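/- **Setting.** For $n\ge 1$ let $\mathbb R[x,\theta]=\mathbb R[x,\theta_1,\dots,\theta_n]$ be the superalgebra of polynomial functions on $\mathbb R^{1|n}$ ($x$ even, $\theta_i$ odd), $\partial_i=\partial/\partial\theta_i$, $F'=\partial_xF$, $\eta_i=\partial_i-\theta_i\partial_x$, and let $|\cdot|$ denote parity. The Lie superalgebra $\mathcal K(n)$ of contact polynomial vector fields consists of the fields $X_F=F\partial_x-\frac12\sum_i(-1)^{|F|}\eta_i(F)\eta_i$, $F\in\mathbb R[x,\theta]$, with $[X_F,X_G]=X_{\{F,G\}}$, $\{F,G\}=FG'-F'G-\frac12(-1)^{|F|}\sum_i\eta_i(F)\eta_i(G)$. For $1\le i\le n$ put $\mathcal K(n-1)^i=\{X_F\in\mathcal K(n)\mid \partial_iF=0\}$ and $\mathcal K(n-1)=\mathcal K(n-1)^n$. For $\lambda,\mu\in\mathbb R$ let $\mathbb L^\lambda_{X_F}=X_F+\lambda F'$, and let $\mathbb D^n_{\lambda,\mu}$ be the space of differential operators $\sum a_{k,\varepsilon}(x,\theta)\,\partial_x^k\partial_1^{\varepsilon_1}\cdots\partial_n^{\varepsilon_n}$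 (finite sums with polynomial coefficients), a $\mathcal K(n)$-module via $X_F\cdot A=\mathbb L^\mu_{X_F}\circ A-(-1)^{|A||F|}A\circ\mathbb L^\lambda_{X_F}$. A differential $1$-cocycle is a linear map $\Upsilon:\mathcal K(n)\to\mathbb D^n_{\lambda,\mu}$ such that $(G,H)\mapsto\Upsilon(X_G)(H)$ is a bilinear differential operator with polynomial coefficients and, for all $F,G$, $$(-1)^{|F||\Upsilon|}X_F\cdot\Upsilon(X_G)-(-1)^{|G|(|F|+|\Upsilon|)}X_G\cdot\Upsilon(X_F)-\Upsilon([X_F,X_G])=0;$$ the space of these is $Z^1_{\rm diff}(\mathcal K(n);\mathbb D^n_{\lambda,\mu})$. The restriction of $\Upsilon$ to a subalgebra $\mathfrak h\subseteq\mathcal K(n)$ is a coboundary if there is $b\in\mathbb D^n_{\lambda,\mu}$ with $\Upsilon(X_F)=\delta b(X_F):=(-1)^{|F||b|}X_F\cdot b$ for all $X_F\in\mathfrak h$; $\Upsilon$ is a coboundary if this holds for $\mathfrak h=\mathcal K(n)$, and nontrivial otherwise. (Formulas with signs are for homogeneous arguments and are extended by linearity.) **Proposition.** 1. (a) Let $(\lambda,\mu)\ne(-\frac12,0)$.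 An element of $Z^1_{\rm diff}(\mathcal K(3);\mathbb D^3_{\lambda,\mu})$ is a coboundary over $\mathcal K(3)$ if and only if its restriction to at least one of the subalgebras $\mathcal K(2)^i$, $i=1,2,3$, is a coboundary. (b) Let $(\lambda,\mu)=(-\frac12,0)$. The formula $$\Upsilon^3_{-\frac12,0}(X_G)=\partial_3(G)\,\eta_1\eta_2-\eta_1\eta_2(\partial_3(G))\,(1-\theta_3\partial_3)-(-1)^{|G|}\theta_3M_{\eta_3(G)}\eta_3,\qquad M_G=(-1)^{|G|}\bigl(\eta_1(G)\eta_2-\eta_2(G)\eta_1\bigr),$$ defines an odd element of $Z^1_{\rm diff}(\mathcal K(3);\mathbb D^3_{-\frac12,0})$ which is nontrivial (not a coboundary over $\mathcal K(3)$) and whose restrictions to $\mathcal K(2)$, $\mathcal K(2)^1$ and $\mathcal K(2)^2$ are coboundaries. It is unique up to a scalar factor and a coboundary: every nontrivial $\Upsilon\in Z^1_{\rm diff}(\mathcal K(3);\mathbb D^3_{-\frac12,0})$ whose restrictions to $\mathcal K(2)$, $\mathcal K(2)^1$ and $\mathcal K(2)^2$ are coboundaries is of the form $c\,\Upsilon^3_{-\frac12,0}+\delta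 b$ with $c\in\mathbb R\setminus\{0\}$ and $b\in\mathbb D^3_{-\frac12,0}$. 2. Let $n>3$ and $\lambda,\mu\in\mathbb R$. An element of $Z^1_{\rm diff}(\mathcal K(n);\mathbb D^n_{\lambda,\mu})$ is a coboundary over $\mathcal K(n)$ if and only if its restriction to at least one of the subalgebras $\mathcal K(n-1)^i$, $1\le i\le n$, is a coboundary. -/

import Mathlib

open scoped TensorProduct

noncomputable section

namespace SuperContact

/-- Polynomial superfunctions `ℝ[x, θ₁, …, θₙ]` on `ℝ^{1|n}`: polynomials in the even variable `x`
tensored with the Grassmann algebra on the odd variables `θ₁, …, θₙ`. The even variable commutes with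
everything, so the ordinary tensor product of algebras carries the correct product. -/
abbrev SFun (n : ℕ) : Type := Polynomial ℝ ⊗[ℝ] ExteriorAlgebra ℝ (Fin n → ℝ)

/-- The odd coordinate `θᵢ` (indices run over `0, …, n - 1`). -/
def theta (n : ℕ) (i : Fin n) : SFun n :=
  1 ⊗ₜ[ℝ] ExteriorAlgebra.ι ℝ (Pi.single i (1 : ℝ))

/-- The even coordinate `x`. -/
def coordX (n : ℕ) : SFun n := (Polynomial.X : Polynomial ℝ) ⊗ₜ[ℝ] 1

/-- `∂ₓ`, written `F ↦ F'`. -/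
def dX (n : ℕ) : SFun n →ₗ[ℝ] SFun n :=
  LinearMap.rTensor (ExteriorAlgebra ℝ (Fin n → ℝ)) (Polynomial.derivative (R := ℝ))

/-- `∂ᵢ = ∂/∂θᵢ`, the left odd derivation with `∂ᵢ x = 0` and `∂ᵢ θⱼ = δᵢⱼ`. -/
def dTheta (n : ℕ) (i : Fin n) : SFun n →ₗ[ℝ] SFun n :=
  LinearMap.lTensor (Polynomial ℝ)
    (CliffordAlgebra.contractLeft (Q := (0 : QuadraticForm ℝ (Fin n → ℝ))) (LinearMap.proj i))

/-- The parity automorphism `F ↦ (-1)^{|F|} F`. -/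
def parity (n : ℕ) : SFun n →ₗ[ℝ] SFun n :=
  LinearMap.lTensor (Polynomial ℝ)
    (CliffordAlgebra.involute (Q := (0 : QuadraticForm ℝ (Fin n → ℝ)))).toLinearMap

/-- Multiplication by the superfunction `a`, as an operator. -/
def mulOp {n : ℕ} (a : SFun n) : SFun n →ₗ[ℝ] SFun n := LinearMap.mulLeft ℝ a

/-- `ηᵢ = ∂ᵢ - θᵢ ∂ₓ`. -/
def eta (n : ℕ) (i : Fin n) : SFun n →ₗ[ℝ] SFun n :=
  dTheta n i - mulOp (theta n i) ∘ₗ dX n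

/-- The sign `(-1)^p`, for `p` a parity. -/
def sgn (p : ZMod 2) : ℝ := if p = 0 then 1 else -1

/-- The component of parity `p` of a superfunction. -/
def funPart {n : ℕ} (p : ZMod 2) : SFun n →ₗ[ℝ] SFun n :=
  (1 / 2 : ℝ) • (LinearMap.id + sgn p • parity n)

/-- The component of parity `p` of a linear operator on superfunctions. -/
def opPart {n : ℕ} (p : ZMod 2) (A : SFun n →ₗ[ℝ] SFun n) : SFun n →ₗ[ℝ] SFun n :=
  (1 / 2 : ℝ) • (A + sgn p • (parity n ∘ₗ A ∘ₗ parity n))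

/-- The contact field `X_F = F ∂ₓ - ½ ∑ᵢ (-1)^{|F|} ηᵢ(F) ηᵢ`, extended linearly in `F`. -/
def contactField (n : ℕ) : SFun n →ₗ[ℝ] (SFun n →ₗ[ℝ] SFun n) :=
  LinearMap.mk₂ ℝ
    (fun F H => F * dX n H - (1 / 2 : ℝ) • ∑ i, eta n i (parity n F) * eta n i H)
    (by
      intro F F' H
      simp only [map_add, add_mul, Finset.sum_add_distrib, smul_add]
      abel)
    (by
      intro c F H
      simp only [map_smul, smul_mul_assoc, ← Finset.smul_sum, smul_sub, smul_comm c])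
    (by
      intro F H H'
      simp only [map_add, mul_add, Finset.sum_add_distrib, smul_add]
      abel)
    (by
      intro c F H
      simp only [map_smul, mul_smul_comm, ← Finset.smul_sum, smul_sub, smul_comm c])

/-- The contact bracket `{F, G} = F G' - F' G - ½ (-1)^{|F|} ∑ᵢ ηᵢ(F) ηᵢ(G)`, extended linearly. -/
def contactBracket {n : ℕ} (F G : SFun n) : SFun n :=
  F * dX n G - dX n F * G - (1 / 2 : ℝ) • ∑ i, eta n i (parity n F) * eta n i G

/-- The action `𝕃^lam_{X_F} = X_F + lam F'` of the contact field `X_F` on densities of weight `lam`. -/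
def densityAction (n : ℕ) (lam : ℝ) : SFun n →ₗ[ℝ] (SFun n →ₗ[ℝ] SFun n) :=
  contactField n + lam • (LinearMap.mul ℝ (SFun n) ∘ₗ dX n)

/-- The operator `∂ₓ^k ∂₁^{ε₁} ⋯ ∂ₙ^{εₙ}`. -/
def monomialOp (n : ℕ) (k : ℕ) (ε : Fin n → Fin 2) : Module.End ℝ (SFun n) :=
  (dX n : Module.End ℝ (SFun n)) ^ k *
    (List.ofFn fun i => (dTheta n i : Module.End ℝ (SFun n)) ^ (ε i : ℕ)).prod

/-- Linear differential operators on `ℝ^{1|n}`: finite sums of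
`a(x, θ) ∂ₓ^k ∂₁^{ε₁} ⋯ ∂ₙ^{εₙ}` with polynomial coefficients. This is the space underlying
`𝔻ⁿ_{lam, mu}` for every `lam` and `mu`. -/
def diffOps (n : ℕ) : Submodule ℝ (SFun n →ₗ[ℝ] SFun n) :=
  Submodule.span ℝ
    {A | ∃ (a : SFun n) (k : ℕ) (ε : Fin n → Fin 2), A = mulOp a ∘ₗ monomialOp n k ε}

/-- Bilinear differential operators: finite sums of
`(G, H) ↦ a(x, θ) · ∂ₓ^k ∂^ε(G) · ∂ₓ^l ∂^ε'(H)` with polynomial coefficients. -/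
def biDiffOps (n : ℕ) : Submodule ℝ (SFun n →ₗ[ℝ] SFun n →ₗ[ℝ] SFun n) :=
  Submodule.span ℝ
    {B | ∃ (a : SFun n) (k l : ℕ) (ε ε' : Fin n → Fin 2),
      B = ((LinearMap.mul ℝ (SFun n)).compl₁₂ (monomialOp n k ε) (monomialOp n l ε')).compr₂
        (mulOp a)}

/-- The action `X_F · A = 𝕃^mu_{X_F} ∘ A - (-1)^{|A||F|} A ∘ 𝕃^lam_{X_F}` on an operator `A` of
parity `q`, for `F` of parity `p`. -/
def opAction {n : ℕ} (lam mu : ℝ) (p q : ZMod 2) (F : SFun n) (A : SFun n →ₗ[ℝ] SFun n) :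
    SFun n →ₗ[ℝ] SFun n :=
  densityAction n mu F ∘ₗ A - sgn (p * q) • (A ∘ₗ densityAction n lam F)

/-- `1`-cochains of `𝒦(n)` with values in linear operators on superfunctions. The map `F ↦ X_F` is a
linear isomorphism onto `𝒦(n)` with `[X_F, X_G] = X_{F, G}`, and a cochain `Υ` is recorded as the
map `F ↦ Υ(X_F)`. -/
abbrev Cochain (n : ℕ) : Type := SFun n →ₗ[ℝ] (SFun n →ₗ[ℝ] SFun n)

/-- The component of parity `q` of a `1`-cochain (parity `q` means that a field of parity `p` is sent
to an operator of parity `p + q`). -/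
def cochainPart {n : ℕ} (q : ZMod 2) (U : Cochain n) : Cochain n :=
  (1 / 2 : ℝ) • (U + sgn q •
    ((LinearMap.llcomp ℝ (SFun n) (SFun n) (SFun n) (parity n)) ∘ₗ
      (LinearMap.lcomp ℝ (SFun n) (parity n)) ∘ₗ U ∘ₗ parity n))

/-- The coboundary of an operator `b`: `δb(X_F) = (-1)^{|F||b|} X_F · b` on homogeneous `F` and `b`,
extended bilinearly. -/
def coboundary {n : ℕ} (lam mu : ℝ) (b : SFun n →ₗ[ℝ] SFun n) (F : SFun n) :
    SFun n →ₗ[ℝ] SFun n :=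
  ∑ p : ZMod 2, ∑ q : ZMod 2, sgn (p * q) • opAction lam mu p q (funPart p F) (opPart q b)

/-- The coboundary of a `1`-cochain: on homogeneous arguments
`δΥ(X_F, X_G) = (-1)^{|F||Υ|} X_F · Υ(X_G) - (-1)^{|G|(|F|+|Υ|)} X_G · Υ(X_F) - Υ([X_F, X_G])`,
extended multilinearly. -/
def coboundary₁ {n : ℕ} (lam mu : ℝ) (U : Cochain n) (F G : SFun n) : SFun n →ₗ[ℝ] SFun n :=
  ∑ p : ZMod 2, ∑ r : ZMod 2, ∑ q : ZMod 2,
    (sgn (p * q) •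
        opAction lam mu p (q + r) (funPart p F) (cochainPart q U (funPart r G))
      - sgn (r * (p + q)) •
        opAction lam mu r (q + p) (funPart r G) (cochainPart q U (funPart p F))
      - cochainPart q U (contactBracket (funPart p F) (funPart r G)))

/-- `Υ ∈ Z¹_diff(𝒦(n); 𝔻ⁿ_{lam, mu})`. -/
def IsDiffCocycle {n : ℕ} (lam mu : ℝ) (U : Cochain n) : Prop :=
  U ∈ biDiffOps n ∧ ∀ F G : SFun n, coboundary₁ lam mu U F G = 0

/-- The (Hamiltonians of the) subalgebra `𝒦(n-1)^i = {X_F ∈ 𝒦(n) | ∂ᵢ F = 0}`. -/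
def subK (n : ℕ) (i : Fin n) : Submodule ℝ (SFun n) := LinearMap.ker (dTheta n i)

/-- The restriction of `Υ` to the subalgebra `{X_F | F ∈ h}` is a coboundary of an element of
`𝔻ⁿ_{lam, mu}`. -/
def IsCoboundaryOn {n : ℕ} (lam mu : ℝ) (h : Submodule ℝ (SFun n)) (U : Cochain n) : Prop :=
  ∃ b ∈ diffOps n, ∀ F ∈ h, U F = coboundary lam mu b F

/-- `Υ` is a coboundary over `𝒦(n)`. -/
def IsCoboundary {n : ℕ} (lam mu : ℝ) (U : Cochain n) : Prop :=
  IsCoboundaryOn lam mu ⊤ U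

/-- `M_G = (-1)^{|G|} (η₁(G) η₂ - η₂(G) η₁)` on `ℝ^{1|3}`. -/
def opM (G : SFun 3) : SFun 3 →ₗ[ℝ] SFun 3 :=
  mulOp (eta 3 0 (parity 3 G)) ∘ₗ eta 3 1 - mulOp (eta 3 1 (parity 3 G)) ∘ₗ eta 3 0

/-- The value on `X_G` of the exceptional cocycle:
`∂₃(G) η₁η₂ - η₁η₂(∂₃(G)) (1 - θ₃∂₃) - (-1)^{|G|} θ₃ M_{η₃(G)} η₃`. -/
def exceptionalFun (G : SFun 3) : SFun 3 →ₗ[ℝ] SFun 3 :=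
  mulOp (dTheta 3 2 G) ∘ₗ eta 3 0 ∘ₗ eta 3 1
    - mulOp (eta 3 0 (eta 3 1 (dTheta 3 2 G))) ∘ₗ
        (LinearMap.id - mulOp (theta 3 2) ∘ₗ dTheta 3 2)
    - mulOp (theta 3 2) ∘ₗ opM (eta 3 2 (parity 3 G)) ∘ₗ eta 3 2

/-- The exceptional cocycle `Υ³_{-1/2, 0}` as a `1`-cochain of `𝒦(3)`. -/
def exceptionalCochain : Cochain 3 where
  toFun := exceptionalFun
  map_add' F G := by
    refine LinearMap.ext fun H => ?_
    simp only [exceptionalFun, opM, mulOp, map_add, LinearMap.sub_apply, LinearMap.add_apply,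
      LinearMap.comp_apply, LinearMap.mulLeft_apply, add_mul, mul_sub, mul_add]
    abel
  map_smul' c F := by
    refine LinearMap.ext fun H => ?_
    simp only [exceptionalFun, opM, mulOp, map_smul, LinearMap.sub_apply, LinearMap.smul_apply,
      LinearMap.comp_apply, LinearMap.mulLeft_apply, smul_mul_assoc, mul_smul_comm, smul_sub,
      mul_sub, RingHom.id_apply]

end SuperContact

end

open scoped TensorProduct

noncomputable section

namespace SuperContact

/-! ### The algebra of superfunctions -/

/-! Only the passage from a subalgebra to 𝒦(n) needs an argument. Composing odd parts with parity
(`twC`, `twOp`) turns cocycles into maps V satisfying the sign rule of even cochains (`IsClean`),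
and coboundaries into plain commutators. Subtracting δb, one may assume V = 0 on the fields with ∂ᵢF
= 0. Then V is determined by V(θᵢ), since {F, θᵢ} = -½F'θᵢ and ∂ₓ is surjective
(`IsClean.eq_zero_of_th`).

Put B = V(θᵢ) ∘ par. Brackets with 1, θⱼ, θⱼθₖ, x, θₐθ_bθ_c and xθⱼθₗ give the relations collected
in `IsInv`. As B commutes with the transitive family ∂ₓ, ∂ⱼ + θⱼ∂ₓ, it is determined by the
functional H ↦ B(H)(0) (`IsInv.eq_zero`). This functional lives in a single degree μ - λ + ½ for x∂ₓ
+ ½E, where E is the Euler operator in the odd variables (`IsInv.weight`). By rotation invariance,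
among monomials containing some θⱼ with j ≠ i it sees only those containing all of them
(`IsInv.rot_ev`). The fields xθⱼθₗ remove x^k for k ≥ 2 and θᵢx^k for k ≥ 1. The surviving values at
1, x and θᵢ are those of the coboundaries of θᵢ, ∂ᵢ and θᵢ∂ᵢ (`kerOp`), which vanish on the
subalgebra for exactly the weights at which these values may be nonzero (`IsClean.eq_adj_kerOp`).

There remain the monomials containing every θⱼ, j ≠ i. For n > 3 a cubic field θₐθ_bθ_c of the
subalgebra kills them (`IsInv.ev_th_mul_eq_zero`). For n = 3 there is no such field, but xθⱼθₗ
yields products of weights that must vanish; together with the degree condition they leave only θⱼθₗ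
at (λ, μ) = (-½, 0) (`IsInv.ev_th_th_mul_eq_zero`). Hence at the exceptional weights one number
obstructs triviality, which is uniqueness.

The exceptional cocycle is cohomologous to multiplication by -η₁η₂η₃(G) (`exc_eq`), which is visibly
invariant under cyclic permutations of the indices. It is a cocycle because η₁η₂η₃ is a cocycle with
values in densities of weight ½ (`vol_bracket`); it is δ(2θᵢηⱼηₖ) on each subalgebra, and it is
nontrivial because its value on θ₁θ₂θ₃ at the origin is nonzero. -/

/-- Superfunctions on `ℝ^{1|n}` as an opaque `ℝ`-algebra: a copy of `SFun n` whose algebraic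
structure is all derived from its ring structure. -/
def SF (n : ℕ) : Type := SFun n

variable {n : ℕ}

instance : Ring (SF n) := inferInstanceAs (Ring (SFun n))

instance : Algebra ℝ (SF n) := inferInstanceAs (Algebra ℝ (SFun n))

namespace SF

/-- The even coordinate. -/
def x : SF n := coordX n

/-- The odd coordinates. -/
def th (i : Fin n) : SF n := theta n i

/-- `∂ₓ` on `SF n`. -/
def dx : SF n →ₗ[ℝ] SF n := dX n

/-- `∂ᵢ` on `SF n`. -/
def dt (i : Fin n) : SF n →ₗ[ℝ] SF n := dTheta n i

/-- The parity automorphism of `SF n`. -/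
def par : SF n →ₗ[ℝ] SF n := parity n

/-! ### Coordinate rules, checked on pure tensors -/

theorem theta_tmul (i : Fin n) (p : Polynomial ℝ) (w : ExteriorAlgebra ℝ (Fin n → ℝ)) :
    theta n i * (p ⊗ₜ[ℝ] w : SFun n)
      = p ⊗ₜ[ℝ] (ExteriorAlgebra.ι ℝ (Pi.single i (1 : ℝ)) * w) := by
  simp [theta]

theorem coordX_tmul (p : Polynomial ℝ) (w : ExteriorAlgebra ℝ (Fin n → ℝ)) :
    coordX n * (p ⊗ₜ[ℝ] w : SFun n) = (Polynomial.X * p) ⊗ₜ[ℝ] w := by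
  simp [coordX]

theorem coordX_pow (k : ℕ) : coordX n ^ k = (Polynomial.X ^ k : Polynomial ℝ) ⊗ₜ[ℝ] 1 := by
  simp [coordX, Algebra.TensorProduct.tmul_pow]

/-- Left induction on the Clifford algebra of the zero form peels off one vector at a time, which is
expanded in the θᵢ; what is left is a multiple of a power of x. This principle takes the place of a
monomial basis in all later calculus. -/
theorem induction_aux {C : SFun n → Prop} (one : C 1)
    (add : ∀ F G, C F → C G → C (F + G)) (smul : ∀ (c : ℝ) F, C F → C (c • F))
    (coord : ∀ F, C F → C (coordX n * F)) (odd : ∀ i F, C F → C (theta n i * F))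
    (F : SFun n) : C F := by
  have zero : C 0 := by simpa using smul 0 1 one
  induction F using TensorProduct.induction_on with
  | zero => exact zero
  | add F G hF hG => exact add F G hF hG
  | tmul p w =>
    induction w using CliffordAlgebra.left_induction with
    | algebraMap r =>
      induction p using Polynomial.induction_on' with
      | add p q hp hq => rw [TensorProduct.add_tmul]; exact add _ _ hp hq
      | monomial k a =>
        have hk : ∀ k, C (coordX n ^ k) := by
          intro k
          induction k with
          | zero => simpa using one
          | succ k ih => rw [pow_succ']; exact coord _ ih
        have : (Polynomial.monomial k a : Polynomial ℝ) ⊗ₜ[ℝ]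
            (algebraMap ℝ (CliffordAlgebra (0 : QuadraticForm ℝ (Fin n → ℝ))) r)
            = (r * a) • coordX n ^ k := by
          rw [coordX_pow, Algebra.algebraMap_eq_smul_one, TensorProduct.tmul_smul, mul_smul,
            TensorProduct.smul_tmul' a, ← Polynomial.C_mul_X_pow_eq_monomial,
            ← Polynomial.smul_eq_C_mul]
        rw [this]
        exact smul _ _ (hk k)
    | add w w' hw hw' => rw [TensorProduct.tmul_add]; exact add _ _ hw hw'
    | ι_mul w v hw =>
      have key : (p ⊗ₜ[ℝ] (CliffordAlgebra.ι (0 : QuadraticForm ℝ (Fin n → ℝ)) v * w) : SFun n)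
          = ∑ i, v i • (theta n i * (p ⊗ₜ[ℝ] w : SFun n)) := by
        have hv : v = ∑ i, v i • (Pi.single i (1 : ℝ) : Fin n → ℝ) := by
          ext j; simp [Finset.sum_apply, Pi.single_apply]
        conv_lhs => rw [hv]
        simp only [map_sum, map_smul, Finset.sum_mul, TensorProduct.tmul_sum, theta_tmul,
          smul_mul_assoc, TensorProduct.tmul_smul]
      rw [key]
      exact Finset.sum_induction _ C add zero fun i _ => smul _ _ (odd i _ hw)

/-- Superfunctions are generated from `1` by left multiplication with the coordinates. -/
theorem induction_left {C : SF n → Prop} (one : C 1)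
    (add : ∀ F G, C F → C G → C (F + G)) (smul : ∀ (c : ℝ) F, C F → C (c • F))
    (coord : ∀ F, C F → C (x * F)) (odd : ∀ i F, C F → C (th i * F)) (F : SF n) : C F :=
  induction_aux (C := C) one add smul coord odd F

theorem dX_tmul (p : Polynomial ℝ) (w : ExteriorAlgebra ℝ (Fin n → ℝ)) :
    dX n (p ⊗ₜ[ℝ] w) = Polynomial.derivative p ⊗ₜ[ℝ] w := by
  simp [dX]

theorem dTheta_tmul (i : Fin n) (p : Polynomial ℝ) (w : ExteriorAlgebra ℝ (Fin n → ℝ)) :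
    dTheta n i (p ⊗ₜ[ℝ] w) = p ⊗ₜ[ℝ]
      (CliffordAlgebra.contractLeft (Q := (0 : QuadraticForm ℝ (Fin n → ℝ))) (LinearMap.proj i) w) := by
  simp [dTheta]

theorem parity_tmul (p : Polynomial ℝ) (w : ExteriorAlgebra ℝ (Fin n → ℝ)) :
    parity n (p ⊗ₜ[ℝ] w) = p ⊗ₜ[ℝ]
      (CliffordAlgebra.involute (Q := (0 : QuadraticForm ℝ (Fin n → ℝ))) w) := by
  simp [parity]

theorem parity_mul_aux (F G : SFun n) : parity n (F * G) = parity n F * parity n G := by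
  induction F using TensorProduct.induction_on with
  | zero => simp
  | add F F' hF hF' => simp only [add_mul, map_add, hF, hF']
  | tmul p w =>
    induction G using TensorProduct.induction_on with
    | zero => simp
    | add F F' hF hF' => simp only [mul_add, map_add, hF, hF']
    | tmul q v =>
      simp only [Algebra.TensorProduct.tmul_mul_tmul, parity_tmul]
      congr 1
      exact map_mul _ _ _

theorem dX_mul_aux (F G : SFun n) : dX n (F * G) = dX n F * G + F * dX n G := by
  induction F using TensorProduct.induction_on with
  | zero => simp
  | add F F' hF hF' => simp only [add_mul, map_add, hF, hF']; abel
  | tmul p w =>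
    induction G using TensorProduct.induction_on with
    | zero => simp
    | add F F' hF hF' => simp only [mul_add, map_add, hF, hF']; abel
    | tmul q v =>
      simp only [Algebra.TensorProduct.tmul_mul_tmul, dX_tmul, Polynomial.derivative_mul,
        TensorProduct.add_tmul]

theorem dTheta_theta_mul_aux (i j : Fin n) (F : SFun n) :
    dTheta n i (theta n j * F) = (if i = j then F else 0) - theta n j * dTheta n i F := by
  induction F using TensorProduct.induction_on with
  | zero => simp
  | add F F' hF hF' => simp only [mul_add, map_add, hF, hF']; split_ifs <;> abel
  | tmul p w =>
    rw [theta_tmul, dTheta_tmul, dTheta_tmul, theta_tmul]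
    have := CliffordAlgebra.contractLeft_ι_mul (Q := (0 : QuadraticForm ℝ (Fin n → ℝ)))
      (LinearMap.proj i) (Pi.single j (1 : ℝ)) w
    refine (congrArg (fun z => p ⊗ₜ[ℝ] z) this).trans ?_
    rw [TensorProduct.tmul_sub]
    congr 1
    simp only [LinearMap.coe_proj, Function.eval, Pi.single_apply]
    split_ifs <;> simp

theorem dTheta_coordX_mul_aux (i : Fin n) (F : SFun n) :
    dTheta n i (coordX n * F) = coordX n * dTheta n i F := by
  induction F using TensorProduct.induction_on with
  | zero => simp
  | add F F' hF hF' => simp only [mul_add, map_add, hF, hF']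
  | tmul p w => rw [coordX_tmul, dTheta_tmul, dTheta_tmul, coordX_tmul]

theorem dX_dTheta_aux (i : Fin n) (F : SFun n) :
    dX n (dTheta n i F) = dTheta n i (dX n F) := by
  induction F using TensorProduct.induction_on with
  | zero => simp
  | add F F' hF hF' => simp only [map_add, hF, hF']
  | tmul p w => rw [dTheta_tmul, dX_tmul, dX_tmul, dTheta_tmul]

theorem dTheta_dTheta_aux (i j : Fin n) (F : SFun n) :
    dTheta n i (dTheta n j F) + dTheta n j (dTheta n i F) = 0 := by
  induction F using TensorProduct.induction_on with
  | zero => simp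
  | add F F' hF hF' =>
    simp only [map_add]
    rw [add_add_add_comm, hF, hF', add_zero]
  | tmul p w =>
    simp only [dTheta_tmul]
    rw [← TensorProduct.tmul_add]
    rw [CliffordAlgebra.contractLeft_comm (Q := (0 : QuadraticForm ℝ (Fin n → ℝ)))]
    rw [neg_add_cancel, TensorProduct.tmul_zero]

theorem coordX_comm_aux (F : SFun n) : F * coordX n = coordX n * F := by
  induction F using TensorProduct.induction_on with
  | zero => simp
  | add F F' hF hF' => simp only [mul_add, add_mul, hF, hF']
  | tmul p w => simp [coordX, mul_comm]

/-! ### Calculus of ∂ₓ, ∂ᵢ and parity on `SF` -/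

theorem dx_mul (F G : SF n) : dx (F * G) = dx F * G + F * dx G := dX_mul_aux F G

theorem par_mul (F G : SF n) : par (F * G) = par F * par G := parity_mul_aux F G

theorem dt_th_mul (i j : Fin n) (F : SF n) :
    dt i (th j * F) = (if i = j then F else 0) - th j * dt i F := dTheta_theta_mul_aux i j F

theorem dt_x_mul (i : Fin n) (F : SF n) : dt i (x * F) = x * dt i F := dTheta_coordX_mul_aux i F

theorem dx_dt (i : Fin n) (F : SF n) : dx (dt i F) = dt i (dx F) := dX_dTheta_aux i F

theorem dt_dt (i j : Fin n) (F : SF n) : dt i (dt j F) = -dt j (dt i F) :=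
  eq_neg_of_add_eq_zero_left (dTheta_dTheta_aux i j F)

theorem mul_x (F : SF n) : F * x = x * F := coordX_comm_aux F

@[simp] theorem par_one : par (1 : SF n) = 1 := by
  have : parity n 1 = 1 := by rw [Algebra.TensorProduct.one_def, parity_tmul]; simp
  exact this

@[simp] theorem dx_one : dx (1 : SF n) = 0 := by
  have : dX n 1 = 0 := by rw [Algebra.TensorProduct.one_def, dX_tmul]; simp
  exact this

@[simp] theorem dt_one (i : Fin n) : dt i (1 : SF n) = 0 := by
  have : dTheta n i 1 = 0 := by rw [Algebra.TensorProduct.one_def, dTheta_tmul]; simp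
  exact this

@[simp] theorem par_th (i : Fin n) : par (th i) = -th i := by
  have : parity n (theta n i) = -theta n i := by
    rw [theta, parity_tmul, ← TensorProduct.tmul_neg]
    congr 1
    exact CliffordAlgebra.involute_ι _
  exact this

@[simp] theorem par_x : par (x : SF n) = x := by
  have : parity n (coordX n) = coordX n := by rw [coordX, parity_tmul]; simp
  exact this

@[simp] theorem dx_th (i : Fin n) : dx (th i) = 0 := by
  have : dX n (theta n i) = 0 := by rw [theta, dX_tmul]; simp
  exact this

@[simp] theorem dx_x : dx (x : SF n) = 1 := by
  have : dX n (coordX n) = 1 := by rw [coordX, dX_tmul]; simp [Algebra.TensorProduct.one_def]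
  exact this

@[simp] theorem dt_x (i : Fin n) : dt i (x : SF n) = 0 := by
  have : dTheta n i (coordX n) = 0 := by rw [coordX, dTheta_tmul]; simp
  exact this

theorem dt_th (i j : Fin n) : dt i (th j) = if i = j then 1 else 0 := by
  simpa using dt_th_mul i j 1

@[simp] theorem dt_th_self (i : Fin n) : dt i (th i) = 1 := by
  simp [dt_th]

@[simp] theorem par_par (F : SF n) : par (par F) = F := by
  induction F using induction_left with
  | one => simp
  | add F F' hF hF' => simp only [map_add, hF, hF']
  | smul c F hF => simp only [map_smul, hF]
  | coord F hF => rw [par_mul, par_mul, hF]; simp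
  | odd j F hF => rw [par_mul, par_mul, hF]; simp

theorem dt_mul (i : Fin n) (F G : SF n) : dt i (F * G) = dt i F * G + par F * dt i G := by
  induction F using induction_left with
  | one => simp
  | add F F' hF hF' => simp only [add_mul, map_add, hF, hF']; abel
  | smul c F hF => simp only [smul_mul_assoc, map_smul, hF, smul_add]
  | coord F hF =>
    rw [mul_assoc, dt_x_mul, hF, dt_x_mul, par_mul, par_x]
    noncomm_ring
  | odd j F hF =>
    rw [mul_assoc, dt_th_mul, hF, dt_th_mul, par_mul, par_th]
    split_ifs <;> noncomm_ring

theorem dx_par (F : SF n) : dx (par F) = par (dx F) := by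
  induction F using induction_left with
  | one => simp
  | add F F' hF hF' => simp only [map_add, hF, hF']
  | smul c F hF => simp only [map_smul, hF]
  | coord F hF => simp [par_mul, dx_mul, hF]
  | odd j F hF => simp [par_mul, dx_mul, hF]

theorem dt_par (i : Fin n) (F : SF n) : dt i (par F) = -par (dt i F) := by
  induction F using induction_left with
  | one => simp
  | add F F' hF hF' => simp only [map_add, hF, hF', neg_add]
  | smul c F hF => simp only [map_smul, hF, smul_neg]
  | coord F hF => simp [par_mul, dt_mul, hF]
  | odd j F hF =>
    rw [par_mul, par_th, neg_mul, map_neg, dt_th_mul, dt_th_mul, hF, map_sub, par_mul, par_th]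
    split_ifs <;> simp

@[simp] theorem dt_dt_self (i : Fin n) (F : SF n) : dt i (dt i F) = 0 := by
  have := dt_dt i i F
  rwa [eq_neg_iff_add_eq_zero, ← two_smul ℝ, smul_eq_zero_iff_right (two_ne_zero' ℝ)] at this

theorem th_mul_th (i j : Fin n) : th i * th j = -(th j * th i : SF n) := by
  have : theta n i * theta n j + theta n j * theta n i = 0 := by
    simp only [theta, Algebra.TensorProduct.tmul_mul_tmul, ← TensorProduct.tmul_add]
    rw [ExteriorAlgebra.ι_add_mul_swap, TensorProduct.tmul_zero]
  exact eq_neg_of_add_eq_zero_left this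

@[simp] theorem th_sq (i : Fin n) : th i * th i = (0 : SF n) := by
  have := th_mul_th i i
  rwa [eq_neg_iff_add_eq_zero, ← two_smul ℝ, smul_eq_zero_iff_right (two_ne_zero' ℝ)] at this

@[simp] theorem th_sq_mul (i : Fin n) (F : SF n) : th i * (th i * F) = 0 := by
  rw [← mul_assoc, th_sq, zero_mul]

theorem th_mul_th_mul (i j : Fin n) (F : SF n) : th i * (th j * F) = -(th j * (th i * F)) := by
  rw [← mul_assoc, th_mul_th, neg_mul, mul_assoc]

theorem mul_th (i : Fin n) (F : SF n) : F * th i = th i * par F := by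
  induction F using induction_left with
  | one => simp
  | add F F' hF hF' => simp only [add_mul, map_add, mul_add, hF, hF']
  | smul c F hF => simp only [map_smul, hF, smul_mul_assoc, mul_smul_comm]
  | coord F hF =>
    rw [mul_assoc, hF, par_mul, par_x, ← mul_assoc, ← mul_x, mul_assoc]
  | odd j F hF =>
    rw [mul_assoc, hF, par_mul, par_th, th_mul_th_mul, neg_mul, mul_neg]

theorem th_mul_x_mul (i : Fin n) (F : SF n) : th i * (x * F) = x * (th i * F) := by
  rw [← mul_assoc, mul_x, mul_assoc]

/-- Supercommutativity without homogeneity hypotheses: F ± par F are twice the even and odd parts of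
F. The two claims are proved together because left multiplication by θⱼ exchanges them. -/
theorem mul_comm_aux (F G : SF n) :
    (F + par F) * G = G * (F + par F) ∧ (F - par F) * G = par G * (F - par F) := by
  induction F using induction_left generalizing G with
  | one => simp [add_mul, mul_add]
  | add F F' hF hF' =>
    have h1 := hF G; have h2 := hF' G
    constructor
    · have : F + F' + par (F + F') = (F + par F) + (F' + par F') := by
        rw [map_add]; abel
      rw [this, add_mul, mul_add, h1.1, h2.1]
    · have : F + F' - par (F + F') = (F - par F) + (F' - par F') := by
        rw [map_add]; abel
      rw [this, add_mul, mul_add, h1.2, h2.2]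
  | smul c F hF =>
    simp only [map_smul, ← smul_add, ← smul_sub, smul_mul_assoc, mul_smul_comm, hF G, and_self]
  | coord F hF =>
    simp only [par_mul, par_x, ← mul_add, ← mul_sub]
    constructor
    · rw [mul_assoc, (hF G).1, ← mul_assoc, ← mul_x, mul_assoc]
    · rw [mul_assoc, (hF G).2, ← mul_assoc, ← mul_x, mul_assoc]
  | odd j F hF =>
    simp only [par_mul, par_th, neg_mul, sub_neg_eq_add, ← mul_add, ← sub_eq_add_neg, ← mul_sub]
    constructor
    · rw [mul_assoc, (hF G).2, ← mul_assoc, ← mul_assoc, mul_th]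
    · rw [mul_assoc, (hF G).1, ← mul_assoc, ← mul_assoc, mul_th, par_par]

theorem mul_comm_of_even {F : SF n} (hF : par F = F) (G : SF n) : F * G = G * F := by
  have h := (mul_comm_aux F G).1
  rw [hF, ← two_smul ℝ F, smul_mul_assoc, mul_smul_comm] at h
  exact smul_right_injective _ (two_ne_zero' ℝ) h

theorem mul_comm_of_odd {F : SF n} (hF : par F = -F) (G : SF n) : F * G = par G * F := by
  have h := (mul_comm_aux F G).2
  rw [hF, sub_neg_eq_add, ← two_smul ℝ F, smul_mul_assoc, mul_smul_comm] at h
  exact smul_right_injective _ (two_ne_zero' ℝ) h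

@[simp] theorem par_x_pow (k : ℕ) : par (x ^ k : SF n) = x ^ k := by
  induction k with
  | zero => simp
  | succ k ih => rw [pow_succ, par_mul, ih, par_x]

@[simp] theorem dt_x_pow (i : Fin n) (k : ℕ) : dt i (x ^ k : SF n) = 0 := by
  induction k with
  | zero => simp
  | succ k ih => rw [pow_succ', dt_x_mul, ih, mul_zero]

theorem dx_x_pow_succ (k : ℕ) : dx (x ^ (k + 1) : SF n) = ((k : ℝ) + 1) • x ^ k := by
  induction k with
  | zero => simp
  | succ k ih =>
    rw [pow_succ', dx_mul, ih, dx_x, one_mul, mul_smul_comm, ← pow_succ']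
    push_cast
    module

/-- A linear map on superfunctions is determined by its values on the powers of `x` and by its
composites with the multiplications by the `θᵢ`. -/
theorem eq_zero_of_pow_of_th {M : Type*} [AddCommGroup M] [Module ℝ M] (T : SF n →ₗ[ℝ] M)
    (hx : ∀ k, T (x ^ k) = 0) (hθ : ∀ i F, T (th i * F) = 0) : T = 0 := by
  have key : ∀ F : SF n, ∀ k, T (x ^ k * F) = 0 := by
    intro F
    induction F using induction_left with
    | one => simpa using hx
    | add F F' hF hF' => intro k; rw [mul_add, map_add, hF, hF', add_zero]
    | smul c F hF => intro k; rw [mul_smul_comm, map_smul, hF, smul_zero]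
    | coord F hF => intro k; rw [← mul_assoc, ← pow_succ]; exact hF _
    | odd i F hF =>
      intro k
      rw [← mul_assoc, mul_th, par_x_pow, mul_assoc, hθ]
  refine LinearMap.ext fun F => ?_
  simpa using key F 0

/-- Integration in x. A prefactor x^k is carried through the induction, so that multiplication by x
only raises k. -/
theorem dx_surjective : Function.Surjective (dx (n := n)) := by
  intro F
  have key : ∀ k : ℕ, ∃ M : SF n, dx M = x ^ k * F := by
    induction F using induction_left with
    | one =>
      intro k
      refine ⟨((k : ℝ) + 1)⁻¹ • x ^ (k + 1), ?_⟩
      rw [map_smul, dx_x_pow_succ, smul_smul, inv_mul_cancel₀ (by positivity), one_smul, mul_one]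
    | add F G hF hG =>
      intro k
      obtain ⟨M, hM⟩ := hF k
      obtain ⟨N, hN⟩ := hG k
      exact ⟨M + N, by rw [map_add, hM, hN, mul_add]⟩
    | smul c F hF =>
      intro k
      obtain ⟨M, hM⟩ := hF k
      exact ⟨c • M, by rw [map_smul, hM, mul_smul_comm]⟩
    | coord F hF =>
      intro k
      obtain ⟨M, hM⟩ := hF (k + 1)
      exact ⟨M, by rw [hM, pow_succ, mul_assoc]⟩
    | odd i F hF =>
      intro k
      obtain ⟨M, hM⟩ := hF k
      refine ⟨th i * M, ?_⟩
      rw [dx_mul, hM, dx_th, zero_mul, zero_add, ← mul_assoc, ← mul_assoc, mul_th, par_x_pow]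
  obtain ⟨M, hM⟩ := key 0
  exact ⟨M, by simpa using hM⟩

/-- Evaluation at the origin. -/
def ev : SF n →ₐ[ℝ] ℝ :=
  (Algebra.TensorProduct.lift (Polynomial.aeval 0) ExteriorAlgebra.algebraMapInv
    fun _ _ => Commute.all _ _ : SFun n →ₐ[ℝ] ℝ)

@[simp] theorem ev_th (i : Fin n) : ev (th i) = 0 := by
  have : (Algebra.TensorProduct.lift (Polynomial.aeval 0) ExteriorAlgebra.algebraMapInv
    fun _ _ => Commute.all _ _ : SFun n →ₐ[ℝ] ℝ) (theta n i) = 0 := by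
    simp [theta, ExteriorAlgebra.algebraMapInv]
  exact this

@[simp] theorem ev_x : ev (x : SF n) = 0 := by
  have : (Algebra.TensorProduct.lift (Polynomial.aeval 0) ExteriorAlgebra.algebraMapInv
    fun _ _ => Commute.all _ _ : SFun n →ₐ[ℝ] ℝ) (coordX n) = 0 := by
    simp [coordX]
  exact this

@[simp] theorem ev_par (F : SF n) : ev (par F) = ev F := by
  induction F using induction_left with
  | one => simp
  | add F F' hF hF' => simp only [map_add, hF, hF']
  | smul c F hF => simp only [map_smul, hF]
  | coord F hF => simp [par_mul]
  | odd j F hF => simp [par_mul]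

/-! ### Contact fields acting on densities -/

/-- `ηᵢ = ∂ᵢ - θᵢ ∂ₓ` on `SF n`. -/
def et (i : Fin n) : SF n →ₗ[ℝ] SF n := dt i - LinearMap.mulLeft ℝ (th i) ∘ₗ dx

/-- `∂ᵢ + θᵢ ∂ₓ`, which is twice the contact field of `θᵢ`. -/
def D (i : Fin n) : SF n →ₗ[ℝ] SF n := dt i + LinearMap.mulLeft ℝ (th i) ∘ₗ dx

/-- The action of the contact field of `F` on densities of weight `lam`. -/
def act (lam : ℝ) : SF n →ₗ[ℝ] SF n →ₗ[ℝ] SF n := densityAction n lam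

theorem et_apply (i : Fin n) (F : SF n) : et i F = dt i F - th i * dx F := rfl

theorem D_apply (i : Fin n) (F : SF n) : D i F = dt i F + th i * dx F := rfl

theorem act_apply (lam : ℝ) (F H : SF n) :
    act lam F H = F * dx H - (1 / 2 : ℝ) • ∑ i, et i (par F) * et i H + lam • (dx F * H) := rfl

/-- The adjoint module of 𝒦(n) is the module of densities of weight -1, so that brackets are handled
by the formulas for `act`. -/
theorem contactBracket_eq (F G : SF n) :
    (show SF n from contactBracket (n := n) F G) = act (-1) F G := by
  have h : (show SF n from contactBracket (n := n) F G)
      = F * dx G - dx F * G - (1 / 2 : ℝ) • ∑ i, et i (par F) * et i G := rfl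
  rw [h, act_apply]
  module

theorem dx_et (i : Fin n) (F : SF n) : dx (et i F) = et i (dx F) := by
  simp only [et_apply, map_sub, dx_mul, dx_th, zero_mul, zero_add, dx_dt]

theorem et_mul (i : Fin n) (F G : SF n) : et i (F * G) = et i F * G + par F * et i G := by
  simp only [et_apply, dt_mul, dx_mul, mul_add, mul_sub, sub_mul]
  rw [← mul_assoc (par F), mul_th, par_par, mul_assoc, mul_assoc]
  abel

theorem et_par (i : Fin n) (F : SF n) : et i (par F) = -par (et i F) := by
  simp only [et_apply, dt_par, dx_par, map_sub, par_mul, par_th]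
  noncomm_ring

theorem par_et_of_even {F : SF n} (hF : par F = F) (i : Fin n) : par (et i F) = -et i F := by
  have := et_par i F
  rw [hF] at this
  exact neg_eq_iff_eq_neg.mp this.symm

theorem par_et_of_odd {F : SF n} (hF : par F = -F) (i : Fin n) : par (et i F) = et i F := by
  have := et_par i F
  rw [hF, map_neg] at this
  exact (neg_injective this).symm

theorem D_par (i : Fin n) (F : SF n) : D i (par F) = -par (D i F) := by
  simp only [D_apply, dt_par, dx_par, map_add, par_mul, par_th]
  noncomm_ring

theorem dx_D (i : Fin n) (F : SF n) : dx (D i F) = D i (dx F) := by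
  simp only [D_apply, map_add, dx_mul, dx_th, zero_mul, zero_add, dx_dt]

theorem et_et (i j : Fin n) (F : SF n) :
    et i (et j F) + et j (et i F) = if i = j then -(2 : ℝ) • dx F else 0 := by
  simp only [et_apply, map_sub, dt_th_mul, dx_mul, dx_th, zero_mul, zero_add, dx_dt,
    dt_dt i j]
  rw [th_mul_th_mul i j]
  by_cases h : i = j
  · subst h; simp only [if_true]; module
  · simp only [h, Ne.symm h, if_false]; abel

theorem et_et_self (i : Fin n) (F : SF n) : et i (et i F) = -dx F := by
  have h := et_et i i F
  rw [if_pos rfl, ← two_smul ℝ, neg_smul, ← smul_neg] at h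
  exact smul_right_injective _ (two_ne_zero' ℝ) h

theorem et_et_swap {i j : Fin n} (h : i ≠ j) (F : SF n) : et i (et j F) = -et j (et i F) :=
  eq_neg_of_add_eq_zero_left (by rw [et_et, if_neg h])

/-! ### Leibniz rules and the representation property of the density action -/

theorem act_mul_even {F A : SF n} (hA : par A = A) (B : SF n) :
    act 0 F (A * B) = act 0 F A * B + A * act 0 F B := by
  simp only [act_apply, dx_mul, et_mul, hA, zero_smul, add_zero, mul_add, sub_mul, mul_sub,
    Finset.sum_add_distrib, smul_add, Finset.sum_mul, Finset.mul_sum, smul_mul_assoc,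
    mul_smul_comm]
  have h1 : ∀ Y Z : SF n, A * (Y * Z) = Y * (A * Z) := fun Y Z => by
    rw [← mul_assoc, mul_comm_of_even hA, mul_assoc]
  simp only [h1, ← mul_assoc]
  abel

theorem even_act_mul {F : SF n} (hF : par F = F) (A B : SF n) :
    act 0 F (A * B) = act 0 F A * B + A * act 0 F B := by
  have hF' := par_et_of_even hF
  have h1 : ∀ Z : SF n, A * (F * Z) = F * (A * Z) := fun Z => by
    rw [← mul_assoc, ← mul_comm_of_even hF, mul_assoc]
  have h2 : ∀ i, ∀ Z : SF n, A * (et i F * Z) = et i F * (par A * Z) := fun i Z => by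
    rw [← mul_assoc, ← mul_assoc, mul_comm_of_odd (hF' i), par_par]
  simp only [act_apply, dx_mul, et_mul, hF, zero_smul, add_zero, mul_add, sub_mul, mul_sub,
    Finset.sum_add_distrib, smul_add, Finset.sum_mul, Finset.mul_sum, smul_mul_assoc,
    mul_smul_comm, h1, h2, ← mul_assoc]
  abel

theorem odd_act_mul {F : SF n} (hF : par F = -F) (A B : SF n) :
    act 0 F (A * B) = act 0 F A * B + par A * act 0 F B := by
  have hF' := par_et_of_odd hF
  have h1 : ∀ Z : SF n, par A * (F * Z) = F * (A * Z) := fun Z => by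
    rw [← mul_assoc, ← mul_comm_of_odd hF, mul_assoc]
  have h2 : ∀ i, ∀ A Z : SF n, A * (et i F * Z) = et i F * (A * Z) := fun i A Z => by
    rw [← mul_assoc, ← mul_comm_of_even (hF' i), mul_assoc]
  simp only [act_apply, dx_mul, et_mul, hF, zero_smul, add_zero, mul_add, sub_mul, mul_sub,
    Finset.sum_add_distrib, smul_add, Finset.sum_mul, Finset.mul_sum, smul_mul_assoc,
    mul_smul_comm, h1, h2 _ (par A), ← mul_assoc, map_neg, neg_mul, mul_neg]
  abel

/-- A contact field preserves the distribution spanned by the ηⱼ: its commutator with ηₖ is a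
combination of the ηⱼ, with no ∂ₓ term. -/
theorem even_act_et {F : SF n} (hF : par F = F) (k : Fin n) (H : SF n) :
    act 0 F (et k H)
      = et k (act 0 F H) + (1 / 2 : ℝ) • ∑ j, et k (et j F) * et j H := by
  have hF' := par_et_of_even hF
  -- Interchanging ηⱼ and ηₖ costs -2δⱼₖ∂ₓ; the resulting multiple of ηₖ(F)∂ₓH cancels the one that
  -- comes from differentiating the coefficient of F∂ₓ.
  have key : ∑ j, et j F * et j (et k H) = - ∑ j, et j F * et k (et j H) - (2 : ℝ) • (et k F * dx H) := by
    rw [← Finset.sum_neg_distrib, eq_sub_iff_add_eq, ← sub_eq_zero, add_sub_right_comm,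
      ← Finset.sum_sub_distrib]
    have : ∀ j, et j F * et j (et k H) - -(et j F * et k (et j H))
        = if j = k then -((2 : ℝ) • (et k F * dx H)) else 0 := fun j => by
      rw [sub_neg_eq_add, ← mul_add, et_et]
      split_ifs with h
      · subst h; simp
      · simp
    simp only [this, Finset.sum_ite_eq', Finset.mem_univ, if_true, neg_add_cancel]
  simp only [act_apply, hF, zero_smul, add_zero, map_sub, map_smul, map_sum, et_mul, dx_et, key,
    Finset.sum_add_distrib, hF', neg_mul, Finset.sum_neg_distrib]
  module

theorem odd_act_et {F : SF n} (hF : par F = -F) (k : Fin n) (H : SF n) :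
    act 0 F (et k H)
      = -et k (act 0 F H) + (1 / 2 : ℝ) • ∑ j, et k (et j F) * et j H := by
  have hF' := par_et_of_odd hF
  have key : ∑ j, et j F * et j (et k H) = - ∑ j, et j F * et k (et j H) - (2 : ℝ) • (et k F * dx H) := by
    rw [← Finset.sum_neg_distrib, eq_sub_iff_add_eq, ← sub_eq_zero, add_sub_right_comm,
      ← Finset.sum_sub_distrib]
    have : ∀ j, et j F * et j (et k H) - -(et j F * et k (et j H))
        = if j = k then -((2 : ℝ) • (et k F * dx H)) else 0 := fun j => by
      rw [sub_neg_eq_add, ← mul_add, et_et]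
      split_ifs with h
      · subst h; simp
      · simp
    simp only [this, Finset.sum_ite_eq', Finset.mem_univ, if_true, neg_add_cancel]
  simp only [act_apply, hF, zero_smul, add_zero, map_sub, map_smul, map_sum, et_mul, dx_et, key,
    Finset.sum_add_distrib, hF', neg_mul, Finset.sum_neg_distrib, map_neg]
  module

theorem act_eq (lam : ℝ) (F H : SF n) : act lam F H = act 0 F H + lam • (dx F * H) := by
  simp only [act_apply, zero_smul, add_zero]

theorem dx_act_zero (F H : SF n) :
    dx (act 0 F H) = act 0 F (dx H) + act 0 (dx F) H := by
  simp only [act_apply, map_sub, map_smul, map_sum, dx_mul, dx_et, zero_smul, add_zero,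
    Finset.sum_add_distrib, dx_par]
  module

/-- Both sides are first-order operators; the proof compares the coefficients of ∂ₓ and of each ηⱼ.
-/
theorem even_act_act_zero {F : SF n} (hF : par F = F) (G H : SF n) :
    act 0 F (act 0 G H) - act 0 G (act 0 F H) = act 0 (act 0 F G - dx F * G) H := by
  have hF' := par_et_of_even hF
  have hdF : par (dx F) = dx F := by rw [← dx_par, hF]
  have e1 : ∀ j, et j (par (act 0 F G - dx F * G)) =
      act 0 F (et j (par G)) - (1 / 2 : ℝ) • ∑ k, et j (et k F) * et k (par G)
      - dx (et j F) * par G - dx F * et j (par G) := fun j => by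
    have : par (act 0 F G) = act 0 F (par G) := by
      simp only [act_apply, map_sub, map_smul, map_sum, par_mul, hF, hF', dx_par, et_par, zero_smul,
        add_zero, neg_mul, mul_neg]
    rw [map_sub, map_sub, this, par_mul, hdF, et_mul, hdF, even_act_et hF, dx_et]
    abel
  have e2 : act 0 F (dx H) = dx (act 0 F H) - dx F * dx H + (1 / 2 : ℝ) • ∑ j, dx (et j F) * et j H := by
    rw [dx_act_zero, act_apply 0 (dx F), hdF]
    simp only [dx_et, zero_smul]
    abel
  have lhs : act 0 F (act 0 G H) - act 0 G (act 0 F H)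
      = (act 0 F G - dx F * G) * dx H
        - (1 / 2 : ℝ) • ∑ j, (act 0 F (et j (par G)) - dx (et j F) * par G
            + (1 / 2 : ℝ) • ∑ k, et k (par G) * et k (et j F)) * et j H := by
    have sw : ∑ k, et k (par G) * ∑ j, et k (et j F) * et j H
        = ∑ j, (∑ k, et k (par G) * et k (et j F)) * et j H := by
      simp only [Finset.mul_sum, Finset.sum_mul, mul_assoc]
      exact Finset.sum_comm
    rw [act_apply 0 G H, act_apply 0 G (act 0 F H)]
    simp only [zero_smul, add_zero, map_sub, map_smul, map_sum, even_act_mul hF, even_act_et hF, e2]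
    have c1 : ∀ j, dx (et j F) * par G = G * dx (et j F) := fun j => by
      rw [mul_comm_of_odd (by rw [← dx_par, hF', map_neg]), par_par]
    have c2 : dx F * G = G * dx F := mul_comm_of_even hdF G
    simp only [c1, c2, mul_add, mul_sub, add_mul, sub_mul, smul_mul_assoc, mul_smul_comm,
      Finset.sum_add_distrib, Finset.sum_sub_distrib, ← Finset.smul_sum, sw,
      mul_assoc]
    simp only [Finset.mul_sum]
    module
  rw [lhs, act_apply 0 (act 0 F G - dx F * G)]
  simp only [zero_smul, add_zero, e1]
  congr 2
  refine Finset.sum_congr rfl fun j _ => ?_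
  congr 1
  have e3 : ∑ k, et k (par G) * et k (et j F)
      = - ∑ k, et j (et k F) * et k (par G) - (2 : ℝ) • (dx F * et j (par G)) := by
    have : ∀ k, et k (par G) * et k (et j F) = - (et j (et k F) * et k (par G))
        + if k = j then -((2 : ℝ) • (dx F * et j (par G))) else 0 := fun k => by
      have hev : par (et k (et j F)) = et k (et j F) := by
        rw [← neg_injective.eq_iff, ← et_par, hF', map_neg]
      rw [← mul_comm_of_even hev, eq_sub_of_add_eq (et_et k j F), sub_mul]
      split_ifs with h
      · subst h; simp only [neg_smul, neg_mul, smul_mul_assoc]; abel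
      · simp
    simp only [this, Finset.sum_add_distrib, Finset.sum_neg_distrib, Finset.sum_ite_eq',
      Finset.mem_univ, if_true, sub_eq_add_neg]
  rw [e3]
  module

/-- The weight term adds only the requirement that F ↦ F' be a cocycle, which is the identity `e1`
for the derivative of the bracket. -/
theorem even_act_act {F : SF n} (hF : par F = F) (lam : ℝ) (G H : SF n) :
    act lam F (act lam G H) - act lam G (act lam F H) = act lam (act (-1) F G) H := by
  have hdF : par (dx F) = dx F := by rw [← dx_par, hF]
  have e := even_act_act_zero hF G H
  have b : act (-1) F G = act 0 F G - dx F * G := by rw [act_eq]; module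
  have e1 : dx (act 0 F G - dx F * G) = act 0 F (dx G) - act 0 G (dx F) := by
    have hF' := par_et_of_even hF
    rw [map_sub, dx_act_zero, dx_mul, act_apply 0 (dx F), act_apply 0 G, hdF]
    have : ∀ i, et i (par G) * et i (dx F) = -(et i (dx F) * et i G) := fun i => by
      rw [← dx_et, mul_comm_of_odd (F := dx (et i F)) (by rw [← dx_par, hF', map_neg]), et_par,
        neg_mul]
    simp only [this, zero_smul, add_zero, Finset.sum_neg_distrib, mul_comm_of_even
      (F := dx (dx F)) (by rw [← dx_par, hdF])]
    module
  rw [b, act_eq lam (act 0 F G - dx F * G), ← e, e1]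
  simp only [act_eq lam, map_add, map_smul, even_act_mul hF, act_mul_even hdF]
  simp only [mul_add, mul_smul_comm, smul_add, sub_mul]
  rw [← mul_assoc (dx F), mul_comm_of_even hdF (dx G), mul_assoc]
  module

theorem odd_act_act_zero {F G : SF n} (hF : par F = -F) (hG : par G = -G) (H : SF n) :
    act 0 F (act 0 G H) + act 0 G (act 0 F H) = act 0 (act 0 F G - dx F * G) H := by
  have hF' := par_et_of_odd hF
  have hG' := par_et_of_odd hG
  have hdF : par (dx F) = -dx F := by rw [← dx_par, hF, map_neg]
  have e1 : ∀ j, et j (par (act 0 F G - dx F * G)) =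
      - act 0 F (et j G) + (1 / 2 : ℝ) • ∑ k, et j (et k F) * et k G
      - dx (et j F) * G + dx F * et j G := fun j => by
    have : par (act 0 F G) = act 0 F G := by
      have hdG : par (dx G) = -dx G := by rw [← dx_par, hG, map_neg]
      simp only [act_apply, map_sub, map_smul, map_sum, par_mul, hF, hF', hG', hdG, zero_smul,
        add_zero, neg_mul, mul_neg, map_neg, neg_neg]
    rw [map_sub, map_sub, this, par_mul, hdF, hG, neg_mul_neg, et_mul, hdF, odd_act_et hF, dx_et,
      neg_mul]
    abel
  have e2 : act 0 F (dx H) = dx (act 0 F H) - dx F * dx H - (1 / 2 : ℝ) • ∑ j, dx (et j F) * et j H := by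
    rw [dx_act_zero, act_apply 0 (dx F), hdF]
    simp only [dx_et, zero_smul, map_neg, neg_mul, Finset.sum_neg_distrib]
    module
  have lhs : act 0 F (act 0 G H) + act 0 G (act 0 F H)
      = (act 0 F G - dx F * G) * dx H
        - (1 / 2 : ℝ) • ∑ j, (- act 0 F (et j G) - dx (et j F) * G
            - (1 / 2 : ℝ) • ∑ k, et k G * et k (et j F)) * et j H := by
    have sw : ∑ k, et k G * ∑ j, et k (et j F) * et j H
        = ∑ j, (∑ k, et k G * et k (et j F)) * et j H := by
      simp only [Finset.mul_sum, Finset.sum_mul, mul_assoc]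
      exact Finset.sum_comm
    rw [act_apply 0 G H, act_apply 0 G (act 0 F H), hG]
    simp only [zero_smul, add_zero, map_sub, map_smul, map_sum, odd_act_mul hF, odd_act_et hF, e2,
      map_neg, neg_mul, hG, hG']
    have c1 : ∀ j, dx (et j F) * G = G * dx (et j F) := fun j =>
      mul_comm_of_even (by rw [← dx_par, hF']) G
    have c2 : dx F * G = - (G * dx F) := by
      rw [mul_comm_of_odd hdF G, hG, neg_mul]
    simp only [c1, c2, mul_add, mul_sub, add_mul, sub_mul, smul_mul_assoc, mul_smul_comm,
      Finset.sum_add_distrib, Finset.sum_sub_distrib, ← Finset.smul_sum, sw,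
      mul_assoc, neg_mul, mul_neg, Finset.sum_neg_distrib]
    simp only [Finset.mul_sum]
    module
  rw [lhs, act_apply 0 (act 0 F G - dx F * G)]
  simp only [zero_smul, add_zero, e1]
  congr 2
  refine Finset.sum_congr rfl fun j _ => ?_
  congr 1
  have e3 : ∑ k, et k G * et k (et j F)
      = - ∑ k, et j (et k F) * et k G - (2 : ℝ) • (dx F * et j G) := by
    have : ∀ k, et k G * et k (et j F) = - (et j (et k F) * et k G)
        + if k = j then -((2 : ℝ) • (dx F * et j G)) else 0 := fun k => by
      rw [mul_comm_of_even (hG' k), eq_sub_of_add_eq (et_et k j F), sub_mul]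
      split_ifs with h
      · subst h; simp only [neg_smul, neg_mul, smul_mul_assoc]; abel
      · simp
    simp only [this, Finset.sum_add_distrib, Finset.sum_neg_distrib, Finset.sum_ite_eq',
      Finset.mem_univ, if_true, sub_eq_add_neg]
  rw [e3]
  module

theorem odd_act_act {F G : SF n} (hF : par F = -F) (hG : par G = -G) (lam : ℝ) (H : SF n) :
    act lam F (act lam G H) + act lam G (act lam F H) = act lam (act (-1) F G) H := by
  have hdF : par (dx F) = -dx F := by rw [← dx_par, hF, map_neg]
  have hdG : par (dx G) = -dx G := by rw [← dx_par, hG, map_neg]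
  have e := odd_act_act_zero hF hG H
  have b : act (-1) F G = act 0 F G - dx F * G := by rw [act_eq]; module
  have e1 : dx (act 0 F G - dx F * G) = act 0 F (dx G) + act 0 G (dx F) := by
    have hF' := par_et_of_odd hF
    rw [map_sub, dx_act_zero, dx_mul, act_apply 0 (dx F), act_apply 0 G, hdF, hG]
    have : ∀ i, et i (-G) * et i (dx F) = et i (-dx F) * et i G := fun i => by
      rw [map_neg, map_neg, neg_mul, neg_mul, ← dx_et,
        mul_comm_of_even (F := dx (et i F)) (by rw [← dx_par, hF'])]
    have h2 : dx (dx F) * G = -(G * dx (dx F)) := by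
      rw [mul_comm_of_odd (by rw [← dx_par, hdF, map_neg]), hG, neg_mul]
    simp only [this, zero_smul, add_zero, h2]
    module
  rw [b, act_eq lam (act 0 F G - dx F * G), ← e, e1]
  simp only [act_eq lam, map_add, map_smul, odd_act_mul hF, odd_act_mul hG, hdF, hdG]
  simp only [mul_add, mul_smul_comm, smul_add, add_mul, neg_mul]
  rw [← mul_assoc (dx F), mul_comm_of_odd hdF (dx G), hdG, neg_mul, neg_mul, mul_assoc]
  module

/-! ### Removing the signs of odd cochains -/

theorem par_act (lam : ℝ) (F H : SF n) : par (act lam F H) = act lam (par F) (par H) := by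
  simp only [act_apply, map_add, map_sub, map_smul, map_sum, par_mul, dx_par, et_par, par_par,
    neg_mul, mul_neg, map_neg]

/-- The plain commutator `F ↦ 𝕃^mu_F b - b 𝕃^lam_F`. -/
def adj (lam mu : ℝ) (b : SF n →ₗ[ℝ] SF n) : SF n →ₗ[ℝ] SF n →ₗ[ℝ] SF n :=
  (act mu).compl₂ b - (act lam).compr₂ b

theorem adj_apply (lam mu : ℝ) (b : SF n →ₗ[ℝ] SF n) (F H : SF n) :
    adj lam mu b F H = act mu F (b H) - b (act lam F H) := rfl

/-- The cocycle identity with the signs of an even cochain. -/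
structure IsClean (lam mu : ℝ) (V : SF n →ₗ[ℝ] SF n →ₗ[ℝ] SF n) : Prop where
  even : ∀ {F}, par F = F → ∀ G H, V (act (-1) F G) H
    = act mu F (V G H) - V G (act lam F H) - (act mu G (V F H) - V F (act lam G H))
  odd : ∀ {F G}, par F = -F → par G = -G → ∀ H, V (act (-1) F G) H
    = act mu F (V G H) + V G (act lam F H) + (act mu G (V F H) + V F (act lam G H))

theorem IsClean.sub {lam mu : ℝ} {V W : SF n →ₗ[ℝ] SF n →ₗ[ℝ] SF n} (hV : IsClean lam mu V)
    (hW : IsClean lam mu W) : IsClean lam mu (V - W) where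
  even hF G H := by
    simp only [LinearMap.sub_apply, map_sub, hV.even hF, hW.even hF]
    abel
  odd hF hG H := by
    simp only [LinearMap.sub_apply, map_sub, hV.odd hF hG, hW.odd hF hG]
    abel

theorem IsClean.smul {lam mu : ℝ} {V : SF n →ₗ[ℝ] SF n →ₗ[ℝ] SF n} (hV : IsClean lam mu V)
    (c : ℝ) : IsClean lam mu (c • V) where
  even hF G H := by
    simp only [LinearMap.smul_apply, map_smul, hV.even hF]
    module
  odd hF hG H := by
    simp only [LinearMap.smul_apply, map_smul, hV.odd hF hG]
    module

theorem isClean_adj (lam mu : ℝ) (b : SF n →ₗ[ℝ] SF n) : IsClean lam mu (adj lam mu b) where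
  even hF G H := by
    simp only [adj_apply, map_sub, ← even_act_act hF]
    abel
  odd hF hG H := by
    simp only [adj_apply, map_sub, map_add, ← odd_act_act hF hG]
    abel

/-- An operator with its odd part composed with the parity automorphism. -/
def twOp (b : SF n →ₗ[ℝ] SF n) : SF n →ₗ[ℝ] SF n :=
  (1 / 2 : ℝ) • (b + par ∘ₗ b ∘ₗ par) + (1 / 2 : ℝ) • (par ∘ₗ b - b ∘ₗ par)

theorem twOp_apply (b : SF n →ₗ[ℝ] SF n) (H : SF n) :
    twOp b H = (1 / 2 : ℝ) • (b H + par (b (par H))) + (1 / 2 : ℝ) • (par (b H) - b (par H)) := rfl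

/-- A cochain with its odd part composed with the parity automorphism. -/
def twC (U : SF n →ₗ[ℝ] SF n →ₗ[ℝ] SF n) : SF n →ₗ[ℝ] SF n →ₗ[ℝ] SF n :=
  (1 / 2 : ℝ) • (U + (U.compl₁₂ par par).compr₂ par)
    + (1 / 2 : ℝ) • (U.compr₂ par - U.compl₁₂ par par)

theorem twC_apply (U : SF n →ₗ[ℝ] SF n →ₗ[ℝ] SF n) (G H : SF n) :
    twC U G H = (1 / 2 : ℝ) • (U G H + par (U (par G) (par H)))
      + (1 / 2 : ℝ) • (par (U G H) - U (par G) (par H)) := rfl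

theorem twC_sub (U W : SF n →ₗ[ℝ] SF n →ₗ[ℝ] SF n) : twC (U - W) = twC U - twC W := by
  refine LinearMap.ext fun G => LinearMap.ext fun H => ?_
  simp only [twC_apply, LinearMap.sub_apply, map_sub]
  module

theorem twC_smul (c : ℝ) (U : SF n →ₗ[ℝ] SF n →ₗ[ℝ] SF n) : twC (c • U) = c • twC U := by
  refine LinearMap.ext fun G => LinearMap.ext fun H => ?_
  simp only [twC_apply, LinearMap.smul_apply, map_smul]
  module

/-- The odd part is composed with parity twice, hence unchanged; passing to the sign-free picture
therefore loses nothing. -/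
theorem twC_twC (U : SF n →ₗ[ℝ] SF n →ₗ[ℝ] SF n) : twC (twC U) = U := by
  refine LinearMap.ext fun G => LinearMap.ext fun H => ?_
  simp only [twC_apply, map_add, map_sub, map_smul, par_par]
  module

/-- The coboundary of an operator as a linear map of the field. -/
def cobL (lam mu : ℝ) (b : SF n →ₗ[ℝ] SF n) : SF n →ₗ[ℝ] SF n →ₗ[ℝ] SF n :=
  twC (adj lam mu (twOp b))

theorem sum_zmod_two {M : Type*} [AddCommMonoid M] (f : ZMod 2 → M) :
    ∑ p, f p = f 0 + f 1 := Fin.sum_univ_two f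

theorem sgn_zero : sgn 0 = 1 := if_pos rfl

theorem sgn_one : sgn 1 = -1 := if_neg (by decide)

theorem coboundary_apply (lam mu : ℝ) (b : SF n →ₗ[ℝ] SF n) (F H : SF n) :
    @Eq (SF n) (coboundary (n := n) lam mu b F H) (cobL lam mu b F H) := by
  have e : @Eq (SF n) (coboundary (n := n) lam mu b F H) (
      ∑ p : ZMod 2, ∑ q : ZMod 2, sgn (p * q) •
      (act mu ((1 / 2 : ℝ) • (F + sgn p • par F))
          ((1 / 2 : ℝ) • (b H + sgn q • par (b (par H))))
        - sgn (p * q) • ((1 / 2 : ℝ) •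
          (b (act lam ((1 / 2 : ℝ) • (F + sgn p • par F)) H)
            + sgn q • par (b (par (act lam ((1 / 2 : ℝ) • (F + sgn p • par F)) H))))))) := by
    simp only [coboundary]
    rfl
  rw [e]
  simp only [sum_zmod_two, mul_zero, mul_one, sgn_zero, sgn_one, cobL, twC_apply,
    adj_apply, twOp_apply, map_add, map_sub, map_smul, LinearMap.add_apply, LinearMap.smul_apply,
    par_act, par_par]
  module

theorem twC_cobL (lam mu : ℝ) (b : SF n →ₗ[ℝ] SF n) :
    twC (cobL lam mu b) = adj lam mu (twOp b) := twC_twC _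

theorem cobL_add (lam mu : ℝ) (b c : SF n →ₗ[ℝ] SF n) :
    cobL lam mu (b + c) = cobL lam mu b + cobL lam mu c := by
  refine LinearMap.ext fun G => LinearMap.ext fun H => ?_
  simp only [cobL, twC_apply, adj_apply, twOp_apply, map_add, map_sub, map_smul,
    LinearMap.add_apply, par_act, par_par]
  module

theorem cobL_smul (lam mu c : ℝ) (b : SF n →ₗ[ℝ] SF n) :
    cobL lam mu (c • b) = c • cobL lam mu b := by
  refine LinearMap.ext fun G => LinearMap.ext fun H => ?_
  simp only [cobL, twC_apply, adj_apply, twOp_apply, map_add, map_sub, map_smul,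
    LinearMap.smul_apply, par_act, par_par]
  module

/-- The summand of `coboundary₁` for homogeneous arguments. -/
def defect (lam mu : ℝ) (U : SF n →ₗ[ℝ] SF n →ₗ[ℝ] SF n) (p r : ZMod 2) (F G H : SF n) : SF n :=
  ∑ q : ZMod 2,
    (sgn (p * q) • (act mu F ((1 / 2 : ℝ) • (U G H + sgn q • par (U (par G) (par H))))
        - sgn (p * (q + r)) • ((1 / 2 : ℝ) • (U G (act lam F H)
            + sgn q • par (U (par G) (par (act lam F H))))))
      - sgn (r * (p + q)) • (act mu G ((1 / 2 : ℝ) • (U F H + sgn q • par (U (par F) (par H))))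
        - sgn (r * (q + p)) • ((1 / 2 : ℝ) • (U F (act lam G H)
            + sgn q • par (U (par F) (par (act lam G H))))))
      - (1 / 2 : ℝ) • (U (act (-1) F G) H + sgn q • par (U (par (act (-1) F G)) (par H))))

theorem coboundary₁_apply (lam mu : ℝ) (U : SF n →ₗ[ℝ] SF n →ₗ[ℝ] SF n) (F G H : SF n) :
    @Eq (SF n) (coboundary₁ (n := n) lam mu U F G H) (∑ p : ZMod 2, ∑ r : ZMod 2,
      defect lam mu U p r ((1 / 2 : ℝ) • (F + sgn p • par F))
        ((1 / 2 : ℝ) • (G + sgn r • par G)) H) := by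
  simp only [coboundary₁, defect, ← contactBracket_eq]
  rfl

theorem defect_even_even {F G : SF n} (hF : par F = F) (hG : par G = G) (lam mu : ℝ)
    (U : SF n →ₗ[ℝ] SF n →ₗ[ℝ] SF n) (H : SF n) :
    defect lam mu U 0 0 F G H = act mu F (U G H) - U G (act lam F H)
      - (act mu G (U F H) - U F (act lam G H)) - U (act (-1) F G) H := by
  simp only [defect, sum_zmod_two, zero_mul, add_zero, sgn_zero, sgn_one, par_act, hF, hG,
    map_add, map_smul]
  module

theorem defect_even_odd {F G : SF n} (hF : par F = F) (hG : par G = -G) (lam mu : ℝ)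
    (U : SF n →ₗ[ℝ] SF n →ₗ[ℝ] SF n) (H : SF n) :
    defect lam mu U 0 1 F G H = act mu F (U G H) - U G (act lam F H)
      - (act mu G (par (U F (par H))) - U F (act lam G H)) - U (act (-1) F G) H := by
  simp only [defect, sum_zmod_two, mul_zero, zero_mul, add_zero, zero_add, mul_one, sgn_zero,
    sgn_one, par_act, hF, hG, map_add, map_smul, map_neg, LinearMap.neg_apply]
  module

theorem defect_odd_even {F G : SF n} (hF : par F = -F) (hG : par G = G) (lam mu : ℝ)
    (U : SF n →ₗ[ℝ] SF n →ₗ[ℝ] SF n) (H : SF n) :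
    defect lam mu U 1 0 F G H = act mu F (par (U G (par H))) - U G (act lam F H)
      - (act mu G (U F H) - U F (act lam G H)) - U (act (-1) F G) H := by
  simp only [defect, sum_zmod_two, zero_mul, add_zero, one_mul, sgn_zero,
    sgn_one, par_act, hF, hG, map_add, map_smul, map_neg, LinearMap.neg_apply]
  module

theorem defect_odd_odd {F G : SF n} (hF : par F = -F) (hG : par G = -G) (lam mu : ℝ)
    (U : SF n →ₗ[ℝ] SF n →ₗ[ℝ] SF n) (H : SF n) :
    defect lam mu U 1 1 F G H = -act mu F (par (U G (par H))) + U G (act lam F H)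
      - (act mu G (par (U F (par H))) - U F (act lam G H)) - U (act (-1) F G) H := by
  have h2 : (1 + 1 : ZMod 2) = 0 := by decide
  simp only [defect, sum_zmod_two, add_zero, zero_add, one_mul, sgn_zero, h2,
    sgn_one, par_act, hF, hG, map_add, map_smul, map_neg, LinearMap.neg_apply]
  module

/-- The homogeneous components of a superfunction. -/
theorem exists_even_add_odd (F : SF n) : ∃ F₀ F₁, par F₀ = F₀ ∧ par F₁ = -F₁ ∧ F = F₀ + F₁ := by
  refine ⟨(1 / 2 : ℝ) • (F + par F), (1 / 2 : ℝ) • (F - par F), ?_, ?_, by module⟩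
  · simp only [map_smul, map_add, par_par]; module
  · simp only [map_smul, map_sub, par_par]; module

theorem defect_zero_left (lam mu : ℝ) (U : SF n →ₗ[ℝ] SF n →ₗ[ℝ] SF n) (p r : ZMod 2) (G H : SF n) :
    defect lam mu U p r 0 G H = 0 := by
  simp [defect]

theorem defect_zero_right (lam mu : ℝ) (U : SF n →ₗ[ℝ] SF n →ₗ[ℝ] SF n) (p r : ZMod 2)
    (F H : SF n) : defect lam mu U p r F 0 H = 0 := by
  simp [defect]

theorem bracket_antisymm_of_even {F : SF n} (hF : par F = F) (G : SF n) :
    act (-1) G F = -act (-1) F G := by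
  have hdF : par (dx F) = dx F := by rw [← dx_par, hF]
  have : ∀ i, et i (par G) * et i F = -(et i F * et i G) := fun i => by
    rw [mul_comm_of_odd (par_et_of_even hF i), et_par, neg_mul]
  simp only [act_apply, hF, this, Finset.sum_neg_distrib, mul_comm_of_even hF,
    mul_comm_of_even hdF]
  module

/-- Parity anticommutes with 𝕃_F for odd F, and this absorbs the signs attached to the odd part of
U. -/
theorem isClean_twC {lam mu : ℝ} {U : SF n →ₗ[ℝ] SF n →ₗ[ℝ] SF n}
    (hU : ∀ F G H, @Eq (SF n) (coboundary₁ (n := n) lam mu U F G H) 0) :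
    IsClean lam mu (twC U) := by
  have h00 : ∀ {F G}, par F = F → par G = G → ∀ H, defect lam mu U 0 0 F G H = 0 := by
    intro F G hF hG H
    have h := hU F G H
    rw [coboundary₁_apply] at h
    simp only [sum_zmod_two, sgn_zero, sgn_one, hF, hG, one_smul, neg_smul, add_neg_cancel,
      smul_zero, defect_zero_left, defect_zero_right, add_zero] at h
    rwa [← two_smul ℝ F, ← two_smul ℝ G, smul_smul, smul_smul, one_div_mul_cancel (by norm_num),
      one_smul, one_smul] at h
  have h01 : ∀ {F G}, par F = F → par G = -G → ∀ H, defect lam mu U 0 1 F G H = 0 := by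
    intro F G hF hG H
    have h := hU F G H
    rw [coboundary₁_apply] at h
    simp only [sum_zmod_two, sgn_zero, sgn_one, hF, hG, one_smul, neg_smul, add_neg_cancel, neg_neg,
      smul_zero, defect_zero_left, defect_zero_right, add_zero, zero_add] at h
    rwa [← two_smul ℝ F, ← two_smul ℝ G, smul_smul, smul_smul, one_div_mul_cancel (by norm_num),
      one_smul, one_smul] at h
  have h11 : ∀ {F G}, par F = -F → par G = -G → ∀ H, defect lam mu U 1 1 F G H = 0 := by
    intro F G hF hG H
    have h := hU F G H
    rw [coboundary₁_apply] at h
    simp only [sum_zmod_two, sgn_zero, sgn_one, hF, hG, one_smul, neg_smul, add_neg_cancel, neg_neg,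
      smul_zero, defect_zero_left, defect_zero_right, zero_add] at h
    rwa [← two_smul ℝ F, ← two_smul ℝ G, smul_smul, smul_smul, one_div_mul_cancel (by norm_num),
      one_smul, one_smul] at h
  constructor
  · intro F hF G H
    obtain ⟨G₀, G₁, h0, h1, rfl⟩ := exists_even_add_odd G
    have a1 := h00 hF h0 H
    have a2 := h00 hF h0 (par H)
    have a3 := congrArg par (h00 hF h0 H)
    have a4 := congrArg par (h00 hF h0 (par H))
    have b1 := h01 hF h1 H
    have b2 := h01 hF h1 (par H)
    have b3 := congrArg par (h01 hF h1 H)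
    have b4 := congrArg par (h01 hF h1 (par H))
    simp only [defect_even_even hF h0, defect_even_odd hF h1, map_sub, map_neg, map_zero, par_act, hF, h0, h1, par_par, LinearMap.neg_apply]
      at a1 a2 a3 a4 b1 b2 b3 b4
    simp only [twC_apply, map_add, map_sub, map_smul, LinearMap.add_apply, par_act, hF, h0, h1,
      map_neg, LinearMap.neg_apply]
    -- Using each identity at H and at par H, and applying parity to both, separates the even and
    -- odd parts of U; the coefficients ±½ are those in `twC`.
    linear_combination (norm := module) (-(1 / 2 : ℝ)) • a1 - (1 / 2 : ℝ) • a3 + (1 / 2 : ℝ) • a2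
      - (1 / 2 : ℝ) • a4 + (-(1 / 2 : ℝ)) • b1 - (1 / 2 : ℝ) • b3 - (1 / 2 : ℝ) • b2
      + (1 / 2 : ℝ) • b4
  · intro F G hF hG H
    have a1 := h11 hF hG H
    have a2 := h11 hF hG (par H)
    have a3 := congrArg par (h11 hF hG H)
    have a4 := congrArg par (h11 hF hG (par H))
    simp only [defect_odd_odd hF hG, map_sub, map_neg, map_zero, map_add,
      par_act, hF, hG, par_par, LinearMap.neg_apply] at a1 a2 a3 a4
    simp only [twC_apply, map_add, map_sub, map_smul, par_act, hF, hG,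
      map_neg, LinearMap.neg_apply, neg_neg]
    linear_combination (norm := module) (-(1 / 2 : ℝ)) • a1 - (1 / 2 : ℝ) • a3 + (1 / 2 : ℝ) • a2
      - (1 / 2 : ℝ) • a4

/-- Converse of `isClean_twC`, by which the exceptional cochain is recognised as a cocycle. The
odd–even case reduces to the even–odd one by antisymmetry of the bracket. -/
theorem coboundary₁_eq_zero {lam mu : ℝ} {U : SF n →ₗ[ℝ] SF n →ₗ[ℝ] SF n}
    (hU : IsClean lam mu (twC U)) (F G H : SF n) :
    @Eq (SF n) (coboundary₁ (n := n) lam mu U F G H) 0 := by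
  have key : ∀ F G, U F G = (1 / 2 : ℝ) • (twC U F G + par (twC U (par F) (par G)))
      + (1 / 2 : ℝ) • (par (twC U F G) - twC U (par F) (par G)) := fun F G => by
    rw [← twC_apply, twC_twC]
  rw [coboundary₁_apply]
  generalize twC U = V at hU key
  have h00 : ∀ {F G}, par F = F → par G = G → defect lam mu U 0 0 F G H = 0 := by
    intro F G hF hG
    have a1 := hU.even hF G H
    have a2 := hU.even hF G (par H)
    have a3 := congrArg par a1
    have a4 := congrArg par a2
    rw [defect_even_even hF hG]
    simp only [map_sub, par_act, hF, hG] at a1 a2 a3 a4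
    simp only [key, map_add, map_sub, map_smul, par_act, hF, hG]
    linear_combination (norm := module) (-(1 / 2 : ℝ)) • a1 - (1 / 2 : ℝ) • a3 + (1 / 2 : ℝ) • a2
      - (1 / 2 : ℝ) • a4
  have h01 : ∀ {F G}, par F = F → par G = -G → defect lam mu U 0 1 F G H = 0 := by
    intro F G hF hG
    have a1 := hU.even hF G H
    have a2 := hU.even hF G (par H)
    have a3 := congrArg par a1
    have a4 := congrArg par a2
    rw [defect_even_odd hF hG]
    simp only [map_sub, map_neg, LinearMap.neg_apply, par_act, hF, hG] at a1 a2 a3 a4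
    simp only [key, map_add, map_sub, map_smul, map_neg, LinearMap.neg_apply, par_act, hF, hG,
      par_par]
    linear_combination (norm := module) (-(1 / 2 : ℝ)) • a1 - (1 / 2 : ℝ) • a3 - (1 / 2 : ℝ) • a2
      + (1 / 2 : ℝ) • a4
  have h10 : ∀ {F G}, par F = -F → par G = G → defect lam mu U 1 0 F G H = 0 := by
    intro F G hF hG
    have e := h01 hG hF
    rw [defect_even_odd hG hF] at e
    rw [defect_odd_even hF hG, bracket_antisymm_of_even hG, map_neg, LinearMap.neg_apply]
    linear_combination (norm := module) (-(1 : ℝ)) • e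
  have h11 : ∀ {F G}, par F = -F → par G = -G → defect lam mu U 1 1 F G H = 0 := by
    intro F G hF hG
    have a1 := hU.odd hF hG H
    have a2 := hU.odd hF hG (par H)
    have a3 := congrArg par a1
    have a4 := congrArg par a2
    rw [defect_odd_odd hF hG]
    simp only [map_add, map_neg, LinearMap.neg_apply, par_act, hF, hG]
      at a1 a2 a3 a4
    simp only [key, map_add, map_sub, map_smul, map_neg, LinearMap.neg_apply, par_act, hF, hG,
      par_par, neg_neg]
    linear_combination (norm := module) (-(1 / 2 : ℝ)) • a1 - (1 / 2 : ℝ) • a3 + (1 / 2 : ℝ) • a2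
      - (1 / 2 : ℝ) • a4
  have p0 : ∀ F : SF n, par ((1 / 2 : ℝ) • (F + (1 : ℝ) • par F)) = (1 / 2 : ℝ) • (F + (1 : ℝ) • par F) := by
    intro F; simp only [map_smul, map_add, par_par]; module
  have p1 : ∀ F : SF n, par ((1 / 2 : ℝ) • (F + (-1 : ℝ) • par F))
      = -((1 / 2 : ℝ) • (F + (-1 : ℝ) • par F)) := by
    intro F; simp only [map_smul, map_add, par_par]; module
  simp only [sum_zmod_two, sgn_zero, sgn_one, h00 (p0 _) (p0 _), h01 (p0 _) (p1 _),
    h10 (p1 _) (p0 _), h11 (p1 _) (p1 _), add_zero]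

/-! ### Separation of superfunctions by invariant operators -/

/-- Restriction of a superfunction to `θ = 0`. -/
def rest : SF n →ₐ[ℝ] Polynomial ℝ :=
  (Algebra.TensorProduct.lift (AlgHom.id ℝ _)
    ((Algebra.ofId ℝ (Polynomial ℝ)).comp ExteriorAlgebra.algebraMapInv)
    fun _ _ => Commute.all _ _ : SFun n →ₐ[ℝ] Polynomial ℝ)

/-- Polynomials in `x` as superfunctions. -/
def ofPoly : Polynomial ℝ →ₐ[ℝ] SF n := Polynomial.aeval x

@[simp] theorem rest_th (i : Fin n) : rest (th i) = 0 := by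
  have : (Algebra.TensorProduct.lift (AlgHom.id ℝ _)
    ((Algebra.ofId ℝ (Polynomial ℝ)).comp ExteriorAlgebra.algebraMapInv)
    fun _ _ => Commute.all _ _ : SFun n →ₐ[ℝ] Polynomial ℝ) (theta n i) = 0 := by
    simp [theta, ExteriorAlgebra.algebraMapInv]
  exact this

@[simp] theorem rest_x : rest (x : SF n) = Polynomial.X := by
  have : (Algebra.TensorProduct.lift (AlgHom.id ℝ _)
    ((Algebra.ofId ℝ (Polynomial ℝ)).comp ExteriorAlgebra.algebraMapInv)
    fun _ _ => Commute.all _ _ : SFun n →ₐ[ℝ] Polynomial ℝ) (coordX n) = Polynomial.X := by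
    simp [coordX]
  exact this

theorem rest_dx (F : SF n) : rest (dx F) = Polynomial.derivative (rest F) := by
  induction F using induction_left with
  | one => simp
  | add F F' hF hF' => simp only [map_add, hF, hF']
  | smul c F hF => simp only [map_smul, hF]
  | coord F hF => simp [dx_mul, hF]
  | odd j F hF => simp [dx_mul]

/-- The projection onto the joint kernel of the `∂ⱼ` with `j` in a list. -/
def proj : List (Fin n) → SF n →ₗ[ℝ] SF n
  | [] => LinearMap.id
  | j :: l => dt j ∘ₗ LinearMap.mulLeft ℝ (th j) ∘ₗ proj l

theorem proj_cons (j : Fin n) (l : List (Fin n)) (F : SF n) :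
    proj (j :: l) F = dt j (th j * proj l F) := rfl

theorem proj_of_dt_eq_zero {F : SF n} (hF : ∀ j, dt j F = 0) (l : List (Fin n)) :
    proj l F = F := by
  induction l with
  | nil => rfl
  | cons j l ih => rw [proj_cons, ih, dt_th_mul, hF]; simp

theorem proj_th_mul (j : Fin n) (l : List (Fin n)) (F : SF n) :
    proj l (th j * F) = if j ∈ l then 0 else th j * proj l F := by
  induction l with
  | nil => rfl
  | cons s l ih =>
    rw [proj_cons, ih]
    by_cases h : j ∈ l
    · simp [h]
    · by_cases hs : j = s
      · subst hs; simp [h]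
      · simp only [h, hs, if_false, List.mem_cons, or_self, proj_cons]
        rw [th_mul_th_mul, map_neg, dt_th_mul, if_neg (Ne.symm hs), zero_sub, neg_neg]

/-- The projection onto the joint kernel of all ∂ⱼ and the restriction to θ = 0 agree on powers of
x, and both kill multiples of the θᵢ. -/
theorem eq_ofPoly_rest {F : SF n} (hF : ∀ j, dt j F = 0) : F = ofPoly (rest F) := by
  have h : proj (List.finRange n) - (ofPoly (n := n)).toLinearMap ∘ₗ (rest (n := n)).toLinearMap = 0 := by
    refine eq_zero_of_pow_of_th _ (fun k => ?_) fun i F => ?_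
    · simp [proj_of_dt_eq_zero, ofPoly]
    · simp [proj_th_mul]
  have := LinearMap.congr_fun h F
  rw [LinearMap.sub_apply, proj_of_dt_eq_zero hF, LinearMap.zero_apply, sub_eq_zero] at this
  exact this

theorem eq_zero_of_const {F : SF n} (hdx : dx F = 0) (hF : ∀ j, dt j F = 0) (hev : ev F = 0) :
    F = 0 := by
  have h1 := rest_dx F
  rw [hdx, map_zero] at h1
  have h2 := eq_ofPoly_rest hF
  rw [Polynomial.eq_C_of_derivative_eq_zero h1.symm] at h2
  have h3 : F = algebraMap ℝ (SF n) ((rest F).coeff 0) := by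
    conv_lhs => rw [h2]
    simp [ofPoly]
  rw [h3, AlgHom.commutes] at hev
  rw [h3]
  have : (rest F).coeff 0 = 0 := hev
  rw [this, map_zero]

theorem exists_dx_pow_eq_zero (F : SF n) : ∃ a, (dx ^ a : Module.End ℝ (SF n)) F = 0 := by
  induction F using induction_left with
  | one => exact ⟨1, by simp⟩
  | add F G hF hG =>
    obtain ⟨a, ha⟩ := hF
    obtain ⟨b, hb⟩ := hG
    refine ⟨a + b, ?_⟩
    have h1 : (dx ^ (a + b) : Module.End ℝ (SF n)) F = 0 := by
      rw [add_comm, pow_add, Module.End.mul_apply, ha, map_zero]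
    rw [map_add, h1, pow_add, Module.End.mul_apply, hb, map_zero, add_zero]
  | smul c F hF =>
    obtain ⟨a, ha⟩ := hF
    exact ⟨a, by rw [map_smul, ha, smul_zero]⟩
  | coord F hF =>
    obtain ⟨a, ha⟩ := hF
    have key : ∀ a : ℕ, (dx ^ (a + 1) : Module.End ℝ (SF n)) (x * F)
        = x * (dx ^ (a + 1) : Module.End ℝ (SF n)) F
          + ((a : ℝ) + 1) • (dx ^ a : Module.End ℝ (SF n)) F := by
      intro a
      induction a with
      | zero => simp [dx_mul, add_comm]
      | succ a ih =>
        rw [pow_succ', Module.End.mul_apply, ih, map_add, dx_mul, map_smul, dx_x, one_mul,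
          Module.End.mul_apply, ← Module.End.mul_apply dx (dx ^ a), ← pow_succ']
        push_cast
        module
    refine ⟨a + 1, ?_⟩
    rw [key, pow_succ', Module.End.mul_apply, ha]
    simp
  | odd i F hF =>
    obtain ⟨a, ha⟩ := hF
    refine ⟨a, ?_⟩
    have key : ∀ a : ℕ, (dx ^ a : Module.End ℝ (SF n)) (th i * F)
        = th i * (dx ^ a : Module.End ℝ (SF n)) F := by
      intro a
      induction a with
      | zero => simp
      | succ a ih =>
        rw [pow_succ', Module.End.mul_apply, ih, dx_mul, Module.End.mul_apply]
        simp
    rw [key, ha, mul_zero]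

theorem D_D (i j : Fin n) (F : SF n) : D i (D j F) + D j (D i F)
    = if i = j then (2 : ℝ) • dx F else 0 := by
  simp only [D_apply, map_add, dt_th_mul, dx_mul, dx_th, zero_mul, zero_add, dx_dt,
    dt_dt i j]
  rw [th_mul_th_mul i j]
  by_cases h : i = j
  · subst h; simp only [if_true]; module
  · simp only [h, Ne.symm h, if_false]; abel

theorem D_D_self (i : Fin n) (F : SF n) : D i (D i F) = dx F := by
  have h := D_D i i F
  rw [if_pos rfl, ← two_smul ℝ] at h
  exact smul_right_injective _ (two_ne_zero' ℝ) h

/-- A set of superfunctions vanishing at the origin and stable under the translation-invariant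
operators `∂ₓ` and `∂ⱼ + θⱼ ∂ₓ` contains at most `0`. -/
theorem eq_zero_of_stable {W : Set (SF n)} (hdx : ∀ F ∈ W, dx F ∈ W)
    (hD : ∀ j, ∀ F ∈ W, D j F ∈ W) (hev : ∀ F ∈ W, ev F = 0) : ∀ F ∈ W, F = 0 := by
  -- The list l contains the indices j for which D j F may still be nonzero. On functions killed by
  -- ∂ₓ the operators D j anticommute and square to zero, so D j F needs a shorter list than F.
  have h1 : ∀ l : List (Fin n), ∀ F ∈ W, dx F = 0 → (∀ j, j ∉ l → D j F = 0) → F = 0 := by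
    intro l
    induction l with
    | nil =>
      intro F hF h0 hj
      refine eq_zero_of_const h0 (fun j => ?_) (hev F hF)
      have := hj j (by simp)
      rwa [D_apply, h0, mul_zero, add_zero] at this
    | cons j l ih =>
      intro F hF h0 hj
      have hj' : D j F = 0 := by
        refine ih _ (hD j F hF) (by rw [dx_D, h0, map_zero]) fun s hs => ?_
        by_cases hsj : s = j
        · subst hsj; rw [D_D_self, h0]
        · have := D_D s j F
          rwa [if_neg hsj, hj s (by simp [hsj, hs]), map_zero, add_zero] at this
      refine ih F hF h0 fun s hs => ?_
      by_cases hsj : s = j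
      · subst hsj; exact hj'
      · exact hj s (by simp [hsj, hs])
  -- Induction on the order of nilpotency of ∂ₓ at F: the induction hypothesis gives ∂ₓF = 0, and
  -- `h1` applies.
  have h2 : ∀ a : ℕ, ∀ F ∈ W, (dx ^ a : Module.End ℝ (SF n)) F = 0 → F = 0 := by
    intro a
    induction a with
    | zero => intro F _ h; simpa using h
    | succ a ih =>
      intro F hF h
      rw [pow_succ, Module.End.mul_apply] at h
      exact h1 (List.finRange n) F hF (ih _ (hdx F hF) h) (by simp)
  intro F hF
  obtain ⟨a, ha⟩ := exists_dx_pow_eq_zero F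
  exact h2 a F hF ha

/-! ### Explicit contact fields -/

/-- The Euler operator in the odd variables. -/
def eul : SF n →ₗ[ℝ] SF n := ∑ s, LinearMap.mulLeft ℝ (th s) ∘ₗ dt s

theorem eul_apply (F : SF n) : eul F = ∑ s, th s * dt s F := by
  simp [eul]

theorem eul_th_mul (j : Fin n) (F : SF n) : eul (th j * F) = th j * F + th j * eul F := by
  have : ∀ s, th s * dt s (th j * F) = (if s = j then th j * F else 0) + th j * (th s * dt s F) :=
    fun s => by
      rw [dt_th_mul, mul_sub, th_mul_th_mul s j, sub_neg_eq_add]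
      by_cases h : s = j
      · subst h; simp
      · simp [h]
  simp only [eul_apply, this, Finset.sum_add_distrib, Finset.sum_ite_eq', Finset.mem_univ, if_true,
    Finset.mul_sum]

@[simp] theorem eul_x_pow (k : ℕ) : eul (x ^ k : SF n) = 0 := by
  simp [eul_apply]

theorem et_th_mul (s j : Fin n) (F : SF n) :
    et s (th j * F) = (if s = j then F else 0) - th j * et s F := by
  simp only [et_apply, dt_th_mul, dx_mul, dx_th, zero_mul, zero_add, mul_sub]
  rw [th_mul_th_mul s j]
  abel

theorem et_x_mul (s : Fin n) (F : SF n) : et s (x * F) = x * et s F - th s * F := by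
  simp only [et_apply, dt_x_mul, dx_mul, dx_x, one_mul, mul_add, mul_sub]
  rw [th_mul_x_mul]
  abel

@[simp] theorem et_one (s : Fin n) : et s (1 : SF n) = 0 := by simp [et_apply]

theorem et_th (s j : Fin n) : et s (th j) = if s = j then 1 else 0 := by
  simpa using et_th_mul s j 1

theorem D_th_mul (s j : Fin n) (F : SF n) :
    D s (th j * F) = (if s = j then F else 0) - th j * D s F := by
  simp only [D_apply, dt_th_mul, dx_mul, dx_th, zero_mul, zero_add, mul_add]
  rw [th_mul_th_mul s j]
  abel

theorem D_x_mul (s : Fin n) (F : SF n) : D s (x * F) = th s * F + x * D s F := by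
  simp only [D_apply, dt_x_mul, dx_mul, dx_x, one_mul, mul_add]
  rw [th_mul_x_mul]
  abel

theorem D_x_pow_succ (s : Fin n) (k : ℕ) :
    D s (x ^ (k + 1) : SF n) = ((k : ℝ) + 1) • (th s * x ^ k) := by
  rw [D_apply, dt_x_pow, dx_x_pow_succ, zero_add, mul_smul_comm]

theorem act_one (lam : ℝ) (H : SF n) : act lam 1 H = dx H := by
  simp [act_apply]

theorem act_th (lam : ℝ) (j : Fin n) (H : SF n) : act lam (th j) H = (1 / 2 : ℝ) • D j H := by
  simp only [act_apply, par_th, map_neg, neg_mul, et_th, ite_mul, one_mul, zero_mul, dx_th,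
    Finset.sum_neg_distrib, Finset.sum_ite_eq', Finset.mem_univ, if_true]
  rw [et_apply, D_apply]
  module

theorem th_mul_et (s : Fin n) (H : SF n) : th s * et s H = th s * dt s H := by
  rw [et_apply, mul_sub, th_sq_mul, sub_zero]

theorem act_x (lam : ℝ) (H : SF n) :
    act lam x H = x * dx H + (1 / 2 : ℝ) • eul H + lam • H := by
  have : ∀ s, et s (x : SF n) = -th s := fun s => by
    simpa using et_x_mul s (1 : SF n)
  simp only [act_apply, par_x, this, neg_mul, th_mul_et, Finset.sum_neg_distrib, dx_x, one_mul,
    eul_apply]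
  module

theorem act_th_th (lam : ℝ) {j k : Fin n} (h : j ≠ k) (H : SF n) :
    act lam (th j * th k) H = -(1 / 2 : ℝ) • (th k * dt j H - th j * dt k H) := by
  have : ∀ s, et s (th j * th k) * et s H
      = (if s = j then th k * et j H else 0) - (if s = k then th j * et k H else 0) := fun s => by
    rw [et_th_mul, et_th]
    by_cases h1 : s = j
    · subst h1; simp [h]
    · by_cases h2 : s = k
      · subst h2; simp [h1]
      · simp [h1, h2]
  simp only [act_apply, par_mul, par_th, neg_mul_neg, this, Finset.sum_sub_distrib,
    Finset.sum_ite_eq', Finset.mem_univ, if_true, dx_mul, dx_th, zero_mul, mul_zero, add_zero,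
    smul_zero]
  rw [et_apply, et_apply, mul_sub, mul_sub, th_mul_th_mul k j, mul_assoc]
  module

theorem act_x_th_th (lam : ℝ) {j l : Fin n} (h : j ≠ l) (H : SF n) :
    act lam (x * (th j * th l)) H = -(1 / 2 : ℝ) • (x * (th l * dt j H - th j * dt l H))
      + th j * (th l * (lam • H + (1 / 2 : ℝ) • eul H)) := by
  have : ∀ s, et s (x * (th j * th l)) * et s H
      = (if s = j then x * (th l * et j H) else 0) - (if s = l then x * (th j * et l H) else 0)
        - th j * (th l * (th s * dt s H)) := fun s => by
    rw [et_x_mul, sub_mul, et_th_mul, et_th]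
    have e : th s * (th j * th l) * et s H = th j * (th l * (th s * dt s H)) := by
      rw [← th_mul_et, mul_assoc, mul_assoc, th_mul_th_mul s j, th_mul_th_mul s l]
      simp
    rw [e]
    by_cases h1 : s = j
    · subst h1; simp [h, mul_assoc]
    · by_cases h2 : s = l
      · subst h2; simp [h1, mul_assoc]
      · simp [h1, h2]
  simp only [act_apply, par_mul, par_th, par_x, neg_mul_neg, this, Finset.sum_sub_distrib,
    Finset.sum_ite_eq', Finset.mem_univ, if_true, dx_mul, dx_th, zero_mul, mul_zero, add_zero,
    dx_x, one_mul, eul_apply, ← Finset.mul_sum]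
  rw [et_apply, et_apply, mul_sub, mul_sub, th_mul_th_mul l j, mul_assoc, mul_assoc, mul_assoc]
  simp only [mul_sub, mul_add, mul_neg, mul_smul_comm]
  module

theorem act_th_th_th (lam : ℝ) {a b c : Fin n} (hab : a ≠ b) (hac : a ≠ c) (hbc : b ≠ c)
    (H : SF n) : act lam (th a * (th b * th c)) H
      = (1 / 2 : ℝ) • (th b * (th c * dt a H) - th a * (th c * dt b H) + th a * (th b * dt c H))
        - (1 / 2 : ℝ) • (th a * (th b * (th c * dx H))) := by
  have : ∀ s, et s (th a * (th b * th c)) * et s H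
      = (if s = a then th b * (th c * et a H) else 0) - (if s = b then th a * (th c * et b H) else 0)
        + (if s = c then th a * (th b * et c H) else 0) := fun s => by
    rw [et_th_mul, et_th_mul, et_th]
    by_cases h1 : s = a
    · subst h1; simp [hab, hac, mul_assoc]
    · by_cases h2 : s = b
      · subst h2; simp [h1, hbc, mul_assoc]
      · by_cases h3 : s = c
        · subst h3; simp [h1, h2, mul_assoc]
        · simp [h1, h2, h3]
  have hp : par (th a * (th b * th c)) = -(th a * (th b * th c)) := by
    simp only [par_mul, par_th, neg_mul, mul_neg, neg_neg]
  simp only [act_apply, hp, neg_mul, map_neg, this,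
    Finset.sum_sub_distrib, Finset.sum_add_distrib, Finset.sum_neg_distrib,
    Finset.sum_ite_eq', Finset.mem_univ, if_true, dx_mul, dx_th, zero_mul, mul_zero, add_zero,
    smul_zero]
  simp only [et_apply, mul_sub, mul_assoc]
  rw [th_mul_th_mul c a, mul_neg, th_mul_th_mul b a, th_mul_th_mul c b]
  simp only [mul_neg]
  module

/-! ### Operators invariant under a subalgebra of codimension one -/

/-- The invariance properties of the value at `θᵢ` (composed with parity) of a cocycle that vanishes
on the fields not depending on `θᵢ`. -/
structure IsInv (lam mu : ℝ) (i : Fin n) (B : SF n →ₗ[ℝ] SF n) : Prop where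
  comm_dx : ∀ H, dx (B H) = B (dx H)
  comm_D : ∀ j H, D j (B H) = B (D j H)
  rot : ∀ {j k}, j ≠ i → k ≠ i → j ≠ k → ∀ H,
    th k * dt j (B H) - th j * dt k (B H) = B (th k * dt j H - th j * dt k H)
  euler : ∀ H, x * dx (B H) + (1 / 2 : ℝ) • eul (B H) + (mu - lam + 1 / 2) • B H
    = B (x * dx H + (1 / 2 : ℝ) • eul H)
  cubic : ∀ {a b c}, a ≠ i → b ≠ i → c ≠ i → a ≠ b → a ≠ c → b ≠ c → ∀ H,
    act mu (th a * (th b * th c)) (B H) = B (act lam (th a * (th b * th c)) H)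
  quad : ∀ {j l}, j ≠ i → l ≠ i → j ≠ l → ∀ H,
    act mu (x * (th j * th l)) (act mu (x * (th j * th l)) (B H))
      - (2 : ℝ) • act mu (x * (th j * th l)) (B (act lam (x * (th j * th l)) H))
      + B (act lam (x * (th j * th l)) (act lam (x * (th j * th l)) H)) = 0

/-- For F in the subalgebra, θᵢ is moved only through F'. Hence fields with F' = 0 yield exact
invariance of V(θᵢ), and x yields a weight. -/
theorem bracket_th {i : Fin n} {F : SF n} (hF : dt i F = 0) :
    act (-1) F (th i) = -(1 / 2 : ℝ) • (dx F * th i) := by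
  have e : et i (par F) = -(dx F * th i) := by
    rw [et_apply, dt_par, hF, map_zero, neg_zero, zero_sub, dx_par, mul_th]
  simp only [act_apply, dx_th, mul_zero, et_th, mul_ite, mul_one, Finset.sum_ite_eq',
    Finset.mem_univ, if_true, e]
  module

theorem isInv_of_isClean {lam mu : ℝ} {i : Fin n} {V : SF n →ₗ[ℝ] SF n →ₗ[ℝ] SF n}
    (hV : IsClean lam mu V) (h0 : ∀ F, dt i F = 0 → V F = 0) :
    IsInv lam mu i (V (th i) ∘ₗ par) := by
  have hev : ∀ {F}, par F = F → dt i F = 0 → ∀ H, -(1 / 2 : ℝ) • V (dx F * th i) (par H)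
      = act mu F (V (th i) (par H)) - V (th i) (par (act lam F H)) := by
    intro F hF hi H
    have := hV.even hF (th i) (par H)
    rw [bracket_th hi, h0 F hi, map_smul, LinearMap.smul_apply] at this
    rw [this, par_act, hF]
    simp
  have hodd : ∀ {F}, par F = -F → dt i F = 0 → dx F = 0 → ∀ H,
      act mu F (V (th i) (par H)) = V (th i) (par (act lam F H)) := by
    intro F hF hi hdx H
    have := hV.odd hF (par_th i) (par H)
    rw [bracket_th hi, h0 F hi, hdx, zero_mul, smul_zero, map_zero] at this
    simp only [LinearMap.zero_apply, map_zero, add_zero] at this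
    rw [par_act, hF, map_neg, LinearMap.neg_apply, map_neg]
    exact eq_neg_of_add_eq_zero_left this.symm
  have hD : ∀ j H, D j (V (th i) (par H)) = V (th i) (par (D j H)) := by
    intro j H
    by_cases hj : j = i
    · subst hj
      -- The field of θᵢ lies outside the subalgebra, but {θᵢ, θᵢ} = ½ and V vanishes at 1.
      have := hV.odd (par_th j) (par_th j) (par H)
      have e : act (-1) (th j) (th j) = (1 / 2 : ℝ) • (1 : SF n) := by
        rw [act_th, D_apply]; simp
      rw [e, h0 _ (by simp)] at this
      simp only [act_th, D_par, map_smul, map_neg, LinearMap.zero_apply] at this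
      have h2 : D j (V (th j) (par H)) - V (th j) (par (D j H)) = 0 := by
        rw [this]; module
      exact sub_eq_zero.mp h2
    · have := hodd (par_th j) (by rw [dt_th, if_neg (Ne.symm hj)]) (dx_th j) H
      simp only [act_th, map_smul] at this
      exact smul_right_injective _ (by norm_num : (1 / 2 : ℝ) ≠ 0) this
  have hthth : ∀ {j k}, j ≠ i → k ≠ i → dt i (th j * th k) = 0 := by
    intro j k hj hk
    rw [dt_th_mul, dt_th, if_neg (Ne.symm hj), if_neg (Ne.symm hk), mul_zero, sub_zero]
  constructor
  · intro H
    have := hev (F := 1) par_one (by simp) H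
    simp only [act_one, dx_one, zero_mul, map_zero, LinearMap.zero_apply, smul_zero] at this
    exact (sub_eq_zero.mp this.symm)
  · exact hD
  · intro j k hj hk hjk H
    have := hev (F := th j * th k) (by simp [par_mul]) (hthth hj hk) H
    simp only [dx_mul, dx_th, zero_mul, mul_zero, add_zero, map_zero, LinearMap.zero_apply,
      smul_zero, act_th_th _ hjk, map_smul] at this
    have := sub_eq_zero.mp this.symm
    exact smul_right_injective _ (by norm_num : -(1 / 2 : ℝ) ≠ 0) this
  · intro H
    have := hev (F := x) par_x (dt_x i) H
    simp only [act_x, dx_x, one_mul, map_add, map_smul] at this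
    simp only [LinearMap.comp_apply, map_add, map_smul]
    linear_combination (norm := module) -(1 : ℝ) • this
  · intro a b c ha hb hc hab hac hbc H
    refine hodd (by simp [par_mul]) ?_ (by simp [dx_mul]) H
    rw [dt_th_mul, if_neg (Ne.symm ha), hthth hb hc, mul_zero, sub_zero]
  · intro j l hj hl hjl H
    set F : SF n := x * (th j * th l) with hFdef
    have hF : par F = F := by simp [hFdef, par_mul]
    have hi : dt i F = 0 := by rw [hFdef, dt_x_mul, hthth hj hl, mul_zero]
    have hdF : dx F = th j * th l := by simp [hFdef, dx_mul]
    have h1 := fun H => hev hF hi H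
    -- The rotation part of the field of xθⱼθₗ kills θⱼθₗ, and its other terms repeat θⱼ. So F
    -- applied twice annihilates θᵢ, and the cocycle identity used twice gives the second-order
    -- relation `quad`.
    have e : act (-1) F (dx F * th i) = 0 := by
      rw [hFdef, act_x_th_th _ hjl, ← hFdef, hdF]
      have hij : l ≠ j := Ne.symm hjl
      rw [mul_assoc, eul_th_mul, eul_th_mul]
      simp only [dt_th_mul, hjl, hij, if_true, if_false, mul_sub, zero_sub, mul_neg, mul_add,
        mul_smul_comm, th_mul_th_mul l j, th_sq_mul, mul_zero, smul_zero, sub_zero, add_zero,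
        neg_zero]
    have h2 := hV.even hF (dx F * th i) (par H)
    rw [e, map_zero, h0 F hi] at h2
    simp only [LinearMap.zero_apply, map_zero, sub_zero] at h2
    have h3 : ∀ H, V (dx F * th i) (par H)
        = -(2 : ℝ) • (act mu F (V (th i) (par H)) - V (th i) (par (act lam F H))) := fun H => by
      rw [← h1]; module
    have h4 := h3 (act lam F H)
    rw [par_act, hF] at h4
    rw [h3, h4] at h2
    simp only [LinearMap.comp_apply]
    simp only [map_smul, map_sub, par_act, hF] at h2 ⊢
    linear_combination (norm := module) (1 / 2 : ℝ) • h2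

section functional

variable {lam mu : ℝ} {i : Fin n} {B : SF n →ₗ[ℝ] SF n}

/-- Rotation invariance applied to θₖK and evaluated at the origin: a monomial containing θⱼ
contributes only if it also contains θₖ, for every other k ≠ i. -/
theorem IsInv.rot_ev (hB : IsInv lam mu i B) {j k : Fin n} (hj : j ≠ i) (hk : k ≠ i) (hjk : j ≠ k)
    (K : SF n) : ev (B (th j * K)) = ev (B (th j * (th k * dt k K))) := by
  have h := congrArg ev (hB.rot hj hk hjk (th k * K))
  simp only [map_sub, map_mul, ev_th, zero_mul, sub_zero, dt_th_mul, if_neg hjk, if_true, mul_sub,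
    mul_neg, th_sq_mul, neg_zero, zero_sub, map_neg, map_sub] at h
  linarith

theorem IsInv.euler_ev (hB : IsInv lam mu i B) (H : SF n) :
    ev (B (x * dx H + (1 / 2 : ℝ) • eul H)) = (mu - lam + 1 / 2) * ev (B H) := by
  rw [← hB.euler]
  simp [eul_apply]

theorem IsInv.weight (hB : IsInv lam mu i B) {H : SF n} {c : ℝ}
    (hH : x * dx H + (1 / 2 : ℝ) • eul H = c • H) (hc : c ≠ mu - lam + 1 / 2) :
    ev (B H) = 0 := by
  have h := hB.euler_ev H
  rw [hH, map_smul, map_smul, smul_eq_mul] at h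
  have : (c - (mu - lam + 1 / 2)) * ev (B H) = 0 := by linarith
  exact (mul_eq_zero.mp this).resolve_left (sub_ne_zero.mpr hc)

theorem x_dx_x_pow (k : ℕ) : x * dx (x ^ k : SF n) = (k : ℝ) • x ^ k := by
  cases k with
  | zero => simp
  | succ k => rw [dx_x_pow_succ, mul_smul_comm, ← pow_succ']; push_cast; rfl

/-- The range of B is stable under ∂ₓ and the D j, so vanishing at the origin propagates everywhere.
-/
theorem IsInv.eq_zero (hB : IsInv lam mu i B) (h : ∀ H, ev (B H) = 0) : B = 0 := by
  refine LinearMap.ext fun H => ?_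
  refine eq_zero_of_stable (W := Set.range B) ?_ ?_ ?_ (B H) ⟨H, rfl⟩
  · rintro _ ⟨H, rfl⟩; exact ⟨_, (hB.comm_dx H).symm⟩
  · rintro j _ ⟨H, rfl⟩; exact ⟨_, (hB.comm_D j H).symm⟩
  · rintro _ ⟨H, rfl⟩; exact h H

/-- Invariance under cubic fields excludes the fully antisymmetric components. -/
theorem IsInv.ev_th_mul_eq_zero (hB : IsInv lam mu i B) {a b c : Fin n} (ha : a ≠ i) (hb : b ≠ i)
    (hc : c ≠ i) (hab : a ≠ b) (hac : a ≠ c) (hbc : b ≠ c) (K : SF n) :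
    ev (B (th a * K)) = 0 := by
  obtain ⟨M, rfl⟩ := dx_surjective K
  -- Two uses of `rot_ev` insert θ_b and θ_c.
  have h1 : ev (B (th a * dx M)) = ev (B (th a * (th b * (th c * dt c (dt b (dx M)))))) := by
    rw [hB.rot_ev ha hb hab]
    have := hB.rot_ev hb hc hbc (th a * dt b (dx M))
    rw [th_mul_th_mul a b, map_neg, map_neg, this, dt_th_mul, if_neg (Ne.symm hac), zero_sub]
    rw [th_mul_th_mul a b, th_mul_th_mul a c]
    simp
  -- The test function does not depend on θₐ, θ_b, θ_c, so only the ∂ₓ term of the cubic field acts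
  -- on it; that term is, up to sign, half the expression in `h1`. On the other side every term
  -- carries a θ and vanishes at the origin.
  have h := congrArg ev (hB.cubic ha hb hc hab hac hbc (dt a (dt b (dt c (th a * M)))))
  have e1 : ∀ s : Fin n, ∀ Y, dt b (dt s (dt b Y)) = (0 : SF n) := fun s Y => by
    rw [dt_dt b s, dt_dt_self, map_zero, neg_zero]
  have z1 : dt b (dt a (dt b (dt c (th a * M)))) = 0 := e1 a _
  have z2 : dt c (dt a (dt b (dt c (th a * M)))) = 0 := by
    rw [dt_dt c a, dt_dt c b, dt_dt_self]; simp
  rw [act_th_th_th _ hab hac hbc, act_th_th_th _ hab hac hbc, dt_dt_self, z1, z2] at h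
  have e2 : th a * (th b * (th c * dx (dt a (dt b (dt c (th a * M))))))
      = -(th a * (th b * (th c * dt c (dt b (dx M))))) := by
    simp only [dt_th_mul, dx_dt, if_neg (Ne.symm hac), zero_sub, map_neg, map_sub, if_neg (Ne.symm hab),
      if_true, dx_mul, dx_th, zero_mul, zero_add, mul_sub, mul_neg]
    rw [dt_dt b c (dx M), th_mul_th_mul c a]
    simp only [mul_neg]
    rw [th_mul_th_mul b a]
    simp
  rw [e2] at h
  simp only [mul_zero, sub_zero, add_zero, smul_zero, zero_sub, map_sub, map_add,
    map_smul, map_mul, ev_th, zero_mul, neg_neg, smul_eq_mul, smul_neg] at h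
  rw [h1]
  linarith

/-! ### Consequences of the second-order relation for xθⱼθₗ -/

variable {j l : Fin n}

/-- The coefficients of this field vanish to too high an order for a single D to make them nonzero
at the origin. The terms of `quad` with the field to the left of B thus drop out of such tests. -/
theorem ev_D_act (c : ℝ) (hjl : j ≠ l) (s : Fin n) (M : SF n) :
    ev (D s (act c (x * (th j * th l)) M)) = 0 := by
  rw [act_x_th_th _ hjl]
  simp only [map_add, map_smul, D_x_mul, D_th_mul, map_sub, map_mul, ev_x, ev_th, zero_mul,
    mul_sub, mul_ite, mul_zero]
  split_ifs <;> simp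

theorem ev_D_D_act (c : ℝ) (hjl : j ≠ l) (hj : j ≠ i) (hl : l ≠ i) (M : SF n) :
    ev (D i (D j (act c (x * (th j * th l)) M))) = 0 := by
  rw [act_x_th_th _ hjl]
  simp only [map_add, map_smul, D_x_mul, D_th_mul, map_sub, if_neg hjl, if_neg (Ne.symm hj),
    if_neg (Ne.symm hl), if_true, zero_sub, map_neg]
  simp

/-- D j and D l remove θⱼθₗ, with a sign from their order, and the Euler term vanishes at the
origin: only the weight c is seen. -/
theorem ev_D_D_act' (c : ℝ) (hjl : j ≠ l) (M : SF n) :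
    ev (D j (D l (act c (x * (th j * th l)) M))) = -c * ev M := by
  rw [act_x_th_th _ hjl]
  simp only [map_add, map_smul, D_x_mul, D_th_mul, map_sub, if_neg hjl, if_neg (Ne.symm hjl),
    if_true, zero_sub, map_neg]
  simp [eul_apply]

/-- One further odd derivative makes the Euler term visible, since D i (eul M) and D i M agree at
the origin; this is the shift of c by ½. -/
theorem ev_D_D_D_act (c : ℝ) (hjl : j ≠ l) (hj : j ≠ i) (hl : l ≠ i) (M : SF n) :
    ev (D i (D j (D l (act c (x * (th j * th l)) M)))) = -(c + 1 / 2) * ev (D i M) := by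
  have e : ev (D i (eul M)) = ev (D i M) := by
    have e1 : ∀ s, ev (D i (th s * dt s M)) = if i = s then ev (dt s M) else 0 := fun s => by
      rw [D_th_mul, map_sub, map_mul, ev_th, zero_mul, sub_zero]
      split_ifs <;> simp
    simp only [eul_apply, map_sum, e1]
    simp [D_apply]
  rw [act_x_th_th _ hjl]
  simp only [map_add, map_smul, D_x_mul, D_th_mul, map_sub, if_neg hjl, if_neg (Ne.symm hjl),
    if_neg (Ne.symm hj), if_neg (Ne.symm hl), if_true, zero_sub, map_neg]
  simp only [map_neg, map_add, map_sub, map_smul, map_mul, ev_x, ev_th, zero_mul, smul_eq_mul, e,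
    neg_zero, sub_zero, add_zero, mul_zero, zero_add]
  ring

theorem act_quad_th_left (c : ℝ) (hjl : j ≠ l) (a : ℕ) :
    act c (x * (th j * th l)) (th j * x ^ a) = -(1 / 2 : ℝ) • (th l * x ^ (a + 1)) := by
  rw [act_x_th_th _ hjl, eul_th_mul, eul_x_pow]
  simp only [dt_th_mul, if_neg (Ne.symm hjl), if_true, dt_x_pow, mul_zero, sub_zero, add_zero,
    ← add_smul, mul_smul_comm, th_mul_th_mul l j, th_sq_mul, mul_neg, smul_zero, neg_zero]
  rw [← th_mul_x_mul, ← pow_succ']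

theorem act_quad_th_right (c : ℝ) (hjl : j ≠ l) (a : ℕ) :
    act c (x * (th j * th l)) (th l * x ^ a) = (1 / 2 : ℝ) • (th j * x ^ (a + 1)) := by
  rw [act_x_th_th _ hjl, eul_th_mul, eul_x_pow]
  simp only [dt_th_mul, if_neg hjl, if_true, dt_x_pow, mul_zero, sub_zero, add_zero, zero_sub,
    ← add_smul, mul_smul_comm, th_sq_mul, mul_neg, smul_zero]
  rw [← th_mul_x_mul, ← pow_succ']
  module

theorem act_quad_x_pow (c : ℝ) (hjl : j ≠ l) (a : ℕ) :
    act c (x * (th j * th l)) (x ^ a) = c • (th j * (th l * x ^ a)) := by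
  rw [act_x_th_th _ hjl]
  simp

theorem act_quad_th_x_pow (c : ℝ) (hjl : j ≠ l) (hj : j ≠ i) (hl : l ≠ i) (a : ℕ) :
    act c (x * (th j * th l)) (th i * x ^ a)
      = (c + 1 / 2) • (th j * (th l * (th i * x ^ a))) := by
  rw [act_x_th_th _ hjl, eul_th_mul, eul_x_pow]
  simp only [dt_th_mul, if_neg hj, if_neg hl, dt_x_pow, mul_zero, sub_zero, smul_zero, zero_add,
    add_zero, ← add_smul, mul_smul_comm]

theorem act_quad_th_th (c : ℝ) (hjl : j ≠ l) (Y : SF n) (h1 : dt j Y = 0) (h2 : dt l Y = 0) :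
    act c (x * (th j * th l)) (th j * (th l * Y)) = 0 := by
  rw [act_x_th_th _ hjl, eul_th_mul, eul_th_mul]
  simp only [dt_th_mul, if_neg hjl, if_neg (Ne.symm hjl), if_true, h1, h2, mul_zero, sub_zero, zero_sub, mul_neg, mul_add, mul_smul_comm, th_mul_th_mul l j, th_sq_mul, smul_zero,
    neg_zero, add_zero]

/-- Test `quad` on θⱼx^a with D j at the origin: two rotations return to θⱼ with the factor x² and
the constant -¼, and only the last term of `quad` survives. -/
theorem IsInv.ev_x_pow (hB : IsInv lam mu i B) (hj : j ≠ i) (hl : l ≠ i) (hjl : j ≠ l) (a : ℕ) :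
    ev (B (x ^ (a + 2))) = 0 := by
  have e : th j * D j (x ^ (a + 1 + 1) : SF n) = 0 := by
    rw [D_x_pow_succ, mul_smul_comm, th_sq_mul, smul_zero]
  have h := congrArg (fun Y => ev (D j Y)) (hB.quad hj hl hjl (th j * x ^ a))
  simp only [map_add, map_sub, map_smul, ev_D_act _ hjl, hB.comm_D, act_quad_th_left _ hjl,
    act_quad_th_right _ hjl, D_th_mul, if_true, map_zero, e] at h
  simp only [smul_eq_mul, sub_zero] at h
  linarith

theorem IsInv.ev_th_x_pow (hB : IsInv lam mu i B) (hj : j ≠ i) (hl : l ≠ i) (hjl : j ≠ l) (a : ℕ) :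
    ev (B (th i * x ^ (a + 1))) = 0 := by
  have e : th j * D j (x ^ (a + 1 + 1) : SF n) = 0 := by
    rw [D_x_pow_succ, mul_smul_comm, th_sq_mul, smul_zero]
  have h := congrArg (fun Y => ev (D i (D j Y))) (hB.quad hj hl hjl (th j * x ^ a))
  simp only [map_add, map_sub, map_smul, ev_D_D_act _ hjl hj hl, hB.comm_D, act_quad_th_left _ hjl,
    act_quad_th_right _ hjl, D_th_mul, if_true, map_zero, e, sub_zero] at h
  rw [D_x_pow_succ] at h
  simp only [smul_eq_mul, map_smul] at h
  have h2 : ((a : ℝ) + 2) * ev (B (th i * x ^ (a + 1))) = 0 := by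
    push_cast at h; linarith
  exact (mul_eq_zero.mp h2).resolve_left (by positivity)

/-- Test `quad` on x^a with D j D l: the outer terms vanish, and the mixed term gives λ from x^a and
μ from the evaluation. -/
theorem IsInv.quad_full (hB : IsInv lam mu i B) (hj : j ≠ i) (hl : l ≠ i) (hjl : j ≠ l) (a : ℕ) :
    mu * lam * ev (B (th j * (th l * x ^ a))) = 0 := by
  have h := congrArg (fun Y => ev (D j (D l Y))) (hB.quad hj hl hjl (x ^ a))
  simp only [map_add, map_sub, map_smul, ev_D_D_act' _ hjl, act_quad_x_pow _ hjl,
    act_quad_th_th lam hjl (x ^ a) (dt_x_pow _ _) (dt_x_pow _ _), map_zero, smul_zero] at h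
  have e : ev (act mu (x * (th j * th l)) (B (x ^ a))) = 0 := by
    rw [act_x_th_th _ hjl]; simp
  rw [e] at h
  simp only [smul_eq_mul] at h
  linarith

theorem IsInv.quad_full_th (hB : IsInv lam mu i B) (hj : j ≠ i) (hl : l ≠ i) (hjl : j ≠ l)
    (a : ℕ) : mu * (lam + 1 / 2) * ev (B (th j * (th l * (th i * x ^ a)))) = 0 := by
  have hd : ∀ s, s ≠ i → dt s (th i * x ^ a) = (0 : SF n) := fun s hs => by
    rw [dt_th_mul, if_neg hs, dt_x_pow, mul_zero, sub_zero]
  have h := congrArg (fun Y => ev (D j (D l Y))) (hB.quad hj hl hjl (th i * x ^ a))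
  simp only [map_add, map_sub, map_smul, ev_D_D_act' _ hjl, act_quad_th_x_pow _ hjl hj hl,
    act_quad_th_th lam hjl _ (hd _ hj) (hd _ hl), map_zero, smul_zero] at h
  have e : ev (act mu (x * (th j * th l)) (B (th i * x ^ a))) = 0 := by
    rw [act_x_th_th _ hjl]; simp
  rw [e] at h
  simp only [smul_eq_mul] at h
  linarith

/-- Inserting θᵢ in the test function shifts λ by ½, and the extra D i shifts μ by ½ while returning
the same value of B as in `quad_full`. -/
theorem IsInv.quad_full' (hB : IsInv lam mu i B) (hj : j ≠ i) (hl : l ≠ i) (hjl : j ≠ l) (a : ℕ) :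
    (mu + 1 / 2) * (lam + 1 / 2) * ev (B (th j * (th l * x ^ a))) = 0 := by
  have hd : ∀ s, s ≠ i → dt s (th i * x ^ a) = (0 : SF n) := fun s hs => by
    rw [dt_th_mul, if_neg hs, dt_x_pow, mul_zero, sub_zero]
  have h := congrArg (fun Y => ev (D i (D j (D l Y)))) (hB.quad hj hl hjl (th i * x ^ a))
  simp only [map_add, map_sub, map_smul, ev_D_D_D_act _ hjl hj hl, act_quad_th_x_pow _ hjl hj hl,
    act_quad_th_th lam hjl _ (hd _ hj) (hd _ hl), map_zero, smul_zero, ev_D_act _ hjl, hB.comm_D] at h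
  have e : D i (th j * (th l * (th i * x ^ a))) = th j * (th l * x ^ a) := by
    have e2 : th i * D i (x ^ a : SF n) = 0 := by
      rw [D_apply, dt_x_pow, zero_add, th_sq_mul]
    rw [D_th_mul, D_th_mul, D_th_mul, if_neg (Ne.symm hj), if_neg (Ne.symm hl), if_pos rfl, e2]
    simp
  rw [e] at h
  simp only [smul_eq_mul] at h
  linarith

/-- The exponent a + 1 is chosen because D i turns x^(a+1) into (a+1)θᵢx^a. -/
theorem IsInv.quad_full_th' (hB : IsInv lam mu i B) (hj : j ≠ i) (hl : l ≠ i) (hjl : j ≠ l)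
    (a : ℕ) : (mu + 1 / 2) * lam * ev (B (th j * (th l * (th i * x ^ a)))) = 0 := by
  have h := congrArg (fun Y => ev (D i (D j (D l Y)))) (hB.quad hj hl hjl (x ^ (a + 1)))
  simp only [map_add, map_sub, map_smul, ev_D_D_D_act _ hjl hj hl, act_quad_x_pow _ hjl,
    act_quad_th_th lam hjl (x ^ (a + 1)) (dt_x_pow _ _) (dt_x_pow _ _), map_zero, smul_zero,
    ev_D_act _ hjl, hB.comm_D] at h
  have e : D i (th j * (th l * x ^ (a + 1)))
      = ((a : ℝ) + 1) • (th j * (th l * (th i * x ^ a))) := by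
    rw [D_th_mul, D_th_mul, D_x_pow_succ, if_neg (Ne.symm hj), if_neg (Ne.symm hl)]
    simp
  rw [e] at h
  simp only [smul_eq_mul, map_smul] at h
  have h2 : ((a : ℝ) + 1) * ((mu + 1 / 2) * lam * ev (B (th j * (th l * (th i * x ^ a))))) = 0 := by
    linarith
  exact (mul_eq_zero.mp h2).resolve_left (by positivity)

theorem IsInv.eq_zero_of_values (hB : IsInv lam mu i B) (hj : j ≠ i) (hl : l ≠ i) (hjl : j ≠ l)
    (h1 : ev (B 1) = 0) (hx : ev (B x) = 0) (hi : ev (B (th i)) = 0)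
    (hfull : ∀ s, s ≠ i → ∀ K, ev (B (th s * K)) = 0) : B = 0 := by
  refine hB.eq_zero fun H => ?_
  have hpow : ∀ k, ev (B (x ^ k)) = 0 := by
    intro k
    match k with
    | 0 => simpa using h1
    | 1 => simpa using hx
    | k + 2 => exact hB.ev_x_pow hj hl hjl k
  have hth : ∀ K, ev (B (th i * K)) = 0 := by
    have : (ev (n := n)).toLinearMap ∘ₗ B ∘ₗ LinearMap.mulLeft ℝ (th i) = 0 := by
      refine eq_zero_of_pow_of_th _ (fun k => ?_) fun s K => ?_
      · cases k with
        | zero => simpa using hi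
        | succ k => exact hB.ev_th_x_pow hj hl hjl k
      · by_cases hs : s = i
        · subst hs; simp
        · have := hfull s hs (th i * K)
          simpa [th_mul_th_mul i s] using this
    exact fun K => LinearMap.congr_fun this K
  have : (ev (n := n)).toLinearMap ∘ₗ B = 0 := by
    refine eq_zero_of_pow_of_th _ hpow fun s K => ?_
    by_cases hs : s = i
    · subst hs; exact hth K
    · exact hfull s hs K
  exact LinearMap.congr_fun this H

/-- For `n = 3` the antisymmetric components vanish except possibly at `θⱼ θₗ`. -/
theorem IsInv.ev_th_th_mul_eq_zero (hB : IsInv lam mu i B) (hj : j ≠ i) (hl : l ≠ i) (hjl : j ≠ l)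
    (hs : ∀ s, s = i ∨ s = j ∨ s = l)
    (hex : lam = -1 / 2 → mu = 0 → ev (B (th j * th l)) = 0) (K : SF n) :
    ev (B (th j * (th l * K))) = 0 := by
  have hx : ∀ k, ev (B (th j * (th l * x ^ k))) = 0 := by
    intro k
    by_contra hne
    have e1 : mu * lam = 0 := by
      simpa [hne] using hB.quad_full hj hl hjl k
    have e2 : (mu + 1 / 2) * (lam + 1 / 2) = 0 := by
      have := hB.quad_full' hj hl hjl k
      exact (mul_eq_zero.mp this).resolve_right hne
    have e3 : (k : ℝ) + 1 = mu - lam + 1 / 2 := by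
      by_contra hc
      refine hne (hB.weight ?_ hc)
      simp only [eul_th_mul]
      rw [eul_x_pow, dx_mul, dx_mul, dx_th, dx_th, zero_mul, zero_mul,
        zero_add, zero_add, ← th_mul_x_mul, ← th_mul_x_mul, x_dx_x_pow]
      simp only [mul_smul_comm, mul_zero, add_zero]
      module
    have hk : (0 : ℝ) ≤ k := Nat.cast_nonneg k
    -- The two products leave (λ, μ) = (-½, 0) or (0, -½). The degree equation forces k = 0 in the
    -- first case and the impossible k = -1 in the second.
    rcases mul_eq_zero.mp e1 with h | h
    · rcases mul_eq_zero.mp e2 with h' | h'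
      · linarith
      · have hl' : lam = -1 / 2 := by linarith
        have hk0 : (k : ℝ) = 0 := by rw [h, hl'] at e3; linarith
        have hk0' : k = 0 := by exact_mod_cast hk0
        subst hk0'
        exact hne (by simpa using hex hl' h)
    · rcases mul_eq_zero.mp e2 with h' | h'
      · linarith
      · linarith
  have hxi : ∀ k, ev (B (th j * (th l * (th i * x ^ k)))) = 0 := by
    intro k
    by_contra hne
    have e1 := (mul_eq_zero.mp (hB.quad_full_th hj hl hjl k)).resolve_right hne
    have e2 := (mul_eq_zero.mp (hB.quad_full_th' hj hl hjl k)).resolve_right hne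
    have e3 : (k : ℝ) + 3 / 2 = mu - lam + 1 / 2 := by
      by_contra hc
      refine hne (hB.weight ?_ hc)
      simp only [eul_th_mul]
      rw [eul_x_pow, dx_mul, dx_mul, dx_mul, dx_th, dx_th,
        dx_th, zero_mul, zero_mul, zero_mul, zero_add, zero_add, zero_add, ← th_mul_x_mul,
        ← th_mul_x_mul, ← th_mul_x_mul, x_dx_x_pow]
      simp only [mul_smul_comm, mul_add, mul_zero, add_zero]
      module
    have hk : (0 : ℝ) ≤ k := Nat.cast_nonneg k
    -- The products can vanish together only for λ = μ ∈ {0, -½}, where the degree equation would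
    -- give k = -1.
    rcases mul_eq_zero.mp e1 with h | h <;> rcases mul_eq_zero.mp e2 with h' | h' <;> linarith
  have hK : (ev (n := n)).toLinearMap ∘ₗ B ∘ₗ LinearMap.mulLeft ℝ (th j) ∘ₗ
      LinearMap.mulLeft ℝ (th l) ∘ₗ LinearMap.mulLeft ℝ (th i) = 0 := by
    refine eq_zero_of_pow_of_th _ hxi fun s K => ?_
    rcases hs s with rfl | rfl | rfl
    · simp
    · simp [th_mul_th_mul i s, th_mul_th_mul l s]
    · simp [th_mul_th_mul i s]
  have : (ev (n := n)).toLinearMap ∘ₗ B ∘ₗ LinearMap.mulLeft ℝ (th j) ∘ₗ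
      LinearMap.mulLeft ℝ (th l) = 0 := by
    refine eq_zero_of_pow_of_th _ hx fun s K => ?_
    rcases hs s with rfl | rfl | rfl
    · exact LinearMap.congr_fun hK K
    · simp [th_mul_th_mul l s]
    · simp
  exact LinearMap.congr_fun this K

end functional

/-! ### Cocycles vanishing on a subalgebra of codimension one -/

theorem dt_th_mul_self_add (i : Fin n) (F : SF n) : dt i (th i * F) + th i * dt i F = F := by
  rw [dt_th_mul, if_pos rfl, sub_add_cancel]

/-- The brackets {F, θᵢ} = -½F'θᵢ with ∂ᵢF = 0 exhaust the multiples of θᵢ, and every superfunction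
is such a multiple plus one not depending on θᵢ. -/
theorem IsClean.eq_zero_of_th {lam mu : ℝ} {i : Fin n} {V : SF n →ₗ[ℝ] SF n →ₗ[ℝ] SF n}
    (hV : IsClean lam mu V) (h0 : ∀ F, dt i F = 0 → V F = 0) (h1 : V (th i) = 0) : V = 0 := by
  have heven : ∀ F, par F = F → dt i F = 0 → V (dx F * th i) = 0 := by
    intro F hF hi
    refine LinearMap.ext fun H => ?_
    have := hV.even hF (th i) H
    rw [bracket_th hi, h0 F hi, h1, map_smul] at this
    simpa using this
  have hodd : ∀ F, par F = -F → dt i F = 0 → V (dx F * th i) = 0 := by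
    intro F hF hi
    refine LinearMap.ext fun H => ?_
    have := hV.odd hF (par_th i) H
    rw [bracket_th hi, h0 F hi, h1, map_smul] at this
    simpa using this
  have hker : ∀ F, dt i F = 0 → V (dx F * th i) = 0 := by
    intro F hi
    have e : dx F * th i = dx ((1 / 2 : ℝ) • (F + par F)) * th i
        + dx ((1 / 2 : ℝ) • (F - par F)) * th i := by
      rw [← add_mul, ← map_add]
      congr 2
      module
    rw [e, map_add, heven _ ?_ ?_, hodd _ ?_ ?_, add_zero]
    · simp only [map_smul, map_sub, par_par]; module
    · simp only [map_smul, map_sub, dt_par, hi]; simp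
    · simp only [map_smul, map_add, par_par]; module
    · simp only [map_smul, map_add, dt_par, hi]; simp
  refine LinearMap.ext fun F => ?_
  -- A primitive N may depend on θᵢ; applying ∂ᵢ(θᵢ ·) projects it to the subalgebra without
  -- changing its derivative.
  obtain ⟨N, hN⟩ := dx_surjective (par (dt i F))
  have hM : dx (dt i (th i * N)) = par (dt i F) := by
    rw [dx_dt, dx_mul, dx_th, zero_mul, zero_add, hN, dt_th_mul, dt_par]
    simp
  have h2 := hker (dt i (th i * N)) (dt_dt_self i _)
  rw [hM, mul_th, par_par] at h2
  rw [← dt_th_mul_self_add i F, map_add, h2, h0 _ (dt_dt_self i _), add_zero]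
  rfl

theorem act_th_mul_eq (c : ℝ) (i : Fin n) (F H : SF n) :
    act c F (th i * H) = th i * act c (par F) H - (1 / 2 : ℝ) • (et i (par F) * H) := by
  have e2 : ∀ s, et s (par F) * et s (th i * H)
      = (if s = i then et i (par F) * H else 0) + th i * (et s F * et s H) := by
    intro s
    rw [et_th_mul, mul_sub, ← mul_assoc, mul_th, et_par, map_neg, par_par]
    split_ifs with h
    · subst h; rw [et_par]; noncomm_ring
    · noncomm_ring
  simp only [act_apply, e2, Finset.sum_add_distrib, Finset.sum_ite_eq', Finset.mem_univ, if_true,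
    par_par, dx_mul, dx_th, zero_mul, zero_add, ← Finset.mul_sum, dx_par]
  rw [← mul_assoc F, mul_th, ← mul_assoc (dx F), mul_th]
  simp only [mul_add, mul_sub, mul_smul_comm, mul_assoc]
  module

/-- Over the subalgebra, multiplication by θᵢ intertwines weight c + ½ with weight c, up to parity;
`dt_act` gives the opposite shift for ∂ᵢ. Together they decide when each summand of `kerOp` is
invariant. -/
theorem act_th_mul {i : Fin n} {F : SF n} (hF : dt i F = 0) (c : ℝ) (H : SF n) :
    act c F (th i * H) = th i * act (c + 1 / 2) (par F) H := by
  rw [act_th_mul_eq, et_apply, dt_par, hF, act_eq c, act_eq (c + 1 / 2)]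
  simp only [mul_add, mul_smul_comm, map_zero, neg_zero, zero_sub, neg_mul, mul_assoc]
  module

theorem dt_et (i s : Fin n) (F : SF n) :
    dt i (et s F) = -et s (dt i F) - if i = s then dx F else 0 := by
  simp only [et_apply, map_sub, dt_th_mul, dt_dt i s, dx_dt]
  abel

theorem dt_act {i : Fin n} {F : SF n} (hF : dt i F = 0) (c : ℝ) (H : SF n) :
    dt i (act c F H) = act (c + 1 / 2) (par F) (dt i H) := by
  have hF' : dt i (par F) = 0 := by rw [dt_par, hF, map_zero, neg_zero]
  have hdF : dt i (dx F) = 0 := by rw [← dx_dt, hF, map_zero]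
  have e1 : ∀ s, dt i (et s (par F) * et s H) = et s F * et s (dt i H)
      - (if i = s then par (dx F) * dt i H else 0) := by
    intro s
    rw [dt_mul, dt_et, dt_et, hF', map_zero, et_par, map_neg, par_par]
    split_ifs with h
    · subst h
      rw [et_apply i F, et_apply i H, hF, dx_par]
      have : par (dx F) * (th i * dx H) = th i * dx F * dx H := by
        rw [← mul_assoc, mul_th, par_par]
      simp only [mul_sub, zero_sub, neg_zero, neg_mul, mul_neg, neg_neg, this]
      abel
    · noncomm_ring
  simp only [act_apply, map_add, map_sub, map_smul, map_sum, e1, Finset.sum_sub_distrib,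
    Finset.sum_ite_eq, Finset.mem_univ, if_true, par_par]
  rw [dt_mul, hF, zero_mul, zero_add, dx_dt, dt_mul, hdF, zero_mul, zero_add, dx_par]
  module

/-- The operators whose coboundaries vanish on the fields not depending on `θᵢ`, for the
appropriate weights. -/
def kerOp (i : Fin n) (p q r : ℝ) : SF n →ₗ[ℝ] SF n :=
  p • LinearMap.mulLeft ℝ (th i) + q • dt i + r • (LinearMap.mulLeft ℝ (th i) ∘ₗ dt i)

theorem twOp_kerOp (i : Fin n) (p q r : ℝ) (H : SF n) : twOp (kerOp i p q r) H
    = p • par (th i * H) + q • par (dt i H) + r • (th i * dt i H) := by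
  simp only [twOp_apply, kerOp, LinearMap.add_apply, LinearMap.smul_apply,
    LinearMap.mulLeft_apply, LinearMap.comp_apply, map_add, map_smul, par_mul, par_th, dt_par,
    par_par, map_neg]
  simp only [neg_mul, neg_neg]
  module

theorem adj_kerOp_of_ker {lam mu : ℝ} {i : Fin n} {p q r : ℝ} (hp : p ≠ 0 → mu + 1 / 2 = lam)
    (hq : q ≠ 0 → lam + 1 / 2 = mu) (hr : r ≠ 0 → lam = mu) {F : SF n} (hF : dt i F = 0) :
    adj lam mu (twOp (kerOp i p q r)) F = 0 := by
  refine LinearMap.ext fun H => ?_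
  have hF' : dt i (par F) = 0 := by rw [dt_par, hF, map_zero, neg_zero]
  have e : ∀ Y, act mu F (par Y) = par (act mu (par F) Y) := fun Y => by
    rw [par_act, par_par]
  simp only [adj_apply, twOp_kerOp, map_add, map_smul, e, act_th_mul hF', act_th_mul hF,
    dt_act hF, par_par]
  have h1 : p • (par (th i * act (mu + 1 / 2) F H) - par (th i * act lam F H)) = 0 := by
    by_cases h : p = 0
    · simp [h]
    · rw [hp h, sub_self, smul_zero]
  have h2 : q • (par (act mu (par F) (dt i H)) - par (act (lam + 1 / 2) (par F) (dt i H))) = 0 := by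
    by_cases h : q = 0
    · simp [h]
    · rw [hq h, sub_self, smul_zero]
  have h3 : r • (th i * act (mu + 1 / 2) (par F) (dt i H)
      - th i * act (lam + 1 / 2) (par F) (dt i H)) = 0 := by
    by_cases h : r = 0
    · simp [h]
    · rw [hr h, sub_self, smul_zero]
  rw [LinearMap.zero_apply]
  linear_combination (norm := module) h1 + h2 + h3

/-- Taking H = 1, x, θᵢ reads off p, q and r, the three values left undetermined by invariance. -/
theorem ev_adj_kerOp (lam mu : ℝ) (i : Fin n) (p q r : ℝ) (H : SF n) :
    ev (adj lam mu (twOp (kerOp i p q r)) (th i) (par H))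
      = -(1 / 2 : ℝ) * (p * ev H + q * ev (dx H) + r * ev (dt i H)) := by
  simp only [adj_apply, act_th, twOp_kerOp, map_add, map_smul, map_sub, D_apply, dt_par, par_mul,
    par_th, par_par, dt_th_mul, map_neg, dt_dt_self, map_mul, ev_th, neg_mul, mul_neg, if_true,
    ev_par, smul_eq_mul, dx_par, dx_dt, neg_neg]
  simp
  ring

theorem IsClean.eq_adj_kerOp {lam mu : ℝ} {i j l : Fin n} {V : SF n →ₗ[ℝ] SF n →ₗ[ℝ] SF n}
    (hV : IsClean lam mu V) (h0 : ∀ F, dt i F = 0 → V F = 0) (hj : j ≠ i) (hl : l ≠ i)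
    (hjl : j ≠ l) (hfull : ∀ s, s ≠ i → ∀ K, ev (V (th i) (par (th s * K))) = 0) :
    ∃ p q r, V = adj lam mu (twOp (kerOp i p q r)) := by
  have hB := isInv_of_isClean hV h0
  -- The factor -2 inverts the -½ of `ev_adj_kerOp`. By `IsInv.weight` a coefficient is nonzero only
  -- at the weights for which its operator is invariant under the subalgebra.
  refine ⟨-2 * ev (V (th i) (par 1)), -2 * ev (V (th i) (par x)),
    -2 * ev (V (th i) (par (th i))), ?_⟩
  have hker : ∀ F, dt i F = 0 → adj lam mu (twOp (kerOp i (-2 * ev (V (th i) (par 1)))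
      (-2 * ev (V (th i) (par x))) (-2 * ev (V (th i) (par (th i)))))) F = 0 := by
    intro F hF
    refine adj_kerOp_of_ker (fun h => ?_) (fun h => ?_) (fun h => ?_) hF
    · by_contra hc
      refine h (mul_eq_zero_of_right _ (hB.weight (H := 1) (c := 0) ?_ ?_))
      · simp [eul_apply]
      · intro h'; apply hc; linarith
    · by_contra hc
      refine h (mul_eq_zero_of_right _ (hB.weight (H := x) (c := 1) ?_ ?_))
      · simp [eul_apply]
      · intro h'; apply hc; linarith
    · by_contra hc
      refine h (mul_eq_zero_of_right _ (hB.weight (H := th i) (c := 1 / 2) ?_ ?_))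
      · simp [eul_apply, dt_th]
      · intro h'; apply hc; linarith
  set W := adj lam mu (twOp (kerOp i (-2 * ev (V (th i) (par 1)))
      (-2 * ev (V (th i) (par x))) (-2 * ev (V (th i) (par (th i)))))) with hW
  have hc : IsClean lam mu (V - W) := hV.sub (isClean_adj _ _ _)
  have hz : ∀ F, dt i F = 0 → (V - W) F = 0 := fun F hF => by
    rw [LinearMap.sub_apply, h0 F hF, hker F hF, sub_zero]
  have hval : ∀ H, ev ((V - W) (th i) (par H)) = ev (V (th i) (par H))
      - (ev (V (th i) (par 1)) * ev H + ev (V (th i) (par x)) * ev (dx H)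
        + ev (V (th i) (par (th i))) * ev (dt i H)) := fun H => by
    rw [LinearMap.sub_apply, LinearMap.sub_apply, map_sub, hW, ev_adj_kerOp]
    ring
  have hzero : (V - W) (th i) ∘ₗ par = 0 := by
    refine (isInv_of_isClean hc hz).eq_zero_of_values hj hl hjl ?_ ?_ ?_ fun s hs K => ?_
    all_goals rw [LinearMap.comp_apply, hval]
    · simp
    · simp
    · simp
    · rw [hfull s hs, dt_th_mul, if_neg (Ne.symm hs), dx_mul]
      simp
  have hth : (V - W) (th i) = 0 := LinearMap.ext fun H => by
    have := LinearMap.congr_fun hzero (par H)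
    rwa [LinearMap.comp_apply, par_par] at this
  exact sub_eq_zero.mp (hc.eq_zero_of_th hz hth)

/-! ### Closure properties of differential operators -/

/-- The product of odd derivatives along a list of indices. -/
def dtProd (ε : Fin n → Fin 2) (l : List (Fin n)) : Module.End ℝ (SF n) :=
  (l.map fun i => (dt i : Module.End ℝ (SF n)) ^ (ε i : ℕ)).prod

/-- The operator `∂ₓ^k ∂₁^{ε₁} ⋯ ∂ₙ^{εₙ}`. -/
def mon (k : ℕ) (ε : Fin n → Fin 2) : SF n →ₗ[ℝ] SF n := monomialOp n k ε

/-- The space of differential operators. -/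
def dOps : Submodule ℝ (SF n →ₗ[ℝ] SF n) :=
  Submodule.span ℝ {A | ∃ (a : SF n) (k : ℕ) (ε : Fin n → Fin 2),
    A = LinearMap.mulLeft ℝ a ∘ₗ mon k ε}

theorem mon_eq (k : ℕ) (ε : Fin n → Fin 2) :
    mon k ε = (dx : Module.End ℝ (SF n)) ^ k * dtProd ε (List.finRange n) := by
  rw [dtProd, ← List.ofFn_eq_map]
  rfl

theorem mul_mon_mem (a : SF n) (k : ℕ) (ε : Fin n → Fin 2) :
    LinearMap.mulLeft ℝ a ∘ₗ mon k ε ∈ dOps (n := n) :=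
  Submodule.subset_span ⟨a, k, ε, rfl⟩

theorem dOps_induction {C : (SF n →ₗ[ℝ] SF n) → Prop}
    (gen : ∀ a k ε, C (LinearMap.mulLeft ℝ a ∘ₗ mon k ε))
    (zero : C 0) (add : ∀ A B, C A → C B → C (A + B)) (smul : ∀ (c : ℝ) A, C A → C (c • A))
    {A : SF n →ₗ[ℝ] SF n} (hA : A ∈ dOps (n := n)) : C A := by
  refine Submodule.span_induction (p := fun A _ => C A) ?_ zero (fun A B _ _ => add A B)
    (fun c A _ => smul c A) hA
  rintro _ ⟨a, k, ε, rfl⟩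
  exact gen a k ε

theorem id_mem : LinearMap.id ∈ dOps (n := n) := by
  have : LinearMap.mulLeft ℝ (1 : SF n) ∘ₗ mon 0 0 = LinearMap.id := by
    have h : dtProd (0 : Fin n → Fin 2) (List.finRange n) = 1 := by
      simp [dtProd]
    rw [mon_eq, h, LinearMap.mulLeft_one]
    rfl
  rw [← this]
  exact mul_mon_mem _ _ _

theorem mul_comp_mem (a : SF n) {A : SF n →ₗ[ℝ] SF n} (hA : A ∈ dOps (n := n)) :
    LinearMap.mulLeft ℝ a ∘ₗ A ∈ dOps (n := n) := by
  refine dOps_induction (C := fun A => LinearMap.mulLeft ℝ a ∘ₗ A ∈ dOps (n := n)) (fun b k ε => ?_) ?_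
    (fun A B hA hB => ?_) (fun c A hA => ?_) hA
  · rw [← LinearMap.comp_assoc, ← LinearMap.mulLeft_mul]
    exact mul_mon_mem _ _ _
  · rw [LinearMap.comp_zero]; exact zero_mem _
  · rw [LinearMap.comp_add]; exact add_mem hA hB
  · rw [LinearMap.comp_smul]; exact Submodule.smul_mem _ _ hA

theorem dx_comp_mem {A : SF n →ₗ[ℝ] SF n} (hA : A ∈ dOps (n := n)) :
    dx ∘ₗ A ∈ dOps (n := n) := by
  refine dOps_induction (C := fun A => dx ∘ₗ A ∈ dOps (n := n)) (fun b k ε => ?_) ?_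
    (fun A B hA hB => ?_) (fun c A hA => ?_) hA
  · have e : dx ∘ₗ mon k ε = mon (k + 1) ε := by
      rw [mon_eq, mon_eq, pow_succ', mul_assoc]
      rfl
    have : dx ∘ₗ LinearMap.mulLeft ℝ b ∘ₗ mon k ε
        = LinearMap.mulLeft ℝ (dx b) ∘ₗ mon k ε + LinearMap.mulLeft ℝ b ∘ₗ mon (k + 1) ε := by
      rw [← e]
      exact LinearMap.ext fun H => dx_mul _ _
    rw [this]
    exact add_mem (mul_mon_mem _ _ _) (mul_mon_mem _ _ _)
  · rw [LinearMap.comp_zero]; exact zero_mem _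
  · rw [LinearMap.comp_add]; exact add_mem hA hB
  · rw [LinearMap.comp_smul]; exact Submodule.smul_mem _ _ hA

theorem dt_mul_dtProd (ε : Fin n → Fin 2) (i : Fin n) {l : List (Fin n)} (hl : l.Nodup)
    (hi : i ∈ l) : ∃ c : ℝ, (dt i : Module.End ℝ (SF n)) * dtProd ε l
      = c • dtProd (Function.update ε i 1) l := by
  induction l with
  | nil => simp at hi
  | cons j l ih =>
    have hc : ∀ ε, dtProd ε (j :: l) = (dt j : Module.End ℝ (SF n)) ^ (ε j : ℕ) * dtProd ε l :=
      fun ε => by simp [dtProd]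
    rw [hc, hc]
    rw [List.nodup_cons] at hl
    by_cases h : i = j
    · subst h
      have e : dtProd (Function.update ε i 1) l = dtProd ε l := by
        unfold dtProd
        congr 1
        refine List.map_congr_left fun s hs => ?_
        rw [Function.update_of_ne]
        rintro rfl
        exact hl.1 hs
      rw [e, Function.update_self]
      rcases Fin.exists_fin_two.mp ⟨ε i, rfl⟩ with h0 | h0
      · exact ⟨1, by rw [h0]; simp⟩
      · refine ⟨0, ?_⟩
        have : (dt i : Module.End ℝ (SF n)) * dt i = 0 := LinearMap.ext fun H => dt_dt_self i H
        rw [h0, ← mul_assoc]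
        simp [this]
    · obtain ⟨c, hc⟩ := ih hl.2 (by simpa [h] using hi)
      rw [Function.update_of_ne (Ne.symm h)]
      rcases Fin.exists_fin_two.mp ⟨ε j, rfl⟩ with h0 | h0
      · exact ⟨c, by rw [h0]; simpa using hc⟩
      · refine ⟨-c, ?_⟩
        rw [h0]
        refine LinearMap.ext fun H => ?_
        have h2 : dt i (dtProd ε l H) = c • dtProd (Function.update ε i 1) l H :=
          LinearMap.congr_fun hc H
        change dt i (dt j (dtProd ε l H)) = -c • dt j (dtProd (Function.update ε i 1) l H)
        rw [dt_dt, h2, map_smul, neg_smul]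

theorem dt_comp_mem (i : Fin n) {A : SF n →ₗ[ℝ] SF n} (hA : A ∈ dOps (n := n)) :
    dt i ∘ₗ A ∈ dOps (n := n) := by
  refine dOps_induction (C := fun A => dt i ∘ₗ A ∈ dOps (n := n)) (fun b k ε => ?_) ?_
    (fun A B hA hB => ?_) (fun c A hA => ?_) hA
  · obtain ⟨c, hc⟩ := dt_mul_dtProd ε i (List.nodup_finRange n) (List.mem_finRange i)
    have hcomm : (dt i : Module.End ℝ (SF n)) * dx ^ k = dx ^ k * dt i :=
      (Commute.pow_right (show Commute (dt i : Module.End ℝ (SF n)) dx from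
        LinearMap.ext fun H => (dx_dt i H).symm) k).eq
    have e : dt i ∘ₗ mon k ε = c • mon k (Function.update ε i 1) := by
      rw [mon_eq, mon_eq, ← mul_smul_comm, ← hc, ← mul_assoc, ← hcomm, mul_assoc]
      rfl
    have : dt i ∘ₗ LinearMap.mulLeft ℝ b ∘ₗ mon k ε = LinearMap.mulLeft ℝ (dt i b) ∘ₗ mon k ε
        + c • (LinearMap.mulLeft ℝ (par b) ∘ₗ mon k (Function.update ε i 1)) := by
      rw [← LinearMap.comp_smul, ← e]
      exact LinearMap.ext fun H => dt_mul _ _ _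
    rw [this]
    exact add_mem (mul_mon_mem _ _ _) (Submodule.smul_mem _ _ (mul_mon_mem _ _ _))
  · rw [LinearMap.comp_zero]; exact zero_mem _
  · rw [LinearMap.comp_add]; exact add_mem hA hB
  · rw [LinearMap.comp_smul]; exact Submodule.smul_mem _ _ hA

theorem et_comp_mem (i : Fin n) {A : SF n →ₗ[ℝ] SF n} (hA : A ∈ dOps (n := n)) :
    et i ∘ₗ A ∈ dOps (n := n) := by
  rw [et, LinearMap.sub_comp, LinearMap.comp_assoc]
  exact sub_mem (dt_comp_mem i hA) (mul_comp_mem _ (dx_comp_mem hA))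

/-- The operator changing the sign of the odd variables in a list. -/
def flip : List (Fin n) → SF n →ₗ[ℝ] SF n
  | [] => LinearMap.id
  | j :: l => (LinearMap.id - (2 : ℝ) • (LinearMap.mulLeft ℝ (th j) ∘ₗ dt j)) ∘ₗ flip l

theorem flip_cons (j : Fin n) (l : List (Fin n)) (F : SF n) :
    flip (j :: l) F = flip l F - (2 : ℝ) • (th j * dt j (flip l F)) := rfl

theorem flip_th_mul (j : Fin n) {l : List (Fin n)} (hl : l.Nodup) (F : SF n) :
    flip l (th j * F) = if j ∈ l then -(th j * flip l F) else th j * flip l F := by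
  induction l with
  | nil => rfl
  | cons s l ih =>
    rw [List.nodup_cons] at hl
    rw [flip_cons, flip_cons, ih hl.2]
    by_cases h : j = s
    · subst h
      simp only [hl.1, if_false, List.mem_cons, true_or, if_true, dt_th_mul, mul_sub, th_sq_mul,
        mul_smul_comm, smul_zero, sub_zero]
      module
    · have h' : ¬ s = j := Ne.symm h
      by_cases hj : j ∈ l
      · simp only [hj, if_true, List.mem_cons, or_true, map_neg, dt_th_mul, h', if_false, mul_sub,
          mul_smul_comm, th_mul_th_mul s j, zero_sub, mul_neg]
        module
      · simp only [hj, if_false, List.mem_cons, or_false, h, dt_th_mul, h', mul_sub,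
          mul_smul_comm, th_mul_th_mul s j, zero_sub, mul_neg]
        module

theorem flip_x_mul (l : List (Fin n)) (F : SF n) : flip l (x * F) = x * flip l F := by
  induction l with
  | nil => rfl
  | cons s l ih =>
    rw [flip_cons, flip_cons, ih, dt_x_mul, th_mul_x_mul, mul_sub, mul_smul_comm]

theorem flip_one (l : List (Fin n)) : flip l (1 : SF n) = 1 := by
  induction l with
  | nil => rfl
  | cons s l ih => rw [flip_cons, ih]; simp

/-- Parity is the product of the operators 1 - 2θⱼ∂ⱼ, hence a differential operator. So sign factors
and twists by parity do not leave the class of differential operators. -/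
theorem par_eq_flip : (par : SF n →ₗ[ℝ] SF n) = flip (List.finRange n) := by
  refine LinearMap.ext fun F => ?_
  induction F using induction_left with
  | one => rw [par_one, flip_one]
  | add F G hF hG => rw [map_add, map_add, hF, hG]
  | smul c F hF => rw [map_smul, map_smul, hF]
  | coord F hF => rw [par_mul, par_x, hF, flip_x_mul]
  | odd j F hF =>
    rw [par_mul, par_th, hF, flip_th_mul j (List.nodup_finRange n), if_pos (List.mem_finRange j),
      neg_mul]

theorem par_comp_mem {A : SF n →ₗ[ℝ] SF n} (hA : A ∈ dOps (n := n)) :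
    par ∘ₗ A ∈ dOps (n := n) := by
  rw [par_eq_flip]
  generalize List.finRange n = l
  induction l with
  | nil => exact hA
  | cons j l ih =>
    rw [flip, LinearMap.comp_assoc, LinearMap.sub_comp, LinearMap.smul_comp, LinearMap.id_comp,
      LinearMap.comp_assoc]
    exact sub_mem ih (Submodule.smul_mem _ _ (mul_comp_mem _ (dt_comp_mem j ih)))

theorem kerOp_mem (i : Fin n) (p q r : ℝ) : kerOp i p q r ∈ dOps (n := n) :=
  add_mem (add_mem (Submodule.smul_mem _ _ (mul_comp_mem _ id_mem))
    (Submodule.smul_mem _ _ (dt_comp_mem i id_mem)))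
    (Submodule.smul_mem _ _ (mul_comp_mem _ (dt_comp_mem i id_mem)))

/-! ### Bilinear differential operators -/

/-- The bilinear operator `(G, H) ↦ S(G) T(H)`. -/
def mulBi (S T : SF n →ₗ[ℝ] SF n) : SF n →ₗ[ℝ] SF n →ₗ[ℝ] SF n :=
  (LinearMap.mul ℝ (SF n)).compl₁₂ S T

/-- The space of bilinear differential operators. -/
def bOps : Submodule ℝ (SF n →ₗ[ℝ] SF n →ₗ[ℝ] SF n) :=
  Submodule.span ℝ {B | ∃ (a : SF n) (k l : ℕ) (ε ε' : Fin n → Fin 2),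
    B = (mulBi (mon k ε) (mon l ε')).compr₂ (LinearMap.mulLeft ℝ a)}

theorem mul_mulBi_mon_mem (a : SF n) (k l : ℕ) (ε ε' : Fin n → Fin 2) :
    (mulBi (mon k ε) (mon l ε')).compr₂ (LinearMap.mulLeft ℝ a) ∈ bOps (n := n) :=
  Submodule.subset_span ⟨a, k, l, ε, ε', rfl⟩

theorem mul_comp_mem_bOps (a : SF n) {B : SF n →ₗ[ℝ] SF n →ₗ[ℝ] SF n} (hB : B ∈ bOps (n := n)) :
    B.compr₂ (LinearMap.mulLeft ℝ a) ∈ bOps (n := n) := by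
  refine Submodule.span_induction
    (p := fun (B : SF n →ₗ[ℝ] SF n →ₗ[ℝ] SF n) _ =>
      B.compr₂ (LinearMap.mulLeft ℝ a) ∈ bOps (n := n)) ?_ ?_ ?_ ?_ hB
  · rintro _ ⟨b, k, l, ε, ε', rfl⟩
    have := mul_mulBi_mon_mem (a * b) k l ε ε'
    rw [LinearMap.mulLeft_mul] at this
    exact this
  · have : (0 : SF n →ₗ[ℝ] SF n →ₗ[ℝ] SF n).compr₂ (LinearMap.mulLeft ℝ a) = 0 :=
      LinearMap.ext fun G => LinearMap.ext fun H => mul_zero _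
    rw [this]; exact zero_mem _
  · intro B C _ _ hB hC
    have : (B + C).compr₂ (LinearMap.mulLeft ℝ a)
        = B.compr₂ (LinearMap.mulLeft ℝ a) + C.compr₂ (LinearMap.mulLeft ℝ a) :=
      LinearMap.ext fun G => LinearMap.ext fun H => mul_add _ _ _
    rw [this]; exact add_mem hB hC
  · intro c B _ hB
    have : (c • B).compr₂ (LinearMap.mulLeft ℝ a) = c • B.compr₂ (LinearMap.mulLeft ℝ a) :=
      LinearMap.ext fun G => LinearMap.ext fun H =>
        show a * (c • B G H) = c • (a * B G H) from mul_smul_comm _ _ _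
    rw [this]; exact Submodule.smul_mem _ _ hB

theorem sub_mem_bOps {A B : SF n →ₗ[ℝ] SF n →ₗ[ℝ] SF n} (hA : A ∈ bOps (n := n))
    (hB : B ∈ bOps (n := n)) : A - B ∈ bOps (n := n) := by
  have : A - B = A + (-1 : ℝ) • B := LinearMap.ext fun G => LinearMap.ext fun H => by
    simp only [LinearMap.sub_apply, LinearMap.add_apply, LinearMap.smul_apply]
    module
  rw [this]
  exact add_mem hA (Submodule.smul_mem _ _ hB)

theorem mulBi_mon_mem {S : SF n →ₗ[ℝ] SF n} (hS : S ∈ dOps (n := n)) (l : ℕ)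
    (ε' : Fin n → Fin 2) : mulBi S (mon l ε') ∈ bOps (n := n) := by
  refine dOps_induction (C := fun S => mulBi S (mon l ε') ∈ bOps (n := n)) (fun b k ε => ?_) ?_
    (fun A B hA hB => ?_) (fun c A hA => ?_) hS
  · have : mulBi (LinearMap.mulLeft ℝ b ∘ₗ mon k ε) (mon l ε')
        = (mulBi (mon k ε) (mon l ε')).compr₂ (LinearMap.mulLeft ℝ b) :=
      LinearMap.ext fun G => LinearMap.ext fun H => mul_assoc _ _ _
    rw [this]; exact mul_mulBi_mon_mem _ _ _ _ _
  · have : mulBi 0 (mon l ε') = 0 := LinearMap.ext fun G => LinearMap.ext fun H => zero_mul _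
    rw [this]; exact zero_mem _
  · have : mulBi (A + B) (mon l ε') = mulBi A (mon l ε') + mulBi B (mon l ε') :=
      LinearMap.ext fun G => LinearMap.ext fun H => add_mul _ _ _
    rw [this]; exact add_mem hA hB
  · have : mulBi (c • A) (mon l ε') = c • mulBi A (mon l ε') :=
      LinearMap.ext fun G => LinearMap.ext fun H =>
        show c • A G * mon l ε' H = c • (A G * mon l ε' H) from smul_mul_assoc _ _ _
    rw [this]; exact Submodule.smul_mem _ _ hA

/-- A coefficient of T must be moved to the left of S(G); for its odd part this replaces S by par ∘
S. -/
theorem mulBi_mem {S T : SF n →ₗ[ℝ] SF n} (hS : S ∈ dOps (n := n)) (hT : T ∈ dOps (n := n)) :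
    mulBi S T ∈ bOps (n := n) := by
  refine dOps_induction (C := fun T => mulBi S T ∈ bOps (n := n)) (fun b k ε => ?_) ?_
    (fun A B hA hB => ?_) (fun c A hA => ?_) hT
  · obtain ⟨b₀, b₁, h₀, h₁, rfl⟩ := exists_even_add_odd b
    have : mulBi S (LinearMap.mulLeft ℝ (b₀ + b₁) ∘ₗ mon k ε)
        = (mulBi S (mon k ε)).compr₂ (LinearMap.mulLeft ℝ b₀)
          + (mulBi (par ∘ₗ S) (mon k ε)).compr₂ (LinearMap.mulLeft ℝ b₁) := by
      refine LinearMap.ext fun G => LinearMap.ext fun H => ?_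
      change S G * ((b₀ + b₁) * mon k ε H) = b₀ * (S G * mon k ε H) + b₁ * (par (S G) * mon k ε H)
      rw [add_mul, mul_add, ← mul_assoc, ← mul_comm_of_even h₀, ← mul_assoc (S G) b₁]
      have : S G * b₁ = b₁ * par (S G) := by rw [mul_comm_of_odd h₁, par_par]
      rw [this, mul_assoc, mul_assoc]
    rw [this]
    exact add_mem (mul_comp_mem_bOps _ (mulBi_mon_mem hS _ _))
      (mul_comp_mem_bOps _ (mulBi_mon_mem (par_comp_mem hS) _ _))
  · have : mulBi S 0 = 0 := LinearMap.ext fun G => LinearMap.ext fun H => mul_zero _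
    rw [this]; exact zero_mem _
  · have : mulBi S (A + B) = mulBi S A + mulBi S B :=
      LinearMap.ext fun G => LinearMap.ext fun H => mul_add _ _ _
    rw [this]; exact add_mem hA hB
  · have : mulBi S (c • A) = c • mulBi S A :=
      LinearMap.ext fun G => LinearMap.ext fun H =>
        show S G * (c • A H) = c • (S G * A H) from mul_smul_comm _ _ _
    rw [this]; exact Submodule.smul_mem _ _ hA

/-! ### Cocycles that are coboundaries on a subalgebra of codimension one -/

section restriction

variable {lam mu : ℝ} {i : Fin n} {U : SF n →ₗ[ℝ] SF n →ₗ[ℝ] SF n} {b : SF n →ₗ[ℝ] SF n}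

theorem twC_eq_zero_of_ker {X : SF n →ₗ[ℝ] SF n →ₗ[ℝ] SF n} (hX : ∀ F, dt i F = 0 → X F = 0)
    {F : SF n} (hF : dt i F = 0) : twC X F = 0 := by
  refine LinearMap.ext fun H => ?_
  rw [twC_apply, hX F hF, hX (par F) (by rw [dt_par, hF, map_zero, neg_zero])]
  simp

theorem isClean_twC_sub_cobL (hU : IsClean lam mu (twC U)) (b : SF n →ₗ[ℝ] SF n) :
    IsClean lam mu (twC (U - cobL lam mu b)) := by
  rw [twC_sub, twC_cobL]
  exact hU.sub (isClean_adj _ _ _)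

theorem eq_cobL_add {b' : SF n →ₗ[ℝ] SF n}
    (h : twC (U - cobL lam mu b) = adj lam mu (twOp b')) : U = cobL lam mu (b + b') := by
  have : U - cobL lam mu b = cobL lam mu b' := by rw [← twC_twC (U - cobL lam mu b), h]; rfl
  rw [cobL_add]
  refine LinearMap.ext fun F => LinearMap.ext fun H => ?_
  exact sub_eq_iff_eq_add'.mp (LinearMap.congr_fun (LinearMap.congr_fun this F) H)

theorem cobL_sub (b c : SF n →ₗ[ℝ] SF n) :
    cobL lam mu (b - c) = cobL lam mu b - cobL lam mu c := by
  refine LinearMap.ext fun F => LinearMap.ext fun H => ?_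
  simp only [cobL, twC_apply, adj_apply, twOp_apply, map_add, map_sub, map_smul,
    LinearMap.sub_apply, par_act, par_par]
  module

/-- After subtracting δb the cocycle vanishes on the subalgebra. The hypothesis `hfull` isolates the
only point at which n > 3, n = 3 and the exceptional weights differ. -/
theorem exists_eq_cobL {j l : Fin n} (hU : IsClean lam mu (twC U)) (hb : b ∈ dOps (n := n))
    (h : ∀ F, dt i F = 0 → U F = cobL lam mu b F) (hj : j ≠ i) (hl : l ≠ i) (hjl : j ≠ l)
    (hfull : ∀ {V : SF n →ₗ[ℝ] SF n →ₗ[ℝ] SF n}, V = twC (U - cobL lam mu b) →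
      IsInv lam mu i (V (th i) ∘ₗ par) → ∀ s, s ≠ i → ∀ K, ev (V (th i) (par (th s * K))) = 0) :
    ∃ b ∈ dOps (n := n), U = cobL lam mu b := by
  have hV := isClean_twC_sub_cobL hU b
  have h0 : ∀ F, dt i F = 0 → twC (U - cobL lam mu b) F = 0 := fun F hF =>
    twC_eq_zero_of_ker (fun F hF => by rw [LinearMap.sub_apply, h F hF, sub_self]) hF
  obtain ⟨p, q, r, e⟩ := hV.eq_adj_kerOp h0 hj hl hjl (hfull rfl (isInv_of_isClean hV h0))
  exact ⟨_, add_mem hb (kerOp_mem i p q r), eq_cobL_add e⟩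

end restriction

theorem isCoboundaryOn_iff {lam mu : ℝ} {h : Submodule ℝ (SFun n)}
    {U : SF n →ₗ[ℝ] SF n →ₗ[ℝ] SF n} : IsCoboundaryOn (n := n) lam mu h U
      ↔ ∃ b ∈ dOps (n := n), ∀ F : SF n, Membership.mem h F → U F = cobL lam mu b F := by
  refine exists_congr fun b => and_congr Iff.rfl (forall_congr' fun F => imp_congr Iff.rfl ?_)
  rw [LinearMap.ext_iff]
  constructor
  · intro h
    exact LinearMap.ext fun H => (h H).trans (coboundary_apply lam mu b F H)
  · intro h H
    exact (LinearMap.congr_fun h H).trans (coboundary_apply lam mu b F H).symm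

theorem isCoboundary_iff {lam mu : ℝ} {U : SF n →ₗ[ℝ] SF n →ₗ[ℝ] SF n} :
    IsCoboundary (n := n) lam mu U ↔ ∃ b ∈ dOps (n := n), U = cobL lam mu b := by
  refine isCoboundaryOn_iff.trans (exists_congr fun b => and_congr Iff.rfl ?_)
  rw [LinearMap.ext_iff]
  exact forall_congr' fun F => ⟨fun h => h trivial, fun h _ => h⟩

theorem isCoboundaryOn_subK_iff {lam mu : ℝ} {i : Fin n} {U : SF n →ₗ[ℝ] SF n →ₗ[ℝ] SF n} :
    IsCoboundaryOn (n := n) lam mu (subK n i) U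
      ↔ ∃ b ∈ dOps (n := n), ∀ F : SF n, dt i F = 0 → U F = cobL lam mu b F :=
  isCoboundaryOn_iff

theorem isClean_of_isDiffCocycle {lam mu : ℝ} {U : SF n →ₗ[ℝ] SF n →ₗ[ℝ] SF n}
    (hU : IsDiffCocycle (n := n) lam mu U) : IsClean lam mu (twC U) :=
  isClean_twC fun F G H => LinearMap.congr_fun (hU.2 F G) H

theorem isCoboundaryOn_subK {lam mu : ℝ} {U : Cochain n} (h : IsCoboundary lam mu U)
    (i : Fin n) : IsCoboundaryOn lam mu (subK n i) U := by
  obtain ⟨b, hb, h⟩ := h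
  exact ⟨b, hb, fun F _ => h F trivial⟩

theorem isCoboundary_iff_of_three_lt (hn : 3 < n) {lam mu : ℝ} {U : Cochain n}
    (hU : IsDiffCocycle lam mu U) :
    IsCoboundary lam mu U ↔ ∃ i : Fin n, IsCoboundaryOn lam mu (subK n i) U := by
  refine ⟨fun h => ⟨⟨0, by omega⟩, isCoboundaryOn_subK h _⟩, ?_⟩
  rintro ⟨i, h⟩
  obtain ⟨b, hb, h⟩ := isCoboundaryOn_subK_iff.mp h
  have hcard : 3 ≤ (Finset.univ.erase i).card := by
    rw [Finset.card_erase_of_mem (Finset.mem_univ i), Finset.card_univ, Fintype.card_fin]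
    omega
  -- At least three indices differ from i, so each s ≠ i belongs to a triple defining a cubic field
  -- of the subalgebra.
  have key : ∀ s : Fin n, s ≠ i → ∃ a c, a ≠ i ∧ c ≠ i ∧ s ≠ a ∧ s ≠ c ∧ a ≠ c := by
    intro s hs
    have : 1 < ((Finset.univ.erase i).erase s).card := by
      rw [Finset.card_erase_of_mem (Finset.mem_erase.mpr ⟨hs, Finset.mem_univ s⟩)]
      omega
    obtain ⟨a, ha, c, hc, hac⟩ := Finset.one_lt_card.mp this
    simp only [Finset.mem_erase, Finset.mem_univ, and_true] at ha hc
    exact ⟨a, c, ha.2, hc.2, Ne.symm ha.1, Ne.symm hc.1, hac⟩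
  obtain ⟨s, hs⟩ := Finset.card_pos.mp (show 0 < (Finset.univ.erase i).card by omega)
  obtain ⟨a, c, ha, hc, -, -, hac⟩ := key s (Finset.ne_of_mem_erase hs)
  refine isCoboundary_iff.mpr (exists_eq_cobL (isClean_of_isDiffCocycle hU) hb h ha hc hac ?_)
  intro V _ hB s hs K
  obtain ⟨a, c, ha, hc, hsa, hsc, hac⟩ := key s hs
  exact hB.ev_th_mul_eq_zero hs ha hc hsa hsc hac K

/-- For `n = 3`, the components along the odd variables other than `θᵢ` are determined by one
number. -/
theorem IsInv.ev_th_mul_eq_zero_of_three {lam mu : ℝ} {i j l : Fin n} {B : SF n →ₗ[ℝ] SF n}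
    (hB : IsInv lam mu i B) (hj : j ≠ i) (hl : l ≠ i) (hjl : j ≠ l)
    (hs : ∀ s, s = i ∨ s = j ∨ s = l)
    (hex : lam = -1 / 2 → mu = 0 → ev (B (th j * th l)) = 0) (s : Fin n) (hsi : s ≠ i) (K : SF n) :
    ev (B (th s * K)) = 0 := by
  rcases hs s with rfl | rfl | rfl
  · exact absurd rfl hsi
  · rw [hB.rot_ev hj hl hjl]
    exact hB.ev_th_th_mul_eq_zero hj hl hjl hs hex _
  · rw [hB.rot_ev hl hj (Ne.symm hjl), th_mul_th_mul, map_neg, map_neg,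
      hB.ev_th_th_mul_eq_zero hj hl hjl hs hex, neg_zero]

theorem fin_three_exists (i : Fin 3) : ∃ j l, j ≠ i ∧ l ≠ i ∧ j ≠ l
    ∧ ∀ s, s = i ∨ s = j ∨ s = l := by
  revert i; decide

theorem isCoboundary_iff_of_generic {lam mu : ℝ} (hlm : ¬(lam = -1 / 2 ∧ mu = 0)) {U : Cochain 3}
    (hU : IsDiffCocycle lam mu U) :
    IsCoboundary lam mu U ↔ ∃ i : Fin 3, IsCoboundaryOn lam mu (subK 3 i) U := by
  refine ⟨fun h => ⟨0, isCoboundaryOn_subK h _⟩, ?_⟩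
  rintro ⟨i, h⟩
  obtain ⟨b, hb, h⟩ := isCoboundaryOn_subK_iff.mp h
  obtain ⟨j, l, hj, hl, hjl, hs⟩ := fin_three_exists i
  refine isCoboundary_iff.mpr (exists_eq_cobL (isClean_of_isDiffCocycle hU) hb h hj hl hjl ?_)
  intro V _ hB
  exact hB.ev_th_mul_eq_zero_of_three hj hl hjl hs fun h h' => absurd ⟨h, h'⟩ hlm

/-! ### The exceptional cocycle -/

theorem et_act (c : ℝ) (k : Fin n) (F H : SF n) : et k (act c F H)
    = act c (par F) (et k H) - (1 / 2 : ℝ) • ∑ s, et k (et s (par F)) * et s H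
      + c • (et k (dx F) * H) := by
  have e : ∀ s, et k (et s (par F) * et s H) = et k (et s (par F)) * et s H
      + (et s F * et s (et k H) + if k = s then (2 : ℝ) • (et s F * dx H) else 0) := by
    intro s
    have h : et k (et s H) = -et s (et k H) + if k = s then -(2 : ℝ) • dx H else 0 := by
      rw [← et_et k s H]; abel
    have h' : par (et s (par F)) = -et s F := by rw [et_par, map_neg, par_par]
    rw [et_mul, h, h']
    split_ifs
    · rw [mul_add, neg_mul, neg_mul, mul_smul_comm, mul_neg]; module
    · rw [mul_add, neg_mul, neg_mul, mul_neg, mul_zero]; module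
  simp only [act_apply, map_add, map_sub, map_smul, map_sum, e, Finset.sum_add_distrib,
    Finset.sum_ite_eq, Finset.mem_univ, if_true, par_par]
  rw [et_mul, et_mul, dx_et, dx_par]
  module

theorem cobL_apply_of_odd (lam mu : ℝ) {b : SF n →ₗ[ℝ] SF n} (hb : ∀ H, par (b H) = -b (par H))
    (G H : SF n) : cobL lam mu b G H = act mu (par G) (b H) - b (act lam G H) := by
  have h : ∀ H, b (par H) = -par (b H) := fun H => by rw [hb, neg_neg]
  simp only [cobL, twC_apply, adj_apply, twOp_apply, map_add, map_sub, map_smul, h, par_act,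
    par_par, map_neg]
  module

/-- The hypothesis says that M is a cocycle with values in densities of weight ½; its last three
terms are the action of G on M F with the factors interchanged. Multiplication by such a density
maps weight -½ to weight 0. -/
theorem isClean_of_bracket {M : SF n →ₗ[ℝ] SF n} (hpar : ∀ G, par (M G) = -M (par G))
    (hM : ∀ F G, M (act (-1) F G) = act (1 / 2) (par F) (M G) - dx (M F) * G
      + (1 / 2 : ℝ) • ∑ s, par (et s (M F)) * et s G - (1 / 2 : ℝ) • (M F * dx G)) :
    IsClean (-1 / 2) 0 ((LinearMap.mul ℝ (SF n)).compl₁₂ (M ∘ₗ par) par) where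
  even {F} hF G H := by
    have hm : par (M F) = -M F := by rw [hpar, hF]
    have key : ∀ H, act 0 G (M F * H) = (dx (M F) * par G
        - (1 / 2 : ℝ) • ∑ s, et s (M F) * et s (par G)) * H + M F * act 0 (par G) H := by
      intro H
      have e : ∀ s, et s (par G) * et s (M F * H)
          = et s (M F) * et s (par G) * H + M F * (et s G * et s H) := by
        intro s
        have h : et s (par G) * M F = -(M F * et s G) := by
          rw [et_par, neg_mul, ← mul_comm_of_odd hm]
        rw [et_mul, mul_add, ← mul_assoc, mul_comm_of_even (par_et_of_odd hm s), hm, neg_mul,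
          mul_neg, ← mul_assoc (et s (par G)), h, neg_mul, neg_neg, mul_assoc (M F)]
      have hdm : par (dx (M F)) = -dx (M F) := by rw [← dx_par, hm, map_neg]
      have e1 : ∀ Z, G * (M F * Z) = M F * (par G * Z) := fun Z => by
        rw [← mul_assoc, ← mul_assoc, mul_comm_of_odd hm, par_par]
      have e2 : ∀ Z, G * (dx (M F) * Z) = dx (M F) * (par G * Z) := fun Z => by
        rw [← mul_assoc, ← mul_assoc, mul_comm_of_odd hdm, par_par]
      simp only [act_apply, e, Finset.sum_add_distrib, dx_mul, mul_add, e1, e2, zero_smul, add_zero,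
        ← Finset.sum_mul, ← Finset.mul_sum, par_par, sub_mul, mul_sub, smul_mul_assoc,
        mul_smul_comm]
      simp only [mul_assoc]
      module
    change M (par (act (-1) F G)) * par H = act 0 F (M (par G) * par H)
      - M (par G) * par (act (-1 / 2) F H)
      - (act 0 G (M (par F) * par H) - M (par F) * par (act (-1 / 2) G H))
    have hdF : par (dx F) = dx F := by rw [← dx_par, hF]
    have e3 : M (par G) * (dx F * par H) = dx F * (M (par G) * par H) := by
      rw [← mul_assoc, ← mul_assoc, mul_comm_of_even hdF]
    simp only [par_act, hF]
    simp only [hM, hF, even_act_mul hF, key, act_eq (-1 / 2), act_eq (1 / 2), dx_par]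
    simp only [par_et_of_odd hm, add_mul, sub_mul, mul_add, smul_mul_assoc, mul_smul_comm, e3,
      mul_assoc]
    module
  odd {F G} hF hG H := by
    have hm : ∀ {F}, par F = -F → par (M F) = M F := fun hF => by rw [hpar, hF, map_neg, neg_neg]
    have key : ∀ H, act 0 G (M F * H) = (dx (M F) * G
        - (1 / 2 : ℝ) • ∑ s, par (et s (M F)) * et s G) * H + M F * act 0 G H := by
      intro H
      have hdm : par (dx (M F)) = dx (M F) := by rw [← dx_par, hm hF]
      have e : ∀ s, et s (par G) * et s (M F) = par (et s (M F)) * et s G := fun s => by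
        rw [par_et_of_even (hm hF), hG, map_neg, neg_mul, neg_mul,
          mul_comm_of_even (par_et_of_odd hG s)]
      rw [act_mul_even (hm hF)]
      congr 2
      simp only [act_apply, e, zero_smul, add_zero, mul_comm_of_even hdm]
    change M (par (act (-1) F G)) * par H = act 0 F (M (par G) * par H)
      + M (par G) * par (act (-1 / 2) F H)
      + (act 0 G (M (par F) * par H) + M (par F) * par (act (-1 / 2) G H))
    have e3 : M G * (dx F * par H) = dx F * (M G * par H) := by
      rw [← mul_assoc, ← mul_assoc, mul_comm_of_even (hm hG)]
    have hbr : par (act (-1) F G) = act (-1) F G := by rw [par_act, hF, hG]; simp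
    rw [hbr, hM]
    simp only [par_act, hF, hG, map_neg, LinearMap.neg_apply, mul_neg]
    simp only [neg_mul, map_neg, key,
      act_mul_even (hm hG), act_eq (-1 / 2), act_eq (1 / 2)]
    simp only [add_mul, sub_mul, mul_add, smul_mul_assoc, mul_smul_comm, e3, mul_assoc, neg_mul]
    module

/-- The operator `θᵢ ηⱼ ηₖ`. -/
def tripleOp (i j k : Fin n) : SF n →ₗ[ℝ] SF n := LinearMap.mulLeft ℝ (th i) ∘ₗ et j ∘ₗ et k

theorem tripleOp_apply (i j k : Fin n) (H : SF n) : tripleOp i j k H = th i * et j (et k H) := rfl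

theorem tripleOp_mem (i j k : Fin n) : tripleOp i j k ∈ dOps (n := n) := by
  have := mul_comp_mem (th i) (et_comp_mem j (et_comp_mem k id_mem))
  rwa [LinearMap.comp_id] at this

theorem sum_fin_three {M : Type*} [AddCommMonoid M] {i j k : Fin 3} (hij : i ≠ j) (hik : i ≠ k)
    (hjk : j ≠ k) (f : Fin 3 → M) : ∑ s, f s = f i + f j + f k := by
  have : (Finset.univ : Finset (Fin 3)) = {i, j, k} := by
    revert i j k; decide
  rw [this, Finset.sum_insert (by simp [hij, hik]), Finset.sum_insert (by simp [hjk]),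
    Finset.sum_singleton, add_assoc]

theorem cobL_tripleOp {i j k : Fin 3} (hij : i ≠ j) (hik : i ≠ k) (hjk : j ≠ k) (G H : SF 3) :
    cobL (-1 / 2) 0 (tripleOp i j k) G H = (1 / 2 : ℝ) • (-(dt i G * et j (et k H))
      + th i * (et j (et i G) * et i (et k H) + et k (et i G) * et j (et i H)
        - par (et j (et k (et i G))) * et i H + et j (et k (dx G)) * H)) := by
  have hd : dt i G = et i G + th i * dx G := by rw [et_apply, sub_add_cancel]
  rw [cobL_apply_of_odd]
  · simp only [tripleOp_apply, act_th_mul_eq, et_act, sum_fin_three hij hik hjk, map_add, map_sub,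
      map_smul, et_mul, par_par, et_par, map_neg, hd]
    simp only [act_eq (-1 / 2)]
    simp only [dx_par, et_et_swap (Ne.symm hij), et_et_swap (Ne.symm hik), et_et_swap (Ne.symm hjk),
      et_et_self, map_neg, dx_et, et_par, mul_add, mul_sub, add_mul,
      mul_neg, neg_mul, neg_neg, mul_smul_comm, mul_assoc]
    module
  · intro H
    simp only [tripleOp_apply, par_mul, par_th, et_par, map_neg, neg_mul, neg_neg]

/-- The operator `η₁ η₂ η₃`. -/
def vol : SF 3 →ₗ[ℝ] SF 3 := et 0 ∘ₗ et 1 ∘ₗ et 2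

theorem vol_apply (G : SF 3) : vol G = et 0 (et 1 (et 2 G)) := rfl

theorem par_vol (G : SF 3) : par (vol G) = -vol (par G) := by
  simp only [vol_apply, et_par, map_neg, neg_neg]

theorem sum_fin (f : Fin 3 → SF 3) : ∑ s, f s = f 0 + f 1 + f 2 := Fin.sum_univ_three f

theorem vol_bracket (F G : SF 3) : vol (act (-1) F G) = act (1 / 2) (par F) (vol G) - dx (vol F) * G
      + (1 / 2 : ℝ) • ∑ s, par (et s (vol F)) * et s G - (1 / 2 : ℝ) • (vol F * dx G) := by
  simp only [vol_apply, et_act, sum_fin, map_add, map_sub, map_smul, et_mul, par_par, et_par,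
    map_neg]
  rw [act_eq (-1), act_eq (1 / 2)]
  simp only [dx_par, et_et_swap (show (1 : Fin 3) ≠ 0 by decide),
    et_et_swap (show (2 : Fin 3) ≠ 0 by decide), et_et_swap (show (2 : Fin 3) ≠ 1 by decide),
    et_et_self, map_neg, dx_et, par_par, et_par, mul_neg, neg_mul, neg_neg]
  module

/-- The cochain `G ↦ -η₁η₂η₃(G)`. -/
def volC : SF 3 →ₗ[ℝ] SF 3 →ₗ[ℝ] SF 3 := -(LinearMap.mul ℝ (SF 3)).compl₁₂ vol LinearMap.id

theorem volC_apply (G H : SF 3) : volC G H = -(vol G * H) := rfl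

theorem twC_volC : twC volC = (LinearMap.mul ℝ (SF 3)).compl₁₂ (vol ∘ₗ par) par := by
  refine LinearMap.ext fun G => LinearMap.ext fun H => ?_
  change twC volC G H = vol (par G) * par H
  simp only [twC_apply, volC_apply, map_neg, par_mul, par_vol, par_par, neg_mul, neg_neg]
  module

theorem isClean_volC : IsClean (-1 / 2) 0 (twC volC) := by
  rw [twC_volC]
  exact isClean_of_bracket par_vol vol_bracket

/-- The exceptional cocycle. -/
def exc : SF 3 →ₗ[ℝ] SF 3 →ₗ[ℝ] SF 3 := exceptionalCochain

theorem exc_apply (G H : SF 3) : exc G H = dt 2 G * et 0 (et 1 H)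
    - et 0 (et 1 (dt 2 G)) * (H - th 2 * dt 2 H)
    - th 2 * (et 0 (par (et 2 (par G))) * et 1 (et 2 H)
      - et 1 (par (et 2 (par G))) * et 0 (et 2 H)) := rfl

/-- The given formula is the symmetric cocycle `volC` normalised by a coboundary; with this
normalisation it vanishes identically on the fields with ∂₃F = 0. -/
theorem exc_eq : exc = volC - cobL (-1 / 2) 0 ((2 : ℝ) • tripleOp 2 0 1) := by
  refine LinearMap.ext fun G => LinearMap.ext fun H => ?_
  have hG : et 2 G = dt 2 G - th 2 * dx G := rfl
  have hH : th 2 * et 2 H = th 2 * dt 2 H := th_mul_et _ _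
  have h2 : ∀ Y : SF 3, Y * (th 2 * dt 2 H) = th 2 * (par Y * dt 2 H) := fun Y => by
    rw [← mul_assoc, mul_th, mul_assoc]
  have h3 : ∀ Y : SF 3, th 2 * (Y * et 2 H) = th 2 * (Y * dt 2 H) := fun Y => by
    rw [et_apply, mul_sub, ← mul_assoc Y, mul_th, mul_assoc (th 2), mul_sub, th_sq_mul, sub_zero]
  rw [cobL_smul, LinearMap.sub_apply, LinearMap.sub_apply, LinearMap.smul_apply,
    LinearMap.smul_apply, cobL_tripleOp (by decide) (by decide) (by decide), volC_apply, vol_apply,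
    exc_apply]
  simp only [et_par, map_neg, par_par, mul_sub, h2, neg_mul, mul_neg, mul_add]
  rw [h3]
  simp only [et_et_swap (show (2 : Fin 3) ≠ 1 by decide) H, hG, map_sub, et_th_mul, sub_mul, mul_sub,
    mul_neg, mul_assoc]
  simp [par_mul, mul_assoc]
  module

/-- When ∂ᵢF = 0 one has ηᵢF = -θᵢF', and most terms of `cobL_tripleOp` die by θᵢ² = 0. The factor 2
cancels the ½ there. -/
theorem volC_eq_of_ker {i j k : Fin 3} (hij : i ≠ j) (hik : i ≠ k) (hjk : j ≠ k)
    (hvol : ∀ F : SF 3, vol F = et i (et j (et k F))) {F : SF 3} (hF : dt i F = 0) :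
    volC F = cobL (-1 / 2) 0 ((2 : ℝ) • tripleOp i j k) F := by
  refine LinearMap.ext fun H => ?_
  have h : et i F = -(th i * dx F) := by rw [et_apply, hF, zero_sub]
  have e : vol F = -(th i * et j (et k (dx F))) := by
    rw [hvol, et_et_swap hij, et_et_swap hik, map_neg, neg_neg, h]
    simp [et_th_mul, Ne.symm hij, Ne.symm hik]
  rw [cobL_smul, LinearMap.smul_apply, LinearMap.smul_apply, cobL_tripleOp hij hik hjk, volC_apply,
    e, h, hF]
  simp only [map_neg, et_th_mul, Ne.symm hij, Ne.symm hik, if_false, zero_sub, par_mul, par_th,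
    map_neg, neg_neg, mul_add, mul_sub, neg_mul, mul_assoc, th_sq_mul, zero_mul]
  module

theorem exc_eq_of_ker {i j k : Fin 3} (hij : i ≠ j) (hik : i ≠ k) (hjk : j ≠ k)
    (hvol : ∀ F : SF 3, vol F = et i (et j (et k F))) {F : SF 3} (hF : dt i F = 0) :
    exc F = cobL (-1 / 2) 0 ((2 : ℝ) • tripleOp i j k - (2 : ℝ) • tripleOp 2 0 1) F := by
  rw [exc_eq, LinearMap.sub_apply, volC_eq_of_ker hij hik hjk hvol hF, cobL_sub,
    LinearMap.sub_apply]

theorem exists_exc_eq_of_ker (i : Fin 3) :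
    ∃ b ∈ dOps (n := 3), ∀ F : SF 3, dt i F = 0 → exc F = cobL (-1 / 2) 0 b F := by
  have hmem : ∀ i j k : Fin 3, (2 : ℝ) • tripleOp i j k - (2 : ℝ) • tripleOp 2 0 1
      ∈ dOps (n := 3) := fun i j k =>
    sub_mem (Submodule.smul_mem _ _ (tripleOp_mem _ _ _)) (Submodule.smul_mem _ _ (tripleOp_mem _ _ _))
  have h10 := fun F : SF 3 => et_et_swap (show (1 : Fin 3) ≠ 0 by decide) F
  have h20 := fun F : SF 3 => et_et_swap (show (2 : Fin 3) ≠ 0 by decide) F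
  have h21 := fun F : SF 3 => et_et_swap (show (2 : Fin 3) ≠ 1 by decide) F
  have hv : ∃ j k, i ≠ j ∧ i ≠ k ∧ j ≠ k ∧ ∀ F : SF 3, vol F = et i (et j (et k F)) := by
    -- Even permutations of the indices are chosen, so that reordering η₁η₂η₃ produces no sign.
    fin_cases i
    · exact ⟨1, 2, by decide, by decide, by decide, fun F => rfl⟩
    · refine ⟨2, 0, by decide, by decide, by decide, fun F => ?_⟩
      simp [vol_apply, h10, h20]
    · refine ⟨0, 1, by decide, by decide, by decide, fun F => ?_⟩
      simp [vol_apply, h20, h21]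
  obtain ⟨j, k, hij, hik, hjk, hvol⟩ := hv
  exact ⟨_, hmem i j k, fun F hF => exc_eq_of_ker hij hik hjk hvol hF⟩

theorem isClean_exc : IsClean (-1 / 2) 0 (twC exc) := by
  rw [exc_eq]
  exact isClean_twC_sub_cobL isClean_volC _

theorem exc_mem : exc ∈ bOps (n := 3) := by
  have hd : ∀ i : Fin 3, dt i ∈ dOps (n := 3) := fun i => dt_comp_mem i id_mem
  have he : ∀ i : Fin 3, et i ∈ dOps (n := 3) := fun i => et_comp_mem i id_mem
  have hp : par ∈ dOps (n := 3) := par_comp_mem id_mem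
  have hpe : ∀ i : Fin 3, et i ∘ₗ par ∈ dOps (n := 3) := fun i => et_comp_mem i hp
  have e : exc = mulBi (dt 2) (et 0 ∘ₗ et 1)
      - mulBi (et 0 ∘ₗ et 1 ∘ₗ dt 2) (LinearMap.id - LinearMap.mulLeft ℝ (th 2) ∘ₗ dt 2)
      - (mulBi (et 0 ∘ₗ par ∘ₗ et 2 ∘ₗ par) (et 1 ∘ₗ et 2)
        - mulBi (et 1 ∘ₗ par ∘ₗ et 2 ∘ₗ par) (et 0 ∘ₗ et 2)).compr₂ (LinearMap.mulLeft ℝ (th 2)) :=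
    rfl
  rw [e]
  refine sub_mem_bOps (sub_mem_bOps (mulBi_mem (hd 2) (et_comp_mem _ (he 1))) (mulBi_mem
    (et_comp_mem _ (et_comp_mem _ (hd 2))) (sub_mem id_mem (mul_comp_mem _ (hd 2)))))
    (mul_comp_mem_bOps _ (sub_mem_bOps (mulBi_mem ?_ (et_comp_mem _ (he 2)))
      (mulBi_mem ?_ (et_comp_mem _ (he 2)))))
  · exact et_comp_mem _ (par_comp_mem (hpe 2))
  · exact et_comp_mem _ (par_comp_mem (hpe 2))

theorem par_exc_par (G H : SF 3) : par (exc (par G) (par H)) = -exc G H := by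
  simp only [exc_apply, map_sub, par_mul, par_th, et_par, dt_par, map_neg, par_par, neg_mul,
    mul_neg, neg_neg, mul_sub]
  abel

theorem twC_exc (G H : SF 3) : twC exc G H = par (exc G H) := by
  have h : exc (par G) (par H) = -par (exc G H) := by
    rw [← par_par (exc (par G) (par H)), par_exc_par, map_neg]
  rw [twC_apply, h, map_neg, par_par]
  module

theorem twC_exc_th (H : SF 3) : twC exc (th 2) (par H) = et 0 (et 1 H) := by
  rw [twC_exc, exc_apply]
  simp [et_par, et_th]

theorem isDiffCocycle_exceptionalCochain : IsDiffCocycle (-1 / 2) 0 exceptionalCochain :=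
  ⟨exc_mem, fun F G => LinearMap.ext fun H => coboundary₁_eq_zero isClean_exc F G H⟩

theorem cochainPart_exceptionalCochain :
    cochainPart 1 exceptionalCochain = exceptionalCochain := by
  refine LinearMap.ext fun (G : SF 3) => LinearMap.ext fun (H : SF 3) => ?_
  have : ((1 / 2 : ℝ) • (exc G H + sgn 1 • par (exc (par G) (par H))) : SF 3) = exc G H := by
    rw [par_exc_par, sgn_one]
    module
  exact this

theorem not_isCoboundary_exceptionalCochain :
    ¬ IsCoboundary (-1 / 2) 0 exceptionalCochain := by
  intro h
  obtain ⟨b, -, h⟩ := isCoboundary_iff.mp h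
  change exc = _ at h
  rw [exc_eq] at h
  have h1 : volC = cobL (-1 / 2) 0 (b + (2 : ℝ) • tripleOp 2 0 1) := by
    rw [cobL_add]
    exact LinearMap.ext fun F => LinearMap.ext fun H =>
      sub_eq_iff_eq_add.mp (LinearMap.congr_fun (LinearMap.congr_fun h F) H)
  have h2 := congrArg twC h1
  rw [twC_cobL, twC_volC] at h2
  -- The field of θ₁θ₂θ₃ vanishes at the origin and annihilates 1, so every coboundary evaluates to
  -- 0 here, whereas η₁η₂η₃(θ₁θ₂θ₃) is a nonzero constant.
  have h3 := congrArg ev (LinearMap.congr_fun (LinearMap.congr_fun h2 (th 0 * (th 1 * th 2))) 1)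
  rw [adj_apply, act_th_th_th _ (by decide) (by decide) (by decide),
    act_th_th_th _ (by decide) (by decide) (by decide)] at h3
  simp [vol_apply, par_mul, et_th_mul, et_th] at h3

theorem exists_eq_smul_exc_add {U : SF 3 →ₗ[ℝ] SF 3 →ₗ[ℝ] SF 3}
    (hU : IsClean (-1 / 2) 0 (twC U)) {b : SF 3 →ₗ[ℝ] SF 3} (hb : b ∈ dOps (n := 3))
    (h : ∀ F, dt 2 F = 0 → U F = cobL (-1 / 2) 0 b F) :
    ∃ c : ℝ, ∃ b ∈ dOps (n := 3), U - c • exc = cobL (-1 / 2) 0 b := by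
  -- At θ₁θ₂ the value of `exc` on θ₃ is η₁η₂(θ₁θ₂) = -1 at the origin, by `twC_exc_th`; the minus
  -- sign makes the remaining obstruction of U - c • exc vanish.
  refine ⟨-ev (twC (U - cobL (-1 / 2) 0 b) (th 2) (par (th 0 * th 1))), ?_⟩
  set c := ev (twC (U - cobL (-1 / 2) 0 b) (th 2) (par (th 0 * th 1))) with hc
  have hexc : ∀ F : SF 3, dt 2 F = 0 → exc F = 0 := fun F hF => by
    rw [exc_eq_of_ker (i := 2) (j := 0) (k := 1) (by decide) (by decide) (by decide) _ hF, sub_self]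
    · have := cobL_smul (-1 / 2) 0 0 (tripleOp (2 : Fin 3) 0 1)
      rw [zero_smul, zero_smul] at this
      rw [this]; rfl
    · intro F
      simp [vol_apply, et_et_swap (show (2 : Fin 3) ≠ 0 by decide),
        et_et_swap (show (2 : Fin 3) ≠ 1 by decide)]
  -- Since `exc` is zero on the fields with ∂₃F = 0, subtracting its multiple keeps the same
  -- primitive b there.
  refine exists_eq_cobL (i := 2) (j := 0) (l := 1) ?_ hb ?_ (by decide) (by decide) (by decide) ?_
  · rw [twC_sub, twC_smul]
    exact hU.sub (isClean_exc.smul _)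
  · intro F hF
    rw [LinearMap.sub_apply, LinearMap.smul_apply, hexc F hF, smul_zero, sub_zero, h F hF]
  · intro V hV hB
    refine hB.ev_th_mul_eq_zero_of_three (j := 0) (l := 1) (by decide) (by decide) (by decide) (by decide)
      fun _ _ => ?_
    have e : V (th 2) (par (th 0 * th 1)) = twC (U - cobL (-1 / 2) 0 b) (th 2) (par (th 0 * th 1))
        + c • twC exc (th 2) (par (th 0 * th 1)) := by
      rw [hV]
      simp only [twC_sub, twC_smul, LinearMap.sub_apply, LinearMap.smul_apply]
      module
    rw [LinearMap.comp_apply, e, twC_exc_th, map_add, ← hc]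
    simp [et_th_mul, et_th]

theorem exceptionalCochain_unique {U : Cochain 3} (hU : IsDiffCocycle (-1 / 2) 0 U)
    (hnt : ¬ IsCoboundary (-1 / 2) 0 U)
    (h : IsCoboundaryOn (-1 / 2) 0 (subK 3 2) U) :
    ∃ c : ℝ, c ≠ 0 ∧ ∃ b ∈ diffOps 3, ∀ F : SFun 3,
      U F = c • exceptionalCochain F + coboundary (-1 / 2) 0 b F := by
  obtain ⟨b, hb, h⟩ := isCoboundaryOn_subK_iff.mp h
  obtain ⟨c, b', hb', e⟩ := exists_eq_smul_exc_add (isClean_of_isDiffCocycle hU) hb h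
  refine ⟨c, ?_, b', hb', fun F => LinearMap.ext fun H => ?_⟩
  · rintro rfl
    refine hnt (isCoboundary_iff.mpr ⟨b', hb', ?_⟩)
    rw [← e, zero_smul]
    exact LinearMap.ext fun F => LinearMap.ext fun H => (sub_zero (U F H)).symm
  · have h1 := LinearMap.congr_fun (LinearMap.congr_fun e F) H
    have h2 := coboundary_apply (-1 / 2) 0 b' F H
    exact (sub_eq_iff_eq_add'.mp (h1.trans h2.symm))

end SF

end SuperContact

end

theorem mainTheorem4 :
    -- n = 3, generic weights
    (∀ lam mu : ℝ, ¬ (lam = -1 / 2 ∧ mu = 0) →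
      ∀ U : SuperContact.Cochain 3, SuperContact.IsDiffCocycle lam mu U →
        (SuperContact.IsCoboundary lam mu U ↔
          ∃ i : Fin 3, SuperContact.IsCoboundaryOn lam mu (SuperContact.subK 3 i) U)) ∧
    -- n > 3, all weights
    (∀ n : ℕ, 3 < n → ∀ lam mu : ℝ,
      ∀ U : SuperContact.Cochain n, SuperContact.IsDiffCocycle lam mu U →
        (SuperContact.IsCoboundary lam mu U ↔
          ∃ i : Fin n, SuperContact.IsCoboundaryOn lam mu (SuperContact.subK n i) U)) ∧
    -- n = 3, exceptional weights: the explicit cocycle is odd, nontrivial, trivial on each subalgebra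
    (SuperContact.IsDiffCocycle (-1 / 2) 0 SuperContact.exceptionalCochain ∧
      SuperContact.cochainPart 1 SuperContact.exceptionalCochain
        = SuperContact.exceptionalCochain ∧
      ¬ SuperContact.IsCoboundary (-1 / 2) 0 SuperContact.exceptionalCochain ∧
      ∀ i : Fin 3, SuperContact.IsCoboundaryOn (-1 / 2) 0 (SuperContact.subK 3 i)
        SuperContact.exceptionalCochain) ∧
    -- and it is unique up to a scalar factor and a coboundary
    (∀ U : SuperContact.Cochain 3, SuperContact.IsDiffCocycle (-1 / 2) 0 U →
      ¬ SuperContact.IsCoboundary (-1 / 2) 0 U →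
      (∀ i : Fin 3, SuperContact.IsCoboundaryOn (-1 / 2) 0 (SuperContact.subK 3 i) U) →
        ∃ c : ℝ, c ≠ 0 ∧ ∃ b ∈ SuperContact.diffOps 3, ∀ F : SuperContact.SFun 3,
          U F = c • SuperContact.exceptionalCochain F
            + SuperContact.coboundary (-1 / 2) 0 b F) := by
  refine ⟨fun lam mu h U hU => SuperContact.SF.isCoboundary_iff_of_generic h hU,
    fun n hn lam mu U hU => SuperContact.SF.isCoboundary_iff_of_three_lt hn hU,
    ⟨SuperContact.SF.isDiffCocycle_exceptionalCochain,
      SuperContact.SF.cochainPart_exceptionalCochain,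
      SuperContact.SF.not_isCoboundary_exceptionalCochain,
      fun i => SuperContact.SF.isCoboundaryOn_subK_iff.mpr
        (SuperContact.SF.exists_exc_eq_of_ker i)⟩,
    fun U hU hnt h => SuperContact.SF.exceptionalCochain_unique hU hnt (h 2)⟩
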